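/- Let $d\ge 2$ and $n\ge 1$ be integers such that $\Lambda_n=\{\lambda\in\mathbb Z^d:\|\lambda\|^2=n\}$ is non-empty, and let $\mathcal N_n=|\Lambda_n|$. Let $(a_\lambda)_{\lambda\in\Lambda_n}$ be complex random variables on a probability space $(\Omega,\mathcal F,\mathbb P)$ such that $\mathrm{Re}\,a_\lambda$ and $\mathrm{Im}\,a_\lambda$ are independent centred real Gaussian variables of variance $1/2$ for each $\lambda$, $a_{-\lambda}=\overline{a_\lambda}$, and the $a_\lambda$ are otherwise independent (i.e. independent along any set of frequencies containing no antipodal pair). Let $\mathbb T^d=\mathbb R^d/\mathbb Z^d$, and let $$f_n(x)=\frac1{\sqrt{\mathcal N_n}}\sum_{\lambda\in\Lambda_n}a_\lambda e^{2\pi i\langle\lambda,x\rangle},\qquad f_{n,k}=\frac{\partial_k f_n}{2\pi\sqrt{n/d}}\quad(1\le k\le d),\qquad \mathcal V_n=\mathrm{Vol}_{d-1}\big(\{x\in\mathbb T^d: f_n(x)=0\}\big),$$ where $\mathrm{Vol}_{d-1}$ is the $(d-1)$-dimensional Hausdorff measure on the flat torus, normalised to agree with Euclidean volume. Let $H_k$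 be the Hermite polynomials, $H_0=1$, $H_k(t)=(-1)^k\gamma(t)^{-1}\gamma^{(k)}(t)$, with $\gamma(t)=e^{-t^2/2}/\sqrt{2\pi}$. Let $\mathbf A$ be the closure in $L^2(\mathbb P)$ of the real linear span of the variables $z a_\lambda+\bar z a_{-\lambda}$ ($z\in\mathbb C$, $\lambda\in\Lambda_n$). For $q\ge0$ let the $q$-th Wiener chaos $\mathcal H_q$ be the closed real linear span in $L^2(\mathbb P)$ of the products $H_{q_1}(\xi_1)\cdots H_{q_k}(\xi_k)$ with $k\ge1$, $q_1+\dots+q_k=q$ and $(\xi_1,\dots,\xi_k)$ a standard Gaussian vector with entries in $\mathbf A$, and let $F[q]$ be the orthogonal projection of $F\in L^2(\mathbb P)$ onto $\mathcal H_q$. Then $\mathcal V_n$ is almost surely finite and belongs to $L^2(\mathbb P)$, $\mathcal V_n[0]=\mathbb E[\mathcal V_n]$, and $$\mathcal V_n=\mathbb E[\mathcal V_n]+\sum_{q=1}^\infty \mathcal V_n[q]\quad\text{in }L^2(\mathbb P).$$ Moreover $\mathcal V_n[2q+1]=0$ for every $q\ge0$; for every $q\ge1$, almost surely, $$\mathcal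 V_n[2q]=2\pi\sqrt{\frac nd}\sum_{p=0}^q\frac{\beta_{2q-2p}}{(2q-2p)!}\sum_{\substack{s\in\mathbb N^d\\ s_1+\dots+s_d=p}}a(2s)\int_{\mathbb T^d}H_{2q-2p}(f_n(x))\prod_{j=1}^dH_{2s_j}(f_{n,j}(x))\,dx,$$ where $\mathbb N=\{0,1,2,\dots\}$ and $$\beta_k=\frac{H_k(0)}{\sqrt{2\pi}},\qquad a(2s)=\sum_{i=0}^\infty\frac1{i!\,2^i}\,\frac{\sqrt2\,\Gamma(\frac d2+i+\frac12)}{\Gamma(\frac d2+i)}\sum_{\substack{j_1+\dots+j_d=i\\ j_1\le s_1,\dots,j_d\le s_d}}\binom{i}{j_1,\dots,j_d}\prod_{k=1}^d\frac{(-1)^{s_k-j_k}}{(s_k-j_k)!\,2^{s_k-j_k}};$$ and the second-order projection vanishes: $\mathcal V_n[2]=0$. The $\beta_k$ are the coefficients of the formal Hermite expansion of $\delta_0$, in the sense that $\beta_k=\lim_{\varepsilon\to0^+}\frac1{2\varepsilon}\int_{-\varepsilon}^{\varepsilon}H_k(t)\gamma(t)\,dt$ for every $k\ge 0$, and the $a(2s)$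 are the Hermite coefficients of the Euclidean norm on $\mathbb R^d$: for every $s\in\mathbb N^d$, $$a(2s)=\frac{1}{(2s_1)!\cdots(2s_d)!}\,\frac1{(2\pi)^{d/2}}\int_{\mathbb R^d}\|z\|\prod_{j=1}^dH_{2s_j}(z_j)\,e^{-\|z\|^2/2}\,dz .$$ -/

import Mathlib

open MeasureTheory ProbabilityTheory Filter Topology
open scoped ENNReal

namespace ArithmeticWave

/-- The frequency set `Λ_n = {λ ∈ ℤ^d : ‖λ‖² = n}`, as a finite set (see `mem_frequencySet`). -/
noncomputable def frequencySet (d n : ℕ) : Finset (Fin d → ℤ) :=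
  (Fintype.piFinset fun _ => Finset.Icc (-(n : ℤ)) n).filter fun l => ∑ i, l i ^ 2 = (n : ℤ)

theorem mem_frequencySet {d n : ℕ} {l : Fin d → ℤ} :
    l ∈ frequencySet d n ↔ ∑ i, l i ^ 2 = (n : ℤ) := by
  simp only [frequencySet, Finset.mem_filter, Fintype.mem_piFinset, Finset.mem_Icc,
    and_iff_right_iff_imp]
  intro h i
  have h1 : l i ^ 2 ≤ (n : ℤ) := by
    rw [← h]
    exact Finset.single_le_sum (f := fun i => l i ^ 2) (fun j _ => sq_nonneg (l j))
      (Finset.mem_univ i)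
  constructor <;> nlinarith [h1]

theorem neg_mem_frequencySet {d n : ℕ} {l : Fin d → ℤ} (h : l ∈ frequencySet d n) :
    -l ∈ frequencySet d n := by
  rw [mem_frequencySet] at h ⊢
  simpa using h

/-- The random coefficients `(a_λ)_{λ ∈ Λ_n}`: standard complex Gaussian variables, independent
save for the relations `a_{-λ} = conj a_λ`. Only the values at `λ ∈ Λ_n` matter. -/
structure IsGaussianCoeff {Ω : Type*} [MeasurableSpace Ω] {d : ℕ} (P : Measure Ω) (n : ℕ)
    (a : (Fin d → ℤ) → Ω → ℂ) : Prop where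
  law_re : ∀ l ∈ frequencySet d n, HasLaw (fun ω => (a l ω).re) (gaussianReal 0 (1 / 2)) P
  law_im : ∀ l ∈ frequencySet d n, HasLaw (fun ω => (a l ω).im) (gaussianReal 0 (1 / 2)) P
  indep_re_im : ∀ l ∈ frequencySet d n,
    IndepFun (fun ω => (a l ω).re) (fun ω => (a l ω).im) P
  conj_symm : ∀ l ∈ frequencySet d n, ∀ ω, a (-l) ω = starRingEnd ℂ (a l ω)
  /-- The family is independent along any set of frequencies without antipodal pairs. -/
  indep : ∀ T : Finset (Fin d → ℤ), T ⊆ frequencySet d n → (∀ l ∈ T, -l ∉ T) →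
    iIndepFun (fun (l : T) => a l) P

section Field

variable {Ω : Type*} {d : ℕ}

/-- `N_n^{-1/2} ∑_{λ ∈ Λ_n} a_λ e(⟨λ, x⟩)`, with `e(t) = exp(2πit)`. -/
noncomputable def waveSum (n : ℕ) (a : (Fin d → ℤ) → Ω → ℂ) (ω : Ω)
    (x : EuclideanSpace ℝ (Fin d)) : ℂ :=
  (1 / (Real.sqrt ((frequencySet d n).card : ℝ) : ℂ)) *
    ∑ l ∈ frequencySet d n,
      a l ω * Complex.exp (2 * Real.pi * Complex.I * ((∑ i, (l i : ℝ) * x i : ℝ) : ℂ))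

/-- The arithmetic random wave `f_n`, as a `ℤ^d`-periodic real function on `ℝ^d`. The sum
`waveSum` is real (see `ofReal_wave`), so that taking its real part loses nothing. -/
noncomputable def wave (n : ℕ) (a : (Fin d → ℤ) → Ω → ℂ) (ω : Ω)
    (x : EuclideanSpace ℝ (Fin d)) : ℝ :=
  (waveSum n a ω x).re

theorem ofReal_wave [MeasurableSpace Ω] {P : Measure Ω} {n : ℕ} {a : (Fin d → ℤ) → Ω → ℂ}
    (ha : IsGaussianCoeff P n a) (ω : Ω) (x : EuclideanSpace ℝ (Fin d)) :
    (wave n a ω x : ℂ) = waveSum n a ω x := by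
  rw [wave, ← Complex.conj_eq_iff_re, waveSum, map_mul, map_div₀, map_one, Complex.conj_ofReal,
    map_sum]
  congr 1
  refine Finset.sum_nbij' (fun l => -l) (fun l => -l) (fun l h => neg_mem_frequencySet h)
    (fun l h => neg_mem_frequencySet h) (fun l _ => neg_neg l) (fun l _ => neg_neg l) ?_
  intro l hl
  rw [ha.conj_symm l hl, map_mul, ← Complex.exp_conj]
  congr 2
  simp [Complex.conj_ofNat]

/-- The fundamental domain `[0,1)^d` of the torus `𝕋^d = ℝ^d / ℤ^d`. -/
def unitCube (d : ℕ) : Set (EuclideanSpace ℝ (Fin d)) :=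
  {x | ∀ i, x i ∈ Set.Ico (0 : ℝ) 1}

/-- The nodal volume `Vol(f_n⁻¹(0))`: the `(d-1)`-dimensional Hausdorff measure on the flat torus,
normalised to agree with Euclidean volume, of the zero set of `f_n`. -/
noncomputable def nodalVolume (n : ℕ) (a : (Fin d → ℤ) → Ω → ℂ) (ω : Ω) : ℝ≥0∞ :=
  μHE[d - 1] {x | x ∈ unitCube d ∧ wave n a ω x = 0}

/-- The normalised derivative `f_{n,k} = ∂_k f_n / (2π √(n/d))`. -/
noncomputable def waveDeriv (n : ℕ) (a : (Fin d → ℤ) → Ω → ℂ) (k : Fin d) (ω : Ω)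
    (x : EuclideanSpace ℝ (Fin d)) : ℝ :=
  fderiv ℝ (wave n a ω) x (EuclideanSpace.single k 1) / (2 * Real.pi * Real.sqrt ((n : ℝ) / d))

end Field

/-- The (probabilists') Hermite polynomial `H_k` as a function on `ℝ`. -/
noncomputable def hermiteFun (k : ℕ) (t : ℝ) : ℝ := Polynomial.aeval t (Polynomial.hermite k)

section Chaos

variable {Ω : Type*} [MeasurableSpace Ω] {d : ℕ}

/-- The real Gaussian Hilbert space `A`: the closure in `L²(P)` of the real linear span of the
variables `z a_λ + conj z a_{-λ}`, `λ ∈ Λ_n`, `z ∈ ℂ`. -/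
noncomputable def gaussianSpace (P : Measure Ω) (n : ℕ) (a : (Fin d → ℤ) → Ω → ℂ) :
    Submodule ℝ (Lp ℝ 2 P) :=
  (Submodule.span ℝ {F : Lp ℝ 2 P | ∃ l ∈ frequencySet d n, ∃ z : ℂ,
    (fun ω => ((F ω : ℝ) : ℂ)) =ᵐ[P]
      fun ω => z * a l ω + starRingEnd ℂ z * a (-l) ω}).topologicalClosure

/-- The `q`-th Wiener chaos associated with `gaussianSpace`: the closed linear span in `L²(P)` of
the products `H_{q₁}(ξ₁) ⋯ H_{q_k}(ξ_k)`, `q₁ + ⋯ + q_k = q`, where `(ξ₁, …, ξ_k)` is a standard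
Gaussian vector extracted from `gaussianSpace`. -/
noncomputable def wienerChaos (P : Measure Ω) (n : ℕ) (a : (Fin d → ℤ) → Ω → ℂ) (q : ℕ) :
    Submodule ℝ (Lp ℝ 2 P) :=
  (Submodule.span ℝ {F : Lp ℝ 2 P | ∃ k : ℕ, 1 ≤ k ∧ ∃ (m : Fin k → ℕ) (ξ : Fin k → Lp ℝ 2 P),
    ∑ i, m i = q ∧ (∀ i, ξ i ∈ gaussianSpace P n a) ∧
    HasLaw (fun ω i => ξ i ω) (Measure.pi fun _ : Fin k => gaussianReal 0 1) P ∧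
    F =ᵐ[P] fun ω => ∏ i, hermiteFun (m i) (ξ i ω)}).topologicalClosure

instance wienerChaos_complete (P : Measure Ω) (n : ℕ) (a : (Fin d → ℤ) → Ω → ℂ) (q : ℕ) :
    CompleteSpace (wienerChaos P n a q) :=
  Submodule.topologicalClosure.completeSpace _

/-- The orthogonal projection `F[q]` of `F ∈ L²(P)` onto the `q`-th Wiener chaos. -/
noncomputable def chaosProj (P : Measure Ω) (n : ℕ) (a : (Fin d → ℤ) → Ω → ℂ) (q : ℕ)
    (F : Lp ℝ 2 P) : Lp ℝ 2 P :=
  (wienerChaos P n a q).starProjection F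

end Chaos

/-- The coefficients `β_k = H_k(0) / √(2π)`. -/
noncomputable def betaCoeff (k : ℕ) : ℝ := 1 / Real.sqrt (2 * Real.pi) * hermiteFun k 0

/-- The coefficients `a(2s)`, as a function of `s ∈ ℕ^d`. In the inner sum `1 / (s_k - j_k)!` is
read as `0` when `j_k > s_k`, i.e. the sum runs over `j ≤ s`; so only the terms with
`i ≤ s₁ + ⋯ + s_d` of the series are nonzero. -/
noncomputable def normCoeff {d : ℕ} (s : Fin d → ℕ) : ℝ :=
  ∑' i : ℕ, 1 / ((i.factorial : ℝ) * 2 ^ i) *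
    (Real.sqrt 2 * Real.Gamma ((d : ℝ) / 2 + i + 1 / 2) / Real.Gamma ((d : ℝ) / 2 + i)) *
    ∑ j ∈ (Finset.piAntidiag (Finset.univ : Finset (Fin d)) i).filter (fun j => ∀ k, j k ≤ s k),
      (Nat.multinomial Finset.univ j : ℝ) *
        ∏ k, (-1 : ℝ) ^ (s k - j k) / (((s k - j k).factorial : ℝ) * 2 ^ (s k - j k))

/-- The Hermite coefficient of order `m ∈ ℕ^d` of the Euclidean norm on `ℝ^d`:
`(m₁! ⋯ m_d!)⁻¹ (2π)^{-d/2} ∫ ‖z‖ ∏ H_{m_j}(z_j) e^{-‖z‖²/2} dz`. -/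
noncomputable def normHermiteCoeff {d : ℕ} (m : Fin d → ℕ) : ℝ :=
  1 / (∏ k, ((m k).factorial : ℝ)) * (1 / (2 * Real.pi) ^ ((d : ℝ) / 2)) *
    ∫ z : EuclideanSpace ℝ (Fin d),
      ‖z‖ * (∏ k, hermiteFun (m k) (z k)) * Real.exp (-‖z‖ ^ 2 / 2)

/-- The explicit expression for the projection on the chaos of order `2q`. -/
noncomputable def evenChaosFormula {Ω : Type*} {d : ℕ} (n : ℕ) (a : (Fin d → ℤ) → Ω → ℂ) (q : ℕ)
    (ω : Ω) : ℝ :=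
  2 * Real.pi * Real.sqrt ((n : ℝ) / d) *
    ∑ p ∈ Finset.range (q + 1),
      betaCoeff (2 * q - 2 * p) / ((2 * q - 2 * p).factorial : ℝ) *
        ∑ s ∈ Finset.piAntidiag (Finset.univ : Finset (Fin d)) p,
          normCoeff s *
            ∫ x in unitCube d, hermiteFun (2 * q - 2 * p) (wave n a ω x) *
              ∏ j, hermiteFun (2 * s j) (waveDeriv n a j ω x)

end ArithmeticWave

open ArithmeticWave

/-! Keep one frequency of each antipodal pair and collect the numbers √2·a_λ into a standard
Gaussian vector ξ of a Euclidean space E. Then f_n(x) = ⟪v x, ξ⟫ and f_{n,k}(x) = ⟪w k x, ξ⟫ for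
deterministic fields v, w. Invariance of Λ_n under sign changes and permutations of the coordinates
makes v x, w 1 x, …, w d x orthonormal, and ∂_k v = c·w k with c = 2π√(n/d). This structure,
`IsIsotropicFrame`, carries the analytic core of the argument.

Square integrability. Almost surely f_n and its gradient have no common zero
(`measure_singularZeros_eq_zero`), so the nodal set is a countable union of Lipschitz graphs over
coordinate hyperplanes. On a line parallel to an axis f_n is a trigonometric polynomial of degree at
most n, with at most 2n zeros per period unless it vanishes identically. Hence the nodal volume is
almost surely below a deterministic constant (`exists_zeroMeasure_le`).

Projections. No ε-regularisation of δ₀ enters the derivation of the chaos formula. The weighted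
Kac–Rice formula `kacRice` gives, for every nonnegative measurable G, E[G(ξ) V] = (2π)^{-1/2} c ∫
E[G(ξ - ⟪v x, ξ⟫ v x) ‖gradVec w x ξ‖] dx. It follows from resampling ξ along a fixed direction e,
where zeros become level sets of a function ℓ, from the coarea formula for ℓ, and from a change of
projection from e to v x. By polarization a chaos of order q is tested by the variables H_q(⟪u, ξ⟫),
‖u‖ = 1, alone (`mem_orthogonal_wienerChaos`). For such a test function the right-hand side is
computed by the multinomial formula for Hermite polynomials: setting the coordinate along v x to 0
produces H_k(0), hence β_k, and the other coordinates produce the Hermite coefficients of the norm.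
The explicit component gives the same pairing and lies in the chaos, so it is the projection
(`chaosProj_zeroMeasure`).

Convergence. A square integrable variable orthogonal to all chaoses is orthogonal to all polynomials
in ξ, hence to exponentials, hence to bounded functions of ξ (`integral_mul_comp_eq_zero`), and V
agrees almost surely with such a function.

Coefficients. In polar coordinates E[‖Z‖ g(Z)] is an explicit multiple of E[g(Z)] for homogeneous g;
expanding H_{2s} into monomials yields the series for a(2s). Odd orders vanish by parity. For order
two, a(2e_k) = a(0)/(2d) and β_2 = -β_0 reduce the claim to Green's identity ∑_k ∫ f_{n,k}² = d ∫
f_n². -/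

open scoped NNReal

open scoped ENNReal

namespace ArithmeticWave

/-! ### Measurability of the Hausdorff measure of fibres -/

section HausdorffMeasurability

variable {X : Type*} [MetricSpace X] [MeasurableSpace X] [BorelSpace X]

/-- The pre-measure of a set obtained from its countable open covers of mesh at most `r`. -/
noncomputable def openCoverContent (s : ℝ) (r : ℝ≥0∞) (A : Set X) : ℝ≥0∞ :=
  ⨅ (U : ℕ → Set X) (_ : (∀ i, IsOpen (U i)) ∧ A ⊆ ⋃ i, U i ∧ ∀ i, Metric.ediam (U i) ≤ r),
    ∑' i, ⨆ _ : (U i).Nonempty, Metric.ediam (U i) ^ s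

omit [MeasurableSpace X] [BorelSpace X] in
-- The η-thickening of `A` has diameter at most that of `A` plus 2η, and the s-th power is
-- continuous. The strict gap between `r` and `r'` leaves room for a small η.
theorem exists_isOpen_ediam_rpow_le {s : ℝ} (hs : 0 ≤ s) {A : Set X} {r r' ε : ℝ≥0∞}
    (hA : Metric.ediam A ≤ r) (hr : r < r') (hε : ε ≠ 0) :
    ∃ U : Set X, IsOpen U ∧ A ⊆ U ∧ Metric.ediam U ≤ r' ∧
      (⨆ _ : U.Nonempty, Metric.ediam U ^ s) ≤ (⨆ _ : A.Nonempty, Metric.ediam A ^ s) + ε := by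
  rcases A.eq_empty_or_nonempty with rfl | hne
  · exact ⟨∅, isOpen_empty, le_rfl, by simp, by simp⟩
  have hfin : Metric.ediam A ≠ ∞ := (hA.trans_lt (hr.trans_le le_top)).ne
  have hcont : Tendsto (fun η : ℝ => Metric.ediam A + 2 * ENNReal.ofReal η) (𝓝[>] 0)
      (𝓝 (Metric.ediam A)) := by
    have : Tendsto (fun η : ℝ => Metric.ediam A + 2 * ENNReal.ofReal η) (𝓝 0)
        (𝓝 (Metric.ediam A + 2 * ENNReal.ofReal 0)) := by
      refine tendsto_const_nhds.add (ENNReal.Tendsto.const_mul ?_ (Or.inr (by simp)))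
      exact (ENNReal.continuous_ofReal.tendsto 0)
    simp only [ENNReal.ofReal_zero, mul_zero, add_zero] at this
    exact this.mono_left nhdsWithin_le_nhds
  have h1 : ∀ᶠ η in 𝓝[>] (0 : ℝ), Metric.ediam A + 2 * ENNReal.ofReal η < r' :=
    hcont.eventually (gt_mem_nhds (hA.trans_lt hr))
  have h2 : ∀ᶠ η in 𝓝[>] (0 : ℝ),
      (Metric.ediam A + 2 * ENNReal.ofReal η) ^ s < Metric.ediam A ^ s + ε :=
    ((ENNReal.continuous_rpow_const.tendsto _).comp hcont).eventually
      (gt_mem_nhds (ENNReal.lt_add_right (ENNReal.rpow_ne_top_of_nonneg hs hfin) hε))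
  obtain ⟨η, ⟨h1, h2⟩, hη⟩ := ((h1.and h2).and self_mem_nhdsWithin).exists
  have hη' : (0 : ℝ) < η := hη
  have hd : Metric.ediam (Metric.thickening η A) ≤ Metric.ediam A + 2 * ENNReal.ofReal η := by
    have := Metric.ediam_thickening_le (s := A) (Real.toNNReal η)
    rwa [Real.coe_toNNReal _ hη'.le] at this
  refine ⟨Metric.thickening η A, Metric.isOpen_thickening, Metric.self_subset_thickening hη' A,
    hd.trans h1.le, ?_⟩
  rw [iSup_pos hne]
  exact iSup_le fun _ => (ENNReal.rpow_le_rpow hd hs).trans h2.le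

omit [MeasurableSpace X] [BorelSpace X] in
theorem openCoverContent_le_of_lt {s : ℝ} (hs : 0 ≤ s) {r r' : ℝ≥0∞} (hr : r < r') (A : Set X) :
    openCoverContent s r' A ≤ ⨅ (t : ℕ → Set X) (_ : A ⊆ ⋃ n, t n)
      (_ : ∀ n, Metric.ediam (t n) ≤ r), ∑' n, ⨆ _ : (t n).Nonempty, Metric.ediam (t n) ^ s := by
  refine le_iInf fun t => le_iInf fun htA => le_iInf fun htr => ?_
  refine ENNReal.le_of_forall_pos_le_add fun ε hε _ => ?_
  obtain ⟨δ, hδ0, hδ⟩ := ENNReal.exists_pos_sum_of_countable (ε := ε) (by simpa using hε.ne') ℕ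
  choose U hUo hUs hUd hU using fun i => exists_isOpen_ediam_rpow_le hs (htr i) hr
    (ε := δ i) (by simpa using (hδ0 i).ne')
  refine (iInf₂_le U ⟨hUo, htA.trans (Set.iUnion_mono hUs), hUd⟩).trans ?_
  calc _ ≤ ∑' i, ((⨆ _ : (t i).Nonempty, Metric.ediam (t i) ^ s) + (δ i : ℝ≥0∞)) :=
        ENNReal.tsum_le_tsum hU
    _ = _ + ∑' i, (δ i : ℝ≥0∞) := ENNReal.tsum_add
    _ ≤ _ := by gcongr

/-- Covers may be fattened to open ones at the price of a slightly larger mesh, which is invisible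
in the limit. Open covers are what makes the content semicontinuous in the set. -/
theorem hausdorffMeasure_eq_iSup_openCoverContent {s : ℝ} (hs : 0 ≤ s) (A : Set X) :
    μH[s] A = ⨆ n : ℕ, openCoverContent s ((n : ℝ≥0∞) + 1)⁻¹ A := by
  rw [Measure.hausdorffMeasure_apply]
  apply le_antisymm
  · refine iSup₂_le fun r hr => ?_
    obtain ⟨n, hn⟩ := ENNReal.exists_inv_nat_lt hr.ne'
    refine le_iSup_of_le n ?_
    refine le_iInf₂ fun U hU => ?_
    refine iInf_le_of_le U (iInf_le_of_le hU.2.1 (iInf_le_of_le (fun i => (hU.2.2 i).trans ?_) le_rfl))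
    exact (ENNReal.inv_le_inv.2 le_self_add).trans hn.le
  · refine iSup_le fun n => ?_
    -- The mesh 1/(n+2) is strictly below 1/(n+1), as the fattening requires.
    refine le_iSup₂_of_le (((n : ℝ≥0∞) + 2)⁻¹) (by simp) ?_
    refine openCoverContent_le_of_lt hs ?_ A
    rw [ENNReal.inv_lt_inv]
    exact_mod_cast (by lia : n + 1 < n + 2)

/-- An open cover of one fibre of a closed set over a compact space still covers all nearby fibres,
so each content is upper semicontinuous in `t`. The measure is a countable supremum of these
contents. -/
theorem measurable_hausdorffMeasure_fiber {T : Type*} [TopologicalSpace T] [MeasurableSpace T]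
    [OpensMeasurableSpace T] {s : ℝ} (hs : 0 ≤ s) {K : Set X} (hK : IsCompact K)
    {C : Set (T × X)} (hC : IsClosed C) (hCK : ∀ p ∈ C, p.2 ∈ K) :
    Measurable fun t => μH[s] {x | (t, x) ∈ C} := by
  simp_rw [hausdorffMeasure_eq_iSup_openCoverContent hs]
  refine Measurable.iSup fun n => measurable_of_Iio fun a => IsOpen.measurableSet ?_
  rw [isOpen_iff_mem_nhds]
  intro t ht
  simp only [Set.mem_preimage, Set.mem_Iio, openCoverContent, iInf_lt_iff] at ht
  obtain ⟨U, hU, hlt⟩ := ht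
  have hev : ∀ᶠ t' in 𝓝 t, ∀ x ∈ K, (t', x) ∈ C → x ∈ ⋃ i, U i := by
    -- This open set contains {t} × K; the tube lemma enlarges {t} to a neighbourhood.
    have hO : IsOpen (Cᶜ ∪ Prod.snd ⁻¹' (⋃ i, U i)) :=
      hC.isOpen_compl.union ((isOpen_iUnion hU.1).preimage continuous_snd)
    have := generalized_tube_lemma (s := {t}) isCompact_singleton hK hO (by
      rintro ⟨t', x⟩ ⟨rfl, hx⟩
      by_cases h : (t', x) ∈ C
      · exact Or.inr (hU.2.1 h)
      · exact Or.inl h)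
    obtain ⟨u, v, hu, _, htu, hKv, huv⟩ := this
    filter_upwards [hu.mem_nhds (htu rfl)] with t' ht' x hx hxC
    rcases huv (Set.mk_mem_prod ht' (hKv hx)) with h | h
    · exact absurd hxC h
    · exact h
  filter_upwards [hev] with t' ht'
  simp only [Set.mem_preimage, Set.mem_Iio, openCoverContent, iInf_lt_iff]
  exact ⟨U, ⟨hU.1, fun x hx => ht' x (hCK _ hx) hx, hU.2.2⟩, hlt⟩

end HausdorffMeasurability

end ArithmeticWave

namespace ArithmeticWave

/-! ### σ-compact pieces and Hausdorff measure under Lipschitz maps -/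

section SigmaCompact

variable {X : Type*}

theorem IsSigmaCompact.inter_isClosed [TopologicalSpace X] {s F : Set X} (hs : IsSigmaCompact s)
    (hF : IsClosed F) : IsSigmaCompact (s ∩ F) := by
  obtain ⟨K, hK, rfl⟩ := hs
  rw [Set.iUnion_inter]
  exact isSigmaCompact_iUnion_of_isCompact _ fun i => (hK i).inter_right hF

theorem IsSigmaCompact.inter_isOpen [PseudoMetricSpace X] {s U : Set X} (hs : IsSigmaCompact s)
    (hU : IsOpen U) : IsSigmaCompact (s ∩ U) := by
  obtain ⟨F, hF, -, rfl, -⟩ := hU.exists_iUnion_isClosed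
  rw [Set.inter_iUnion]
  exact isSigmaCompact_iUnion _ fun i => IsSigmaCompact.inter_isClosed hs (hF i)

/-- A disjointed piece of an open cover is open ∩ closed. Local formulas can therefore be summed
over a partition without leaving the σ-compact sets, for which fibre measures are known to be
measurable. -/
theorem IsSigmaCompact.inter_disjointed [PseudoMetricSpace X] {s : Set X} {U : ℕ → Set X}
    (hs : IsSigmaCompact s) (hU : ∀ i, IsOpen (U i)) (i : ℕ) :
    IsSigmaCompact (s ∩ disjointed U i) := by
  have : disjointed U i = U i ∩ (⋃ j < i, U j)ᶜ := by
    rw [disjointed_eq_inf_compl]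
    ext x; simp
  rw [this, ← Set.inter_assoc]
  exact IsSigmaCompact.inter_isClosed (IsSigmaCompact.inter_isOpen hs (hU i))
    (isOpen_biUnion fun j _ => hU j).isClosed_compl

theorem IsSigmaCompact.measurableSet [TopologicalSpace X] [T2Space X] [MeasurableSpace X]
    [OpensMeasurableSpace X] {s : Set X} (hs : IsSigmaCompact s) : MeasurableSet s := by
  obtain ⟨K, hK, rfl⟩ := hs
  exact MeasurableSet.iUnion fun i => (hK i).isClosed.measurableSet

end SigmaCompact

section FiberMeasurability

variable {X : Type*} [MetricSpace X] [MeasurableSpace X] [BorelSpace X]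

/-- Exhaust `S` by increasing compact sets; over each of them the zero set of `F` is closed. -/
theorem measurable_euclideanHausdorffMeasure_fiber {T : Type*} [TopologicalSpace T]
    [MeasurableSpace T] [OpensMeasurableSpace T] (m : ℕ) {S : Set X} (hS : IsSigmaCompact S)
    {F : T × X → ℝ} (hF : ContinuousOn F (Set.univ ×ˢ S)) :
    Measurable fun t => μHE[m] {x | x ∈ S ∧ F (t, x) = 0} := by
  obtain ⟨K, hK, rfl⟩ := hS
  have hset : ∀ t, {x | x ∈ ⋃ n, K n ∧ F (t, x) = 0}
      = ⋃ n, {x | x ∈ Set.accumulate K n ∧ F (t, x) = 0} := by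
    intro t
    rw [← Set.iUnion_accumulate]
    ext x
    constructor
    · rintro ⟨hx, h⟩
      obtain ⟨n, hn⟩ := Set.mem_iUnion.1 hx
      exact Set.mem_iUnion.2 ⟨n, hn, h⟩
    · intro hx
      obtain ⟨n, hn, h⟩ := Set.mem_iUnion.1 hx
      exact ⟨Set.mem_iUnion.2 ⟨n, hn⟩, h⟩
  have hmono : ∀ t, Monotone fun n => {x | x ∈ Set.accumulate K n ∧ F (t, x) = 0} :=
    fun t i j hij x hx => ⟨Set.monotone_accumulate hij hx.1, hx.2⟩
  simp_rw [hset, fun t => (hmono t).measure_iUnion (μ := μHE[m])]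
  refine Measurable.iSup fun n => ?_
  simp_rw [Measure.euclideanHausdorffMeasure_def, Measure.smul_apply]
  refine Measurable.const_smul ?_ _
  have hKn : IsCompact (Set.accumulate K n) := (Set.finite_Iic n).isCompact_biUnion fun i _ => hK i
  have hsub : Set.accumulate K n ⊆ ⋃ n, K n := Set.accumulate_subset_iUnion n
  have hC : IsClosed ((Set.univ ×ˢ Set.accumulate K n) ∩ F ⁻¹' {0}) :=
    (hF.mono (Set.prod_mono le_rfl hsub)).preimage_isClosed_of_isClosed
      (isClosed_univ.prod hKn.isClosed) isClosed_singleton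
  have hm := measurable_hausdorffMeasure_fiber (s := m) (by positivity) hKn hC fun p hp => hp.1.2
  convert hm using 3
  ext x; simp

theorem LipschitzOnWith.euclideanHausdorffMeasure_image_le {Y : Type*} [MetricSpace Y]
    [MeasurableSpace Y] [BorelSpace Y] {f : X → Y} {K : ℝ≥0} {s : Set X}
    (h : LipschitzOnWith K f s) (m : ℕ) : μHE[m] (f '' s) ≤ (K : ℝ≥0∞) ^ m * μHE[m] s := by
  simp only [Measure.euclideanHausdorffMeasure_def, Measure.smul_apply]
  have := h.hausdorffMeasure_image_le (d := m) (by positivity)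
  rw [ENNReal.rpow_natCast] at this
  calc _ ≤ _ • ((K : ℝ≥0∞) ^ m * μH[m] s) := by gcongr
    _ = _ := by rw [mul_smul_comm]

/-- The hypothesis makes `f` injective on `s` with a `K`-Lipschitz inverse; the Lipschitz bound is
applied to that inverse. -/
theorem euclideanHausdorffMeasure_le_image {Y : Type*} [MetricSpace Y]
    [MeasurableSpace Y] [BorelSpace Y] {f : X → Y} {K : ℝ≥0} {s : Set X}
    (h : ∀ x ∈ s, ∀ y ∈ s, edist x y ≤ K * edist (f x) (f y)) (m : ℕ) :
    μHE[m] s ≤ (K : ℝ≥0∞) ^ m * μHE[m] (f '' s) := by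
  rcases isEmpty_or_nonempty X with hX | hX
  · simp [Set.eq_empty_of_isEmpty s]
  have hinj : Set.InjOn f s := fun x hx y hy hxy => by
    have := h x hx y hy
    rw [hxy, edist_self, mul_zero] at this
    exact edist_le_zero.1 this
  have hL : LipschitzOnWith K (Function.invFunOn f s) (f '' s) := by
    rintro _ ⟨x, hx, rfl⟩ _ ⟨y, hy, rfl⟩
    rw [hinj.leftInvOn_invFunOn hx, hinj.leftInvOn_invFunOn hy]
    exact h x hx y hy
  have := LipschitzOnWith.euclideanHausdorffMeasure_image_le hL m
  rwa [hinj.leftInvOn_invFunOn.image_image] at this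

end FiberMeasurability

/-! ### The coarea formula on regular points -/

section Coarea

open Module

variable {E : Type*} [NormedAddCommGroup E] [InnerProductSpace ℝ E] [FiniteDimensional ℝ E]
  [MeasurableSpace E] [BorelSpace E]

local notation "⟪" x ", " y "⟫" => inner ℝ x y

theorem volume_eq_lintegral_slices {ν : E} (hν : ‖ν‖ = 1) {t : Set E} (ht : MeasurableSet t) :
    volume t = ∫⁻ r : ℝ, μHE[finrank ℝ E - 1] (t ∩ {y | ⟪ν, y⟫ = r}) := by
  have hν0 : ν ≠ 0 := by rintro rfl; simp at hν
  have h := EuclideanGeometry.euclideanHausdorffMeasure_eq_lintegral (0 : E) hν0 ht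
  rw [InnerProductSpace.euclideanHausdorffMeasure_eq_volume] at h
  rw [h, ← ofReal_norm, hν, ENNReal.ofReal_one, one_mul]
  refine lintegral_congr fun r => ?_
  congr 2
  ext y
  simp only [vadd_eq_add, add_zero, SetLike.mem_coe, AffineSubspace.mem_mk', vsub_eq_sub,
    Submodule.mem_orthogonal_singleton_iff_inner_right, inner_sub_right, inner_smul_right,
    real_inner_self_eq_norm_sq, hν, Set.mem_ofPred_eq]
  constructor <;> intro h <;> linarith

/-- Near a regular point of `h` there is a chart, as close to an isometry as desired, in which
`h` is a multiple of a coordinate. -/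
theorem exists_nearIsometry {E : Type*} [NormedAddCommGroup E] [InnerProductSpace ℝ E]
    [FiniteDimensional ℝ E] {h : E → ℝ} {p : E} (hh : HasStrictFDerivAt h (fderiv ℝ h p) p)
    (hp : fderiv ℝ h p ≠ 0) {κ : ℝ≥0} (hκ : 1 < κ) :
    ∃ U ∈ 𝓝 p, ∃ (Φ : E → E) (ν : E), ‖ν‖ = 1 ∧
      (∀ x, h x = ‖fderiv ℝ h p‖ * ⟪ν, Φ x⟫) ∧
      LipschitzOnWith κ Φ U ∧ ∀ x ∈ U, ∀ y ∈ U, edist x y ≤ κ * edist (Φ x) (Φ y) := by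
  set g : E := (InnerProductSpace.toDual ℝ E).symm (fderiv ℝ h p) with hg
  set a : ℝ := ‖fderiv ℝ h p‖ with ha
  have hga : ‖g‖ = a := by simp [hg, ha]
  have ha0 : 0 < a := norm_pos_iff.2 hp
  set ν : E := a⁻¹ • g with hνdef
  have hν : ‖ν‖ = 1 := by rw [hνdef, norm_smul, hga]; simp [ha0.ne', abs_of_pos ha0]
  have hD : ∀ y, fderiv ℝ h p y = a * ⟪ν, y⟫ := by
    intro y
    rw [hνdef, real_inner_smul_left, hg, InnerProductSpace.toDual_symm_apply]
    field_simp
  -- Only the coordinate along the unit gradient ν is modified, so as to become h/a. The correction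
  -- has zero derivative at `p`, hence Φ is tangent to the identity there.
  set Φ : E → E := fun x => x + (a⁻¹ * h x - ⟪ν, x⟫) • ν with hΦ
  have hΦν : ∀ x, h x = a * ⟪ν, Φ x⟫ := by
    intro x
    simp only [hΦ, inner_add_right, inner_smul_right, real_inner_self_eq_norm_sq, hν]
    field_simp
    ring
  have hΦD : HasStrictFDerivAt Φ (ContinuousLinearMap.id ℝ E) p := by
    have h1 : HasStrictFDerivAt (fun x => (a⁻¹ * h x - ⟪ν, x⟫) • ν)
        ((a⁻¹ • fderiv ℝ h p - innerSL ℝ ν).smulRight ν) p :=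
      ((hh.const_mul a⁻¹).sub (innerSL ℝ ν).hasStrictFDerivAt).smul_const ν
    have h2 : (a⁻¹ • fderiv ℝ h p - innerSL ℝ ν) = 0 := by
      ext y
      simp [hD, ha0.ne']
    rw [h2] at h1
    have h3 := (hasStrictFDerivAt_id p).add h1
    rw [ContinuousLinearMap.zero_smulRight, add_zero] at h3
    exact h3
  have hκ0 : 0 < κ := zero_lt_one.trans hκ
  -- With this δ the lower constant 1 - δ is exactly 1/κ, and 1 + δ ≤ κ because κ + 1/κ ≥ 2.
  set δ : ℝ≥0 := 1 - κ⁻¹ with hδ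
  have hδ' : (δ : ℝ) = 1 - (κ : ℝ)⁻¹ := by
    rw [hδ, NNReal.coe_sub (inv_le_one_of_one_le₀ hκ.le)]; simp
  have hκ' : (1 : ℝ) < κ := by exact_mod_cast hκ
  have hδ0 : 0 < δ := by
    have : (0 : ℝ) < δ := by rw [hδ']; simp [inv_lt_one_of_one_lt₀ hκ']
    exact_mod_cast this
  obtain ⟨U, hU, hUa⟩ : ∃ U ∈ 𝓝 p, ∀ x ∈ U, ∀ y ∈ U,
      ‖Φ x - Φ y - (x - y)‖ ≤ δ * ‖x - y‖ := hΦD.approximates_deriv_on_nhds (c := δ) (Or.inr hδ0)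
  refine ⟨U, hU, Φ, ν, hν, hΦν, ?_, ?_⟩
  · refine LipschitzOnWith.of_dist_le_mul fun x hx y hy => ?_
    have h1 := hUa x hx y hy
    rw [dist_eq_norm, dist_eq_norm]
    have h2 : ‖Φ x - Φ y‖ ≤ ‖Φ x - Φ y - (x - y)‖ + ‖x - y‖ := by
      simpa using norm_add_le (Φ x - Φ y - (x - y)) (x - y)
    have h3 : (δ : ℝ) + 1 ≤ κ := by
      rw [hδ']
      have : (κ : ℝ)⁻¹ * κ = 1 := inv_mul_cancel₀ (by positivity)
      nlinarith [sq_nonneg ((κ : ℝ) - 1), inv_pos.2 (zero_lt_one.trans hκ')]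
    nlinarith [norm_nonneg (x - y)]
  · intro x hx y hy
    have h1 := hUa x hx y hy
    have h2 : ‖x - y‖ ≤ ‖Φ x - Φ y - (x - y)‖ + ‖Φ x - Φ y‖ := by
      have := norm_sub_le (Φ x - Φ y) (Φ x - Φ y - (x - y))
      rw [sub_sub_cancel] at this
      linarith
    have h3 : dist x y ≤ κ * dist (Φ x) (Φ y) := by
      rw [dist_eq_norm, dist_eq_norm]
      have h4 : (κ : ℝ)⁻¹ * ‖x - y‖ ≤ ‖Φ x - Φ y‖ := by rw [hδ'] at h1; linarith
      have h5 := mul_le_mul_of_nonneg_left h4 (zero_lt_one.trans hκ').le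
      rwa [← mul_assoc, mul_inv_cancel₀ (by positivity), one_mul] at h5
    rw [edist_nndist, edist_nndist, ← ENNReal.coe_mul]
    exact_mod_cast h3

theorem lintegral_comp_const_mul {a : ℝ} (ha : 0 < a) (F : ℝ → ℝ≥0∞) :
    ENNReal.ofReal a * ∫⁻ r, F (a * r) = ∫⁻ u, F u := by
  have hemb : MeasurableEmbedding (fun r : ℝ => a * r) :=
    (Homeomorph.mulLeft₀ a ha.ne').measurableEmbedding
  rw [← hemb.lintegral_map]
  conv_rhs => rw [← Real.smul_map_volume_mul_left ha.ne']
  rw [lintegral_smul_measure, abs_of_pos ha, smul_eq_mul]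

/-- The chart carries level sets of `h` to parallel hyperplane slices, where slicing is exactly
Fubini. The errors are the distortion of volume (κ^D), the distortion of slices (at most κ^D) and
the oscillation of the gradient (κ), whence the exponent 2D + 1. -/
theorem exists_coarea_nhds {h : E → ℝ} {p : E} (hh : ContDiffAt ℝ 1 h p)
    (hp : fderiv ℝ h p ≠ 0) {κ : ℝ≥0} (hκ : 1 < κ) :
    ∃ U ∈ 𝓝 p, IsOpen U ∧ ContinuousOn h U ∧ ∀ A ⊆ U, MeasurableSet A →
      (∫⁻ u, μHE[finrank ℝ E - 1] (A ∩ h ⁻¹' {u}))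
        ≤ (κ : ℝ≥0∞) ^ (2 * finrank ℝ E + 1) * ∫⁻ x in A, ‖fderiv ℝ h x‖ₑ ∧
      (∫⁻ x in A, ‖fderiv ℝ h x‖ₑ) ≤
        (κ : ℝ≥0∞) ^ (2 * finrank ℝ E + 1) * ∫⁻ u, μHE[finrank ℝ E - 1] (A ∩ h ⁻¹' {u}) := by
  obtain ⟨U₀, hU₀, Φ, ν, hν, hΦν, hΦL, hΦA⟩ :=
    exists_nearIsometry (hh.hasStrictFDerivAt one_ne_zero) hp hκ
  set D := finrank ℝ E
  set a : ℝ := ‖fderiv ℝ h p‖ with ha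
  have ha0 : 0 < a := norm_pos_iff.2 hp
  have hκ1 : (1 : ℝ) < κ := by exact_mod_cast hκ
  have hcont : ContinuousAt (fun x => ‖fderiv ℝ h x‖) p :=
    (hh.fderiv_right (m := 0) (by simp)).continuousAt.norm
  have h1 : ∀ᶠ x in 𝓝 p, ‖fderiv ℝ h x‖ < κ * a :=
    hcont.eventually (gt_mem_nhds (by nlinarith))
  have h2 : ∀ᶠ x in 𝓝 p, a / κ < ‖fderiv ℝ h x‖ :=
    hcont.eventually (lt_mem_nhds (by rw [div_lt_iff₀ (by positivity)]; nlinarith))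
  have h3 : ∀ᶠ x in 𝓝 p, ContinuousAt h x :=
    (hh.eventually (by simp)).mono fun x hx => hx.continuousAt
  obtain ⟨U, hUsub, hUo, hpU⟩ := mem_nhds_iff.1 (inter_mem hU₀ (h1.and (h2.and h3)))
  refine ⟨U, hUo.mem_nhds hpU, hUo, fun x hx => (hUsub hx).2.2.2.continuousWithinAt, ?_⟩
  intro A hAU hA
  have hAU₀ : A ⊆ U₀ := fun x hx => (hUsub (hAU hx)).1
  have hinj : Set.InjOn Φ A := fun x hx y hy hxy => by
    have := hΦA x (hAU₀ hx) y (hAU₀ hy)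
    rw [hxy, edist_self, mul_zero] at this
    exact edist_le_zero.1 this
  have hΦm : MeasurableSet (Φ '' A) :=
    hA.image_of_continuousOn_injOn (hΦL.continuousOn.mono hAU₀) hinj
  -- The level {h = a·r} is sent into the hyperplane ⟪ν, ·⟫ = r; the factor `a` comes from the
  -- substitution u = a·r.
  have hvol : ENNReal.ofReal a * volume (Φ '' A) = ∫⁻ u, μHE[D - 1] (Φ '' (A ∩ h ⁻¹' {u})) := by
    rw [volume_eq_lintegral_slices hν hΦm,
      ← lintegral_comp_const_mul ha0 fun u => μHE[D - 1] (Φ '' (A ∩ h ⁻¹' {u}))]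
    congr 1
    refine lintegral_congr fun r => ?_
    congr 1
    ext y
    constructor
    · rintro ⟨⟨x, hx, rfl⟩, hy⟩
      exact ⟨x, ⟨hx, by simp [hΦν x, show ⟪ν, Φ x⟫ = r from hy]⟩, rfl⟩
    · rintro ⟨x, ⟨hx, hu⟩, rfl⟩
      refine ⟨⟨x, hx, rfl⟩, ?_⟩
      have : h x = a * r := hu
      rw [hΦν x] at this
      exact mul_left_cancel₀ ha0.ne' this
  have hκe : (1 : ℝ≥0∞) ≤ κ := by exact_mod_cast hκ.le
  have hpow : (κ : ℝ≥0∞) ^ (D - 1) ≤ (κ : ℝ≥0∞) ^ D := pow_le_pow_right₀ hκe (Nat.sub_le _ _)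
  have hκt : ∀ k, (κ : ℝ≥0∞) ^ k ≠ ∞ := fun k => ENNReal.pow_ne_top ENNReal.coe_ne_top
  have hv1 : volume (Φ '' A) ≤ (κ : ℝ≥0∞) ^ D * volume A := by
    simpa only [D, InnerProductSpace.euclideanHausdorffMeasure_eq_volume] using
      LipschitzOnWith.euclideanHausdorffMeasure_image_le (hΦL.mono hAU₀) D
  have hv2 : volume A ≤ (κ : ℝ≥0∞) ^ D * volume (Φ '' A) := by
    simpa only [D, InnerProductSpace.euclideanHausdorffMeasure_eq_volume] using
      euclideanHausdorffMeasure_le_image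
        (fun x hx y hy => hΦA x (hAU₀ hx) y (hAU₀ hy)) D
  have hs1 : (∫⁻ u, μHE[D - 1] (A ∩ h ⁻¹' {u})) ≤
      (κ : ℝ≥0∞) ^ D * ∫⁻ u, μHE[D - 1] (Φ '' (A ∩ h ⁻¹' {u})) := by
    rw [← lintegral_const_mul' _ _ (hκt D)]
    refine lintegral_mono fun u => ?_
    exact (euclideanHausdorffMeasure_le_image
      (fun x hx y hy => hΦA x (hAU₀ hx.1) y (hAU₀ hy.1)) (D - 1)).trans (by gcongr)
  have hs2 : (∫⁻ u, μHE[D - 1] (Φ '' (A ∩ h ⁻¹' {u}))) ≤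
      (κ : ℝ≥0∞) ^ D * ∫⁻ u, μHE[D - 1] (A ∩ h ⁻¹' {u}) := by
    rw [← lintegral_const_mul' _ _ (hκt D)]
    refine lintegral_mono fun u => ?_
    exact (LipschitzOnWith.euclideanHausdorffMeasure_image_le
      (hΦL.mono (Set.inter_subset_left.trans hAU₀)) (D - 1)).trans (by gcongr)
  have hd1 : (∫⁻ x in A, ‖fderiv ℝ h x‖ₑ) ≤ κ * (ENNReal.ofReal a * volume A) := by
    calc _ ≤ ∫⁻ _ in A, κ * ENNReal.ofReal a := by
          refine setLIntegral_mono' hA fun x hx => ?_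
          rw [← ofReal_norm, ← ENNReal.ofReal_coe_nnreal, ← ENNReal.ofReal_mul (by positivity)]
          exact ENNReal.ofReal_le_ofReal (hUsub (hAU hx)).2.1.le
      _ = _ := by rw [setLIntegral_const, mul_assoc]
  have hd2 : ENNReal.ofReal a * volume A ≤ κ * ∫⁻ x in A, ‖fderiv ℝ h x‖ₑ := by
    rw [← lintegral_const_mul' _ _ ENNReal.coe_ne_top, ← setLIntegral_const]
    refine setLIntegral_mono' hA fun x hx => ?_
    rw [← ofReal_norm, ← ENNReal.ofReal_coe_nnreal, ← ENNReal.ofReal_mul (by positivity)]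
    refine ENNReal.ofReal_le_ofReal ?_
    have := (hUsub (hAU hx)).2.2.1.le
    rwa [div_le_iff₀' (by positivity)] at this
  constructor
  · calc _ ≤ (κ : ℝ≥0∞) ^ D * (ENNReal.ofReal a * volume (Φ '' A)) := hvol ▸ hs1
      _ ≤ (κ : ℝ≥0∞) ^ D * (ENNReal.ofReal a * ((κ : ℝ≥0∞) ^ D * volume A)) := by gcongr
      _ = (κ : ℝ≥0∞) ^ (2 * D) * (ENNReal.ofReal a * volume A) := by ring
      _ ≤ (κ : ℝ≥0∞) ^ (2 * D) * (κ * ∫⁻ x in A, ‖fderiv ℝ h x‖ₑ) := by gcongr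
      _ = _ := by ring
  · calc _ ≤ κ * (ENNReal.ofReal a * volume A) := hd1
      _ ≤ κ * (ENNReal.ofReal a * ((κ : ℝ≥0∞) ^ D * volume (Φ '' A))) := by gcongr
      _ = κ * (κ : ℝ≥0∞) ^ D * (ENNReal.ofReal a * volume (Φ '' A)) := by ring
      _ ≤ κ * (κ : ℝ≥0∞) ^ D * ((κ : ℝ≥0∞) ^ D * ∫⁻ u, μHE[D - 1] (A ∩ h ⁻¹' {u})) := by
        rw [hvol]; gcongr
      _ = _ := by ring

/-- The coarea formula on a set of regular points, up to a factor close to one. -/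
theorem coarea_le {h : E → ℝ} {S : Set E} (hS : IsSigmaCompact S) (hm : Measurable h)
    (hh : ∀ x ∈ S, ContDiffAt ℝ 1 h x) (hd : ∀ x ∈ S, fderiv ℝ h x ≠ 0)
    {B : Set ℝ} (hB : MeasurableSet B) {κ : ℝ≥0} (hκ : 1 < κ) :
    (∫⁻ u in B, μHE[finrank ℝ E - 1] (S ∩ h ⁻¹' {u}))
        ≤ (κ : ℝ≥0∞) ^ (2 * finrank ℝ E + 1) * ∫⁻ x in S ∩ h ⁻¹' B, ‖fderiv ℝ h x‖ₑ ∧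
      (∫⁻ x in S ∩ h ⁻¹' B, ‖fderiv ℝ h x‖ₑ) ≤ (κ : ℝ≥0∞) ^ (2 * finrank ℝ E + 1) *
        ∫⁻ u in B, μHE[finrank ℝ E - 1] (S ∩ h ⁻¹' {u}) := by
  rcases S.eq_empty_or_nonempty with rfl | hne
  · simp
  choose! U hUn hUo hUc hU using fun x (hx : x ∈ S) => exists_coarea_nhds (hh x hx) (hd x hx) hκ
  -- Lindelöf: countably many local charts suffice, and disjointing them partitions `S` into pieces
  -- each inside one chart.
  obtain ⟨t, htS, htc, hSt⟩ := TopologicalSpace.countable_cover_nhdsWithin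
    (fun x hx => mem_nhdsWithin_of_mem_nhds (hUn x hx))
  have htne : t.Nonempty := by
    by_contra h
    rw [Set.not_nonempty_iff_eq_empty.1 h] at hSt
    simp at hSt
    exact hne.ne_empty hSt
  obtain ⟨e, rfl⟩ := htc.exists_eq_range htne
  have heS : ∀ i, e i ∈ S := fun i => htS ⟨i, rfl⟩
  set A : ℕ → Set E := fun i => S ∩ disjointed (fun i => U (e i)) i with hAdef
  have hAs : ∀ i, IsSigmaCompact (A i) := fun i =>
    IsSigmaCompact.inter_disjointed hS (fun i => hUo _ (heS i)) i
  have hAd : Pairwise (Function.onFun Disjoint A) := fun i j hij =>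
    (disjoint_disjointed (fun i => U (e i)) hij).mono Set.inter_subset_right Set.inter_subset_right
  have hAU : ∀ i, A i ⊆ U (e i) := fun i =>
    Set.inter_subset_right.trans (disjointed_subset _ i)
  have hAS : S = ⋃ i, A i := by
    rw [← Set.inter_iUnion, iUnion_disjointed, Set.left_eq_inter]
    simpa using hSt
  have hAm : ∀ i, MeasurableSet (A i) := fun i => IsSigmaCompact.measurableSet (hAs i)
  have hfib : ∀ i, Measurable fun u => μHE[finrank ℝ E - 1] (A i ∩ h ⁻¹' {u}) := by
    intro i
    have := measurable_euclideanHausdorffMeasure_fiber (T := ℝ) (finrank ℝ E - 1) (hAs i)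
      (F := fun p => h p.2 - p.1) (by
        refine ContinuousOn.sub ?_ continuous_fst.continuousOn
        exact ((hUc _ (heS i)).mono (hAU i)).comp continuous_snd.continuousOn fun p hp => hp.2)
    convert this using 3
    ext x; simp [sub_eq_zero]
  have hL : (∫⁻ u in B, μHE[finrank ℝ E - 1] (S ∩ h ⁻¹' {u})) =
      ∑' i, ∫⁻ u, μHE[finrank ℝ E - 1] ((A i ∩ h ⁻¹' B) ∩ h ⁻¹' {u}) := by
    have h1 : ∀ u, μHE[finrank ℝ E - 1] (S ∩ h ⁻¹' {u}) =
        ∑' i, μHE[finrank ℝ E - 1] (A i ∩ h ⁻¹' {u}) := by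
      intro u
      conv_lhs => rw [hAS, Set.iUnion_inter]
      exact measure_iUnion
        (fun i j hij => (hAd hij).mono Set.inter_subset_left Set.inter_subset_left)
        fun i => (hAm i).inter (hm (measurableSet_singleton u))
    simp_rw [h1]
    rw [lintegral_tsum fun i => (hfib i).aemeasurable]
    congr 1
    ext i
    rw [← lintegral_indicator hB]
    refine lintegral_congr fun u => ?_
    by_cases hu : u ∈ B
    · rw [Set.indicator_of_mem hu]
      congr 1
      ext x
      simp only [Set.mem_inter_iff, Set.mem_preimage, Set.mem_singleton_iff]
      constructor
      · rintro ⟨h1, rfl⟩; exact ⟨⟨h1, hu⟩, rfl⟩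
      · rintro ⟨⟨h1, -⟩, h2⟩; exact ⟨h1, h2⟩
    · rw [Set.indicator_of_notMem hu]
      have : (A i ∩ h ⁻¹' B) ∩ h ⁻¹' {u} = ∅ := by
        ext x
        simp only [Set.mem_inter_iff, Set.mem_preimage, Set.mem_singleton_iff,
          Set.mem_empty_iff_false, iff_false]
        rintro ⟨⟨-, h1⟩, rfl⟩; exact hu h1
      rw [this, measure_empty]
  have hR : (∫⁻ x in S ∩ h ⁻¹' B, ‖fderiv ℝ h x‖ₑ) =
      ∑' i, ∫⁻ x in A i ∩ h ⁻¹' B, ‖fderiv ℝ h x‖ₑ := by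
    conv_lhs => rw [hAS, Set.iUnion_inter]
    exact lintegral_iUnion (fun i => (hAm i).inter (hm hB))
      (fun i j hij => (hAd hij).mono Set.inter_subset_left Set.inter_subset_left) _
  rw [hL, hR, ← ENNReal.tsum_mul_left, ← ENNReal.tsum_mul_left]
  have key := fun i => hU (e i) (heS i) (A i ∩ h ⁻¹' B) (Set.inter_subset_left.trans (hAU i))
    ((hAm i).inter (hm hB))
  exact ⟨ENNReal.tsum_le_tsum fun i => (key i).1, ENNReal.tsum_le_tsum fun i => (key i).2⟩

theorem le_of_forall_one_lt_pow_mul {a b : ℝ≥0∞} (k : ℕ)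
    (hab : ∀ κ : ℝ≥0, 1 < κ → a ≤ (κ : ℝ≥0∞) ^ k * b) : a ≤ b := by
  have hlim : Tendsto (fun κ : ℝ≥0 => (κ : ℝ≥0∞) ^ k * b) (𝓝[>] 1) (𝓝 ((1 : ℝ≥0∞) ^ k * b)) := by
    refine ENNReal.Tendsto.mul_const ?_ (Or.inl (by simp))
    have : Tendsto (fun κ : ℝ≥0 => (κ : ℝ≥0∞) ^ k) (𝓝 1) (𝓝 (((1 : ℝ≥0) : ℝ≥0∞) ^ k)) :=
      ((ENNReal.continuous_pow k).comp ENNReal.continuous_coe).tendsto 1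
    simpa using this.mono_left nhdsWithin_le_nhds
  rw [one_pow, one_mul] at hlim
  exact ge_of_tendsto hlim (eventually_mem_nhdsWithin.mono fun κ hκ => hab κ hκ)

/-- The coarea formula on a set of regular points. -/
theorem setLIntegral_coarea {h : E → ℝ} {S : Set E} (hS : IsSigmaCompact S) (hm : Measurable h)
    (hh : ∀ x ∈ S, ContDiffAt ℝ 1 h x) (hd : ∀ x ∈ S, fderiv ℝ h x ≠ 0)
    {B : Set ℝ} (hB : MeasurableSet B) :
    (∫⁻ u in B, μHE[finrank ℝ E - 1] (S ∩ h ⁻¹' {u})) =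
      ∫⁻ x in S ∩ h ⁻¹' B, ‖fderiv ℝ h x‖ₑ :=
  le_antisymm
    (le_of_forall_one_lt_pow_mul _ fun _ hκ => (coarea_le hS hm hh hd hB hκ).1)
    (le_of_forall_one_lt_pow_mul _ fun _ hκ => (coarea_le hS hm hh hd hB hκ).2)

/-- The version over Borel sets of levels says that two measures on ℝ coincide: the one with density
the slice measure, and the image under `h` of the measure with density the norm of the derivative.
Integrating ψ against both gives the weighted form. -/
theorem lintegral_coarea {h : E → ℝ} {S : Set E} (hS : IsSigmaCompact S) (hm : Measurable h)
    (hh : ∀ x ∈ S, ContDiffAt ℝ 1 h x) (hd : ∀ x ∈ S, fderiv ℝ h x ≠ 0)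
    {ψ : ℝ → ℝ≥0∞} (hψ : Measurable ψ) :
    (∫⁻ u, ψ u * μHE[finrank ℝ E - 1] (S ∩ h ⁻¹' {u})) =
      ∫⁻ x in S, ψ (h x) * ‖fderiv ℝ h x‖ₑ := by
  have hfib : Measurable fun u => μHE[finrank ℝ E - 1] (S ∩ h ⁻¹' {u}) := by
    have := measurable_euclideanHausdorffMeasure_fiber (T := ℝ) (finrank ℝ E - 1) hS
      (F := fun p => h p.2 - p.1) (by
        refine ContinuousOn.sub ?_ continuous_fst.continuousOn
        exact ContinuousOn.comp (t := S) (fun x hx => (hh x hx).continuousAt.continuousWithinAt)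
          continuous_snd.continuousOn fun p hp => hp.2)
    convert this using 3
    ext x; simp [sub_eq_zero]
  have hdm : Measurable fun x => ‖fderiv ℝ h x‖ₑ := (measurable_fderiv ℝ h).enorm
  have hmeas : volume.withDensity (fun u => μHE[finrank ℝ E - 1] (S ∩ h ⁻¹' {u})) =
      ((volume.restrict S).withDensity fun x => ‖fderiv ℝ h x‖ₑ).map h := by
    ext B hB
    rw [withDensity_apply _ hB, Measure.map_apply hm hB, withDensity_apply _ (hm hB),
      setLIntegral_coarea hS hm hh hd hB, Measure.restrict_restrict (hm hB), Set.inter_comm]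
  calc _ = ∫⁻ u, ψ u ∂(volume.withDensity fun u => μHE[finrank ℝ E - 1] (S ∩ h ⁻¹' {u})) := by
        rw [lintegral_withDensity_eq_lintegral_mul _ hfib hψ]
        simp [mul_comm]
    _ = _ := by
        rw [hmeas, lintegral_map hψ hm,
          lintegral_withDensity_eq_lintegral_mul _ hdm (g := fun x => ψ (h x)) (hψ.comp hm)]
        simp [mul_comm]

end Coarea

end ArithmeticWave

namespace ArithmeticWave

/-! ### Bounding the regular zero set by counting zeros on axis-parallel lines -/

section RegularZeros

theorem measurableSet_unitCube (d : ℕ) : MeasurableSet (unitCube d) := by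
  have : unitCube d = ⋂ i, (fun x : EuclideanSpace ℝ (Fin d) => x i) ⁻¹' Set.Ico (0 : ℝ) 1 := by
    ext x; simp [unitCube]
  rw [this]
  exact MeasurableSet.iInter fun i => (by fun_prop : Measurable _) measurableSet_Ico

theorem volume_unitCube (d : ℕ) : volume (unitCube d) = 1 := by
  have : unitCube d = (MeasurableEquiv.toLp 2 (Fin d → ℝ)).symm ⁻¹'
      (Set.univ.pi fun _ => Set.Ico (0 : ℝ) 1) := by
    ext x; simp [unitCube]
  rw [this, (EuclideanSpace.volume_preserving_symm_measurableEquiv_toLp (Fin d)).measure_preimage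
    (MeasurableSet.univ_pi fun _ => measurableSet_Ico).nullMeasurableSet, Real.volume_pi_Ico]
  simp

/-- The coordinate projection forgetting the `k`-th coordinate. -/
noncomputable def dropCoord {m : ℕ} (k : Fin (m + 1)) (x : EuclideanSpace ℝ (Fin (m + 1))) :
    EuclideanSpace ℝ (Fin m) :=
  WithLp.toLp 2 fun i => x (k.succAbove i)

theorem continuous_dropCoord {m : ℕ} (k : Fin (m + 1)) : Continuous (dropCoord k) := by
  unfold dropCoord
  fun_prop

theorem euclidean_norm_le_sum {ι : Type*} [Fintype ι] (x : EuclideanSpace ℝ ι) :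
    ‖x‖ ≤ ∑ i, |x i| := by
  classical
  have : x = ∑ i, EuclideanSpace.single i (x i) := by
    ext j
    simp [Finset.sum_apply, Pi.single_apply]
  calc ‖x‖ = ‖∑ i, EuclideanSpace.single i (x i)‖ := by rw [← this]
    _ ≤ ∑ i, ‖EuclideanSpace.single i (x i)‖ := norm_sum_le _ _
    _ = _ := by simp

theorem euclidean_eq_sum_single {ι : Type*} [Fintype ι] [DecidableEq ι] (x : EuclideanSpace ℝ ι) :
    x = ∑ i, x i • EuclideanSpace.single i (1 : ℝ) := by
  ext j
  simp [Finset.sum_apply, Pi.single_apply]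

/-- Near a zero where the `k`-th partial derivative dominates, the zero set is a Lipschitz graph
over the hyperplane orthogonal to the `k`-th axis. -/
theorem exists_nhds_dist_le_dropCoord {m : ℕ} {f : EuclideanSpace ℝ (Fin (m + 1)) → ℝ}
    {p : EuclideanSpace ℝ (Fin (m + 1))} (hf : HasStrictFDerivAt f (fderiv ℝ f p) p)
    {k : Fin (m + 1)} (hk : fderiv ℝ f p (EuclideanSpace.single k 1) ≠ 0)
    (hmax : ∀ j, |fderiv ℝ f p (EuclideanSpace.single j 1)| ≤
      |fderiv ℝ f p (EuclideanSpace.single k 1)|) :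
    ∃ U ∈ 𝓝 p, ∀ x ∈ U, ∀ y ∈ U, f x = 0 → f y = 0 →
      edist x y ≤ ((4 * m : ℝ≥0) : ℝ≥0∞) * edist (dropCoord k x) (dropCoord k y) := by
  set b : ℝ := |fderiv ℝ f p (EuclideanSpace.single k 1)| with hb
  have hb0 : 0 < b := abs_pos.2 hk
  -- Half of the dominant derivative: the linearisation error then costs only ‖z‖/2, which can be
  -- absorbed.
  set δ : ℝ≥0 := Real.toNNReal (b / 2) with hδ
  have hδ' : (δ : ℝ) = b / 2 := Real.coe_toNNReal _ (by positivity)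
  have hδ0 : 0 < δ := Real.toNNReal_pos.2 (by positivity)
  obtain ⟨U, hU, hUa⟩ : ∃ U ∈ 𝓝 p, ∀ x ∈ U, ∀ y ∈ U,
      ‖f x - f y - fderiv ℝ f p (x - y)‖ ≤ δ * ‖x - y‖ :=
    hf.approximates_deriv_on_nhds (c := δ) (Or.inr hδ0)
  refine ⟨U, hU, fun x hx y hy hfx hfy => ?_⟩
  have h1 := hUa x hx y hy
  rw [hfx, hfy, sub_zero, zero_sub, norm_neg, Real.norm_eq_abs, hδ'] at h1
  set z := x - y with hz
  have h2 : fderiv ℝ f p z = ∑ j, z j * fderiv ℝ f p (EuclideanSpace.single j 1) := by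
    conv_lhs => rw [euclidean_eq_sum_single z]
    simp
  rw [h2, Fin.sum_univ_succAbove _ k] at h1
  set s := ∑ i : Fin m, |z (k.succAbove i)| with hs
  have h3 : |∑ i : Fin m, z (k.succAbove i) *
      fderiv ℝ f p (EuclideanSpace.single (k.succAbove i) 1)| ≤ b * s := by
    rw [hs, Finset.mul_sum]
    refine (Finset.abs_sum_le_sum_abs _ _).trans (Finset.sum_le_sum fun i _ => ?_)
    rw [abs_mul, mul_comm]
    exact mul_le_mul_of_nonneg_right (hmax _) (abs_nonneg _)
  have h4 : b * |z k| ≤ b * s + b / 2 * ‖z‖ := by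
    have h5 : b * |z k| = |z k * fderiv ℝ f p (EuclideanSpace.single k 1)| := by
      rw [abs_mul, mul_comm]
    rw [h5]
    have := abs_sub_le_iff.1 (abs_abs_sub_abs_le (z k * fderiv ℝ f p (EuclideanSpace.single k 1))
      (-(∑ i : Fin m, z (k.succAbove i) *
        fderiv ℝ f p (EuclideanSpace.single (k.succAbove i) 1))))
    rw [sub_neg_eq_add, abs_neg] at this
    linarith [this.1]
  have h5 : |z k| ≤ s + ‖z‖ / 2 := by
    have : b * |z k| ≤ b * (s + ‖z‖ / 2) := by linarith
    exact le_of_mul_le_mul_left this hb0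
  have h6 : ‖z‖ ≤ |z k| + s := by
    have := euclidean_norm_le_sum z
    rwa [Fin.sum_univ_succAbove _ k] at this
  have h7 : s ≤ m * ‖dropCoord k x - dropCoord k y‖ := by
    have : ∀ i : Fin m, |z (k.succAbove i)| ≤ ‖dropCoord k x - dropCoord k y‖ := fun i => by
      have := PiLp.norm_apply_le (dropCoord k x - dropCoord k y) i
      simpa [dropCoord, hz] using this
    calc s ≤ ∑ _i : Fin m, ‖dropCoord k x - dropCoord k y‖ := Finset.sum_le_sum fun i _ => this i
      _ = _ := by simp
  -- From |z_k| ≤ s + ‖z‖/2 and ‖z‖ ≤ |z_k| + s follows ‖z‖ ≤ 4s, while s ≤ m times the distance of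
  -- the projections.
  have h8 : dist x y ≤ (4 * m : ℝ≥0) * dist (dropCoord k x) (dropCoord k y) := by
    rw [dist_eq_norm, dist_eq_norm]
    push_cast
    nlinarith
  rw [edist_nndist, edist_nndist, ← ENNReal.coe_mul]
  exact_mod_cast h8

/-- The part of the zero set of `f` in the unit cube where the `k`-th partial derivative
dominates. -/
def dominantZeros {m : ℕ} (f : EuclideanSpace ℝ (Fin (m + 1)) → ℝ) (k : Fin (m + 1)) :
    Set (EuclideanSpace ℝ (Fin (m + 1))) :=
  {x | x ∈ unitCube (m + 1) ∧ f x = 0 ∧ fderiv ℝ f x (EuclideanSpace.single k 1) ≠ 0 ∧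
    ∀ j, |fderiv ℝ f x (EuclideanSpace.single j 1)| ≤
      |fderiv ℝ f x (EuclideanSpace.single k 1)|}

/-- `f` has at most `M` zeros on each unit segment parallel to an axis, unless it vanishes on the
whole line. -/
def AxisZerosLE {d : ℕ} (f : EuclideanSpace ℝ (Fin d) → ℝ) (M : ℕ) : Prop :=
  ∀ (k : Fin d) (x : EuclideanSpace ℝ (Fin d)),
    (∃ t : ℝ, f (x + t • EuclideanSpace.single k 1) ≠ 0) → ∀ F : Finset ℝ,
    (∀ t ∈ F, t ∈ Set.Ico (0 : ℝ) 1 ∧ f (x + t • EuclideanSpace.single k 1) = 0) → F.card ≤ M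

theorem fderiv_single_eq_zero_of_vanish {d : ℕ} {f : EuclideanSpace ℝ (Fin d) → ℝ}
    (hf : ContDiff ℝ 1 f) (k : Fin d) (x : EuclideanSpace ℝ (Fin d))
    (h : ∀ t : ℝ, f (x + t • EuclideanSpace.single k 1) = 0) :
    fderiv ℝ f x (EuclideanSpace.single k 1) = 0 := by
  have h1 := (hf.differentiable one_ne_zero x).hasFDerivAt.hasLineDerivAt (EuclideanSpace.single k 1)
  have h2 : HasDerivAt (fun t : ℝ => f (x + t • EuclideanSpace.single k 1)) 0 0 := by
    simp_rw [h]; exact hasDerivAt_const _ _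
  exact h1.unique h2

/-- Points with the same projection lie on one line parallel to the k-th axis, and `f` does not
vanish identically on it since its k-th derivative is nonzero at such a point. -/
theorem card_le_of_dropCoord_eq {m : ℕ} {f : EuclideanSpace ℝ (Fin (m + 1)) → ℝ}
    (hf : ContDiff ℝ 1 f) {M : ℕ} (hM : AxisZerosLE f M) (k : Fin (m + 1))
    (y : EuclideanSpace ℝ (Fin m)) (G : Finset (EuclideanSpace ℝ (Fin (m + 1))))
    (hG : ∀ x ∈ G, x ∈ dominantZeros f k ∧ dropCoord k x = y) : G.card ≤ M := by
  rcases G.eq_empty_or_nonempty with rfl | ⟨z, hz⟩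
  · simp
  have hline : ∀ x ∈ G, x = (z + (-(z k)) • EuclideanSpace.single k 1) +
      (x k) • EuclideanSpace.single k (1 : ℝ) := by
    intro x hx
    have h1 : dropCoord k x = dropCoord k z := ((hG x hx).2).trans ((hG z hz).2).symm
    ext j
    rcases eq_or_ne j k with rfl | hj
    · simp
    · obtain ⟨i, rfl⟩ := Fin.exists_succAbove_eq hj
      have h2 := congrArg (fun w => w.ofLp i) h1
      simp only [dropCoord] at h2
      simp [h2]
  have hinj : Set.InjOn (fun x : EuclideanSpace ℝ (Fin (m + 1)) => x k) G := by
    intro x hx x' hx' hxx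
    rw [hline x hx, hline x' hx']
    simp only at hxx
    rw [hxx]
  rw [← Finset.card_image_of_injOn hinj]
  refine hM k (z + (-(z k)) • EuclideanSpace.single k 1) ?_ _ ?_
  · by_contra hcon
    push Not at hcon
    refine (hG z hz).1.2.2.1 (fderiv_single_eq_zero_of_vanish hf k z fun t => ?_)
    have := hcon (z k + t)
    rwa [show z + (-(z k)) • EuclideanSpace.single k (1 : ℝ) + (z k + t) • EuclideanSpace.single k 1
      = z + t • EuclideanSpace.single k (1 : ℝ) by module] at this
  · intro t ht
    obtain ⟨x, hx, rfl⟩ := Finset.mem_image.1 ht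
    refine ⟨(hG x hx).1.1 k, ?_⟩
    rw [← hline x hx]
    exact (hG x hx).1.2.1

theorem measurableSet_dominantZeros {m : ℕ} {f : EuclideanSpace ℝ (Fin (m + 1)) → ℝ}
    (hf : ContDiff ℝ 1 f) (k : Fin (m + 1)) : MeasurableSet (dominantZeros f k) := by
  have hd : ∀ j, Measurable fun x => fderiv ℝ f x (EuclideanSpace.single j 1) := fun j =>
    measurable_fderiv_apply_const ℝ f _
  have : dominantZeros f k = unitCube (m + 1) ∩ (f ⁻¹' {0} ∩
      ({x | fderiv ℝ f x (EuclideanSpace.single k 1) = 0}ᶜ ∩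
      ⋂ j, {x | |fderiv ℝ f x (EuclideanSpace.single j 1)| ≤
        |fderiv ℝ f x (EuclideanSpace.single k 1)|})) := by
    ext x
    simp only [dominantZeros, Set.mem_ofPred_eq, Set.mem_inter_iff, Set.mem_preimage,
      Set.mem_singleton_iff, Set.mem_compl_iff, Set.mem_iInter, ne_eq]
  rw [this]
  refine (measurableSet_unitCube _).inter ((hf.continuous.measurable (measurableSet_singleton 0)).inter
    (MeasurableSet.inter ?_ (MeasurableSet.iInter fun j => ?_)))
  · exact (measurableSet_eq_fun (hd k) measurable_const).compl
  · exact measurableSet_le (hd j).abs (hd k).abs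

/-- The set is cut into countably many pieces on which forgetting the k-th coordinate has a
Lipschitz inverse. The projections of the pieces lie in the unit cube of dimension `m` and cover
each point at most `M` times, so their volumes add up to at most `M`. -/
theorem euclideanHausdorffMeasure_dominantZeros_le {m : ℕ}
    {f : EuclideanSpace ℝ (Fin (m + 1)) → ℝ} (hf : ContDiff ℝ 1 f) {M : ℕ}
    (hM : AxisZerosLE f M) (k : Fin (m + 1)) :
    μHE[m] (dominantZeros f k) ≤ ((4 * m : ℝ≥0) : ℝ≥0∞) ^ m * M := by
  rcases (dominantZeros f k).eq_empty_or_nonempty with h0 | hne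
  · simp [h0]
  choose! U hUn hU using fun x (hx : x ∈ dominantZeros f k) =>
    exists_nhds_dist_le_dropCoord (hf.contDiffAt.hasStrictFDerivAt one_ne_zero) hx.2.2.1 hx.2.2.2
  obtain ⟨t, htS, htc, hSt⟩ := TopologicalSpace.countable_cover_nhdsWithin
    (fun x hx => mem_nhdsWithin_of_mem_nhds (interior_mem_nhds.2 (hUn x hx)))
  have htne : t.Nonempty := by
    by_contra h
    rw [Set.not_nonempty_iff_eq_empty.1 h] at hSt
    simp at hSt
    exact hne.ne_empty hSt
  obtain ⟨e, rfl⟩ := htc.exists_eq_range htne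
  have heS : ∀ i, e i ∈ dominantZeros f k := fun i => htS ⟨i, rfl⟩
  set A : ℕ → Set (EuclideanSpace ℝ (Fin (m + 1))) := fun i =>
    dominantZeros f k ∩ disjointed (fun i => interior (U (e i))) i with hAdef
  have hAd : Pairwise (Function.onFun Disjoint A) := fun i j hij =>
    (disjoint_disjointed (fun i => interior (U (e i))) hij).mono
      Set.inter_subset_right Set.inter_subset_right
  have hAU : ∀ i, A i ⊆ U (e i) := fun i =>
    Set.inter_subset_right.trans ((disjointed_subset _ i).trans interior_subset)
  have hAS : dominantZeros f k = ⋃ i, A i := by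
    rw [← Set.inter_iUnion, iUnion_disjointed, Set.left_eq_inter]
    simpa using hSt
  have hAm : ∀ i, MeasurableSet (A i) := fun i =>
    (measurableSet_dominantZeros hf k).inter
      (MeasurableSet.disjointed (fun i => isOpen_interior.measurableSet) i)
  have hAl : ∀ i, ∀ x ∈ A i, ∀ y ∈ A i, edist x y ≤
      ((4 * m : ℝ≥0) : ℝ≥0∞) * edist (dropCoord k x) (dropCoord k y) := fun i x hx y hy =>
    hU (e i) (heS i) x (hAU i hx) y (hAU i hy) hx.1.2.1 hy.1.2.1
  have hinj : ∀ i, Set.InjOn (dropCoord k) (A i) := fun i x hx y hy hxy => by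
    have := hAl i x hx y hy
    rw [hxy, edist_self, mul_zero] at this
    exact edist_le_zero.1 this
  have hIm : ∀ i, MeasurableSet (dropCoord k '' A i) := fun i =>
    (hAm i).image_of_continuousOn_injOn (continuous_dropCoord k).continuousOn (hinj i)
  have hpt : ∀ y, ∑' i, (dropCoord k '' A i).indicator (fun _ => (1 : ℝ≥0∞)) y ≤
      (unitCube m).indicator (fun _ => (M : ℝ≥0∞)) y := by
    intro y
    by_cases hy : y ∈ unitCube m
    · rw [Set.indicator_of_mem hy, ENNReal.tsum_eq_iSup_sum]
      refine iSup_le fun I => ?_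
      classical
      rw [Finset.sum_indicator_eq_sum_filter]
      simp only [Finset.sum_const, nsmul_eq_mul, mul_one, Nat.cast_le]
      set J := I.filter fun i => y ∈ dropCoord k '' A i with hJ
      have hJm : ∀ i ∈ J, ∃ x, x ∈ A i ∧ dropCoord k x = y := fun i hi =>
        (Finset.mem_filter.1 hi).2
      choose! z hzA hzy using hJm
      -- Disjoint pieces provide distinct preimages of `y`, so the overlap at `y` is bounded by the
      -- number of zeros on one line.
      have hzinj : Set.InjOn z J := by
        intro i hi j hj hij
        by_contra hne
        exact Set.disjoint_left.1 (hAd hne) (hzA i hi) (hij ▸ hzA j hj)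
      rw [← Finset.card_image_of_injOn hzinj]
      refine card_le_of_dropCoord_eq hf hM k y _ fun x hx => ?_
      obtain ⟨i, hi, rfl⟩ := Finset.mem_image.1 hx
      exact ⟨(hzA i hi).1, hzy i hi⟩
    · rw [Set.indicator_of_notMem hy]
      simp only [nonpos_iff_eq_zero, ENNReal.tsum_eq_zero]
      intro i
      refine Set.indicator_of_notMem ?_ _
      rintro ⟨x, hx, rfl⟩
      exact hy fun i => hx.1.1 _
  calc μHE[m] (dominantZeros f k) = ∑' i, μHE[m] (A i) := by
        conv_lhs => rw [hAS]
        exact measure_iUnion hAd hAm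
    _ ≤ ∑' i, ((4 * m : ℝ≥0) : ℝ≥0∞) ^ m * volume (dropCoord k '' A i) := by
        refine ENNReal.tsum_le_tsum fun i => ?_
        rw [← EuclideanSpace.euclideanHausdorffMeasure_eq_volume]
        exact euclideanHausdorffMeasure_le_image (hAl i) m
    _ = ((4 * m : ℝ≥0) : ℝ≥0∞) ^ m * ∫⁻ y, ∑' i,
          (dropCoord k '' A i).indicator (fun _ => (1 : ℝ≥0∞)) y := by
        rw [ENNReal.tsum_mul_left, lintegral_tsum
          fun i => (measurable_const.indicator (hIm i)).aemeasurable]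
        congr 2
        ext i
        rw [lintegral_indicator_const (hIm i), one_mul]
    _ ≤ ((4 * m : ℝ≥0) : ℝ≥0∞) ^ m * ∫⁻ y, (unitCube m).indicator (fun _ => (M : ℝ≥0∞)) y := by
        gcongr with y
        exact hpt y
    _ = _ := by
        rw [lintegral_indicator_const (measurableSet_unitCube m), volume_unitCube, mul_one]

/-- The regular part of the zero set of `f` in the unit cube has a measure bounded in terms of the
number of zeros on lines parallel to the axes. -/
theorem euclideanHausdorffMeasure_regularZeros_le {m : ℕ}
    {f : EuclideanSpace ℝ (Fin (m + 1)) → ℝ} (hf : ContDiff ℝ 1 f) {M : ℕ}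
    (hM : AxisZerosLE f M) :
    μHE[m] {x | x ∈ unitCube (m + 1) ∧ f x = 0 ∧ fderiv ℝ f x ≠ 0} ≤
      (m + 1) * (((4 * m : ℝ≥0) : ℝ≥0∞) ^ m * M) := by
  have hsub : {x | x ∈ unitCube (m + 1) ∧ f x = 0 ∧ fderiv ℝ f x ≠ 0} ⊆
      ⋃ k, dominantZeros f k := by
    rintro x ⟨hx, hfx, hd⟩
    obtain ⟨k, -, hk⟩ := Finset.exists_max_image Finset.univ
      (fun j => |fderiv ℝ f x (EuclideanSpace.single j 1)|) ⟨0, Finset.mem_univ _⟩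
    refine Set.mem_iUnion.2 ⟨k, hx, hfx, fun h0 => hd ?_, fun j => hk j (Finset.mem_univ j)⟩
    ext y
    rw [euclidean_eq_sum_single y, map_sum, zero_apply]
    refine Finset.sum_eq_zero fun j _ => ?_
    have := hk j (Finset.mem_univ j)
    rw [h0, abs_zero] at this
    rw [map_smul, abs_nonpos_iff.1 this, smul_zero]
  calc _ ≤ μHE[m] (⋃ k, dominantZeros f k) := measure_mono hsub
    _ ≤ ∑ k, μHE[m] (dominantZeros f k) := measure_iUnion_fintype_le _ _
    _ ≤ ∑ _k : Fin (m + 1), ((4 * m : ℝ≥0) : ℝ≥0∞) ^ m * M :=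
        Finset.sum_le_sum fun k _ => euclideanHausdorffMeasure_dominantZeros_le hf hM k
    _ = _ := by simp

end RegularZeros

end ArithmeticWave

namespace ArithmeticWave

/-! ### Standard Gaussian vectors: independence, resampling, oblique projection -/

section GaussianTools

variable {E : Type*} [NormedAddCommGroup E] [InnerProductSpace ℝ E] [FiniteDimensional ℝ E]
  [MeasurableSpace E] [BorelSpace E]

local notation "⟪" x ", " y "⟫" => inner ℝ x y

theorem hasLaw_inner_orthonormal {κ : Type*} [Fintype κ] {b : κ → E} (hb : Orthonormal ℝ b) :
    HasLaw (fun (ξ : E) (i : κ) => ⟪b i, ξ⟫) (Measure.pi fun _ : κ => gaussianReal 0 1)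
      (stdGaussian E) := by
  have hmeas : Measurable fun ξ : E => (WithLp.toLp 2 fun i => ⟪b i, ξ⟫ : EuclideanSpace ℝ κ) := by
    fun_prop
  have hmap : (stdGaussian E).map (fun ξ : E => (WithLp.toLp 2 fun i => ⟪b i, ξ⟫ :
      EuclideanSpace ℝ κ)) = stdGaussian (EuclideanSpace ℝ κ) := by
    have := Measure.isProbabilityMeasure_map (μ := stdGaussian E) hmeas.aemeasurable
    apply Measure.ext_of_charFun
    ext t
    have h1 : ∀ ξ : E, ⟪(WithLp.toLp 2 fun i => ⟪b i, ξ⟫ : EuclideanSpace ℝ κ), t⟫ =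
        ⟪ξ, ∑ i, t i • b i⟫ := by
      intro ξ
      rw [PiLp.inner_apply, inner_sum]
      refine Finset.sum_congr rfl fun i _ => ?_
      rw [inner_smul_right, real_inner_comm]
      simp [real_inner_comm, mul_comm]
    have h2 : ‖∑ i, t i • b i‖ ^ 2 = ‖t‖ ^ 2 := by
      rw [← real_inner_self_eq_norm_sq, hb.inner_sum, EuclideanSpace.real_norm_sq_eq]
      simp [sq]
    rw [charFun_apply, integral_map hmeas.aemeasurable
      (Measurable.aestronglyMeasurable (by fun_prop))]
    simp_rw [h1]
    rw [← charFun_apply, charFun_stdGaussian, charFun_stdGaussian]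
    norm_cast
    rw [h2]
  refine ⟨by fun_prop, ?_⟩
  have h3 : (fun (ξ : E) (i : κ) => ⟪b i, ξ⟫) = (WithLp.ofLp (p := 2)) ∘
      fun ξ : E => (WithLp.toLp 2 fun i => ⟪b i, ξ⟫ : EuclideanSpace ℝ κ) := rfl
  rw [h3, ← Measure.map_map (by fun_prop) hmeas, hmap, ← map_pi_eq_stdGaussian,
    Measure.map_map (by fun_prop) (by fun_prop)]
  exact Measure.map_id

theorem hasLaw_inner_unit {e : E} (he : ‖e‖ = 1) :
    HasLaw (fun ξ : E => ⟪e, ξ⟫) (gaussianReal 0 1) (stdGaussian E) := by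
  have hb : Orthonormal ℝ (fun _ : Unit => e) := by
    rw [orthonormal_iff_ite]; intro i j; simp [he]
  have h := hasLaw_inner_orthonormal hb
  refine ⟨by fun_prop, ?_⟩
  have h2 : (fun ξ : E => ⟪e, ξ⟫) = (Function.eval ()) ∘ fun (ξ : E) (_ : Unit) => ⟪e, ξ⟫ := rfl
  rw [h2, ← Measure.map_map (by fun_prop) (by fun_prop), h.map_eq]
  exact (measurePreserving_eval (fun _ : Unit => gaussianReal 0 1) ()).map_eq

/-- The pair is jointly Gaussian, and the covariance of ⟪p, ξ⟫ with a functional L of R ξ is L (R p)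
= 0. -/
theorem indepFun_inner_of_apply_eq_zero {F : Type*} [NormedAddCommGroup F] [NormedSpace ℝ F]
    [MeasurableSpace F] [BorelSpace F] [SecondCountableTopology F] [CompleteSpace F]
    {p : E} {R : E →L[ℝ] F} (hR : R p = 0) :
    IndepFun (fun ξ : E => ⟪p, ξ⟫) (fun ξ => R ξ) (stdGaussian E) := by
  have hG : HasGaussianLaw (fun ξ : E => (⟪p, ξ⟫, R ξ)) (stdGaussian E) :=
    (IsGaussian.hasGaussianLaw_id (μ := stdGaussian E)).map_fun ((innerSL ℝ p).prod R)
  refine hG.indepFun_of_covariance_strongDual fun L₁ L₂ => ?_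
  set y : E := (InnerProductSpace.toDual ℝ E).symm (L₂ ∘L R) with hy
  have h1 : (L₂ ∘ fun ξ => R ξ) = fun ξ => ⟪y, ξ⟫ := by
    ext ξ; simp [hy, InnerProductSpace.toDual_symm_apply]
  have h2 : (L₁ ∘ fun ξ : E => ⟪p, ξ⟫) = fun ξ => ⟪(L₁ 1) • p, ξ⟫ := by
    ext ξ
    have : L₁ ⟪p, ξ⟫ = ⟪p, ξ⟫ • L₁ 1 := by rw [← map_smul]; simp
    simp [this, real_inner_smul_left, mul_comm]
  rw [h1, h2, ← covarianceBilin_apply_eq_cov IsGaussian.memLp_two_id, covarianceBilin_stdGaussian,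
    innerSL_apply_apply, real_inner_comm, inner_smul_right, hy,
    InnerProductSpace.toDual_symm_apply]
  simp [hR]

theorem lintegral_inner_prod {F : Type*} [NormedAddCommGroup F] [NormedSpace ℝ F]
    [MeasurableSpace F] [BorelSpace F] [SecondCountableTopology F] [CompleteSpace F]
    {e : E} (he : ‖e‖ = 1) {R : E →L[ℝ] F} (hR : R e = 0) {Ψ : ℝ × F → ℝ≥0∞}
    (hΨ : Measurable Ψ) :
    ∫⁻ ξ, Ψ (⟪e, ξ⟫, R ξ) ∂stdGaussian E =
      ∫⁻ ξ, ∫⁻ s, Ψ (s, R ξ) ∂gaussianReal 0 1 ∂stdGaussian E := by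
  have hind := indepFun_inner_of_apply_eq_zero hR
  rw [indepFun_iff_map_prod_eq_prod_map_map (by fun_prop) (by fun_prop),
    (hasLaw_inner_unit he).map_eq] at hind
  calc _ = ∫⁻ q, Ψ q ∂((stdGaussian E).map fun ξ => (⟪e, ξ⟫, R ξ)) :=
        (lintegral_map hΨ (by fun_prop)).symm
    _ = ∫⁻ r, ∫⁻ s, Ψ (s, r) ∂gaussianReal 0 1 ∂((stdGaussian E).map fun ξ => R ξ) := by
        have : IsProbabilityMeasure ((stdGaussian E).map fun ξ => R ξ) :=
          Measure.isProbabilityMeasure_map (by fun_prop)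
        rw [hind, lintegral_prod_symm _ hΨ.aemeasurable]
    _ = _ := lintegral_map hΨ.lintegral_prod_left' (by fun_prop)

/-- Resampling the component of a standard Gaussian vector along a unit vector. -/
theorem lintegral_resample {e : E} (he : ‖e‖ = 1) {F : E → ℝ≥0∞} (hF : Measurable F) :
    ∫⁻ ξ, F ξ ∂stdGaussian E =
      ∫⁻ ξ, ∫⁻ s, F (ξ - ⟪e, ξ⟫ • e + s • e) ∂gaussianReal 0 1 ∂stdGaussian E := by
  have hR : (ContinuousLinearMap.id ℝ E - (innerSL ℝ e).smulRight e) e = 0 := by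
    simp [he]
  have h := lintegral_inner_prod he hR (Ψ := fun q => F (q.2 + q.1 • e)) (by fun_prop)
  simp at h
  exact h

theorem lintegral_gaussianReal_eq (g : ℝ → ℝ≥0∞) (hg : Measurable g) :
    ∫⁻ s, g s ∂gaussianReal 0 1 = ∫⁻ s, gaussianPDF 0 1 s * g s := by
  rw [gaussianReal_of_var_ne_zero _ one_ne_zero,
    lintegral_withDensity_eq_lintegral_mul _ (measurable_gaussianPDF 0 1) hg]
  rfl

theorem gaussianPDF_zero_one (s : ℝ) :
    gaussianPDF 0 1 s = ENNReal.ofReal ((√(2 * Real.pi))⁻¹ * Real.exp (-s ^ 2 / 2)) := by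
  simp [gaussianPDF, gaussianPDFReal]

/-- Substitute s = κ·r. The Jacobian cancels `‖κ‖ₑ⁻¹`, and the densities at κr and σr multiply to
(2π)^{-1/2} times the density at r because κ² + σ² = 1. -/
theorem lintegral_gaussianPDF_tilt {κ σ : ℝ} (hκ : κ ≠ 0) (hκσ : κ ^ 2 + σ ^ 2 = 1)
    {g : ℝ → ℝ≥0∞} (hg : Measurable g) :
    ∫⁻ s, gaussianPDF 0 1 (-(σ * (s / κ))) * g (s / κ) * ‖κ‖ₑ⁻¹ ∂gaussianReal 0 1 =
      ENNReal.ofReal (√(2 * Real.pi))⁻¹ * ∫⁻ c, g c ∂gaussianReal 0 1 := by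
  have hpm := measurable_gaussianPDF 0 1
  rw [lintegral_gaussianReal_eq _ (by fun_prop), lintegral_gaussianReal_eq _ hg,
    ← lintegral_const_mul _ (by fun_prop)]
  have hemb : MeasurableEmbedding (fun r : ℝ => κ * r) :=
    (Homeomorph.mulLeft₀ κ hκ).measurableEmbedding
  conv_lhs => rw [← Real.smul_map_volume_mul_left hκ]
  rw [lintegral_smul_measure, hemb.lintegral_map, smul_eq_mul,
    ← lintegral_const_mul' _ _ ENNReal.ofReal_ne_top]
  refine lintegral_congr fun r => ?_
  have h1 : κ * r / κ = r := by field_simp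
  have h2 : gaussianPDF 0 1 (κ * r) * gaussianPDF 0 1 (-(σ * r)) =
      ENNReal.ofReal (√(2 * Real.pi))⁻¹ * gaussianPDF 0 1 r := by
    simp only [gaussianPDF_zero_one]
    rw [← ENNReal.ofReal_mul (by positivity), ← ENNReal.ofReal_mul (by positivity)]
    congr 1
    have : Real.exp (-r ^ 2 / 2) =
        Real.exp (-(κ * r) ^ 2 / 2) * Real.exp (-(-(σ * r)) ^ 2 / 2) := by
      rw [← Real.exp_add]
      congr 1
      linear_combination (r ^ 2 / 2) * hκσ
    rw [this]; ring
  have h3 : ENNReal.ofReal |κ| * ‖κ‖ₑ⁻¹ = 1 := by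
    rw [← Real.norm_eq_abs, ofReal_norm]
    exact ENNReal.mul_inv_cancel (by simpa using hκ) (by simp)
  rw [h1]
  calc _ = (ENNReal.ofReal |κ| * ‖κ‖ₑ⁻¹) * (gaussianPDF 0 1 (κ * r) *
        gaussianPDF 0 1 (-(σ * r))) * g r := by ring
    _ = _ := by rw [h2, h3]; ring

/-- The Gaussian measure of the hyperplane `v^⊥`, computed by projecting along `e` and along
`v`. -/
theorem lintegral_oblique_projection {e v : E} (he : ‖e‖ = 1) (hv : ‖v‖ = 1)
    (hκ : ⟪e, v⟫ ≠ 0) {F : E → ℝ≥0∞} (hF : Measurable F) :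
    ∫⁻ ξ, gaussianPDF 0 1 (⟪e, ξ⟫ - ⟪v, ξ⟫ / ⟪e, v⟫) * F (ξ - (⟪v, ξ⟫ / ⟪e, v⟫) • e) *
        ‖⟪e, v⟫‖ₑ⁻¹ ∂stdGaussian E =
      ENNReal.ofReal (√(2 * Real.pi))⁻¹ * ∫⁻ ξ, F (ξ - ⟪v, ξ⟫ • v) ∂stdGaussian E := by
  set κ := ⟪e, v⟫ with hκdef
  have hpm := measurable_gaussianPDF 0 1
  have hvv : ⟪v, v⟫ = 1 := by rw [real_inner_self_eq_norm_sq, hv]; norm_num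
  have hee : ⟪e, e⟫ = 1 := by rw [real_inner_self_eq_norm_sq, he]; norm_num
  have hve : ⟪v, e⟫ = κ := real_inner_comm _ _
  -- Degenerate case v = ±e: the two projections coincide and no second direction is available.
  by_cases hw0 : v - κ • e = 0
  · have hvκ : v = κ • e := sub_eq_zero.1 hw0
    have hκ2 : κ * κ = 1 := by
      have := hvv
      rw [hvκ, inner_smul_left, inner_smul_right, hee] at this
      simpa using this
    have hinner : ∀ ξ, ⟪v, ξ⟫ = κ * ⟪e, ξ⟫ := fun ξ => by
      rw [hvκ, real_inner_smul_left]
    have habs : ‖κ‖ₑ = 1 := by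
      rw [← ofReal_norm, Real.norm_eq_abs]
      rcases mul_self_eq_one_iff.1 hκ2 with h | h <;> simp [h]
    rw [← lintegral_const_mul' _ _ ENNReal.ofReal_ne_top]
    refine lintegral_congr fun ξ => ?_
    have h1 : κ * ⟪e, ξ⟫ / κ = ⟪e, ξ⟫ := by field_simp
    have h2 : (κ * ⟪e, ξ⟫) • v = ⟪e, ξ⟫ • e := by
      rw [hvκ, smul_smul, mul_right_comm, hκ2, one_mul]
    rw [habs, hinner, h1, h2, sub_self, gaussianPDF_zero_one]
    simp
  · set σ : ℝ := ‖v - κ • e‖ with hσ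
    have hσ0 : σ ≠ 0 := norm_ne_zero_iff.2 hw0
    set w : E := σ⁻¹ • (v - κ • e) with hw
    have hσw : σ • w = v - κ • e := by rw [hw, smul_smul, mul_inv_cancel₀ hσ0, one_smul]
    have hvw : v = κ • e + σ • w := by rw [hσw]; abel
    have hσ2 : σ ^ 2 = 1 - κ ^ 2 := by
      rw [hσ, ← real_inner_self_eq_norm_sq]
      simp only [inner_sub_left, inner_sub_right, real_inner_smul_left, inner_smul_right, hvv, hee,
        hve, ← hκdef]
      ring
    have hwn : ‖w‖ = 1 := by
      rw [hw, norm_smul, ← hσ, norm_inv, Real.norm_eq_abs, abs_of_nonneg (norm_nonneg _)]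
      exact inv_mul_cancel₀ hσ0
    have hww : ⟪w, w⟫ = 1 := by rw [real_inner_self_eq_norm_sq, hwn]; norm_num
    have hew : ⟪e, w⟫ = 0 := by
      rw [hw, inner_smul_right, inner_sub_right, inner_smul_right, hee, ← hκdef]; simp
    have hwe : ⟪w, e⟫ = 0 := by rw [real_inner_comm, hew]
    clear_value w σ
    -- In the plane of e and v, (e, w) is an orthonormal basis with v = κe + σw, and u is the unit
    -- vector orthogonal to v.
    obtain ⟨u, hu⟩ : ∃ u : E, u = κ • w - σ • e := ⟨_, rfl⟩
    have hun : ‖u‖ = 1 := by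
      have : ‖u‖ ^ 2 = 1 := by
        rw [← real_inner_self_eq_norm_sq, hu]
        simp only [inner_sub_left, inner_sub_right, real_inner_smul_left, inner_smul_right, hee,
          hww, hew, hwe]
        linarith
      exact by nlinarith [norm_nonneg u]
    obtain ⟨R, hR⟩ : ∃ R : E →L[ℝ] E, R = ContinuousLinearMap.id ℝ E -
      (innerSL ℝ e).smulRight e - (innerSL ℝ w).smulRight w := ⟨_, rfl⟩
    have hRa : ∀ ξ, R ξ = ξ - ⟪e, ξ⟫ • e - ⟪w, ξ⟫ • w := fun ξ => by simp [hR]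
    have hRw : R w = 0 := by rw [hRa, hew, hww]; simp
    have hRu : R u = 0 := by
      rw [hRa, hu]
      simp only [inner_sub_right, inner_smul_right, hee, hww, hew, hwe]
      module
    have hvξ : ∀ ξ, ⟪v, ξ⟫ = κ * ⟪e, ξ⟫ + σ * ⟪w, ξ⟫ := fun ξ => by
      conv_lhs => rw [hvw]
      rw [inner_add_left, real_inner_smul_left, real_inner_smul_left]
    have huξ : ∀ ξ, ⟪u, ξ⟫ = κ * ⟪w, ξ⟫ - σ * ⟪e, ξ⟫ := fun ξ => by
      rw [hu, inner_sub_left, real_inner_smul_left, real_inner_smul_left]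
    -- Both projections land on R ξ + ℝ·u, with coordinate ⟪w, ξ⟫/κ for the oblique one and ⟪u, ξ⟫
    -- for the orthogonal one. Conditionally on R ξ, a one-dimensional identity remains.
    have hL : ∀ ξ, gaussianPDF 0 1 (⟪e, ξ⟫ - ⟪v, ξ⟫ / κ) * F (ξ - (⟪v, ξ⟫ / κ) • e) * ‖κ‖ₑ⁻¹ =
        (fun q : ℝ × E => gaussianPDF 0 1 (-(σ * (q.1 / κ))) * F (q.2 + (q.1 / κ) • u) * ‖κ‖ₑ⁻¹)
          (⟪w, ξ⟫, R ξ) := by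
      intro ξ
      have h1 : ⟪e, ξ⟫ - ⟪v, ξ⟫ / κ = -(σ * (⟪w, ξ⟫ / κ)) := by
        rw [hvξ]; field_simp; ring
      have h2 : ξ - (⟪v, ξ⟫ / κ) • e = R ξ + (⟪w, ξ⟫ / κ) • u := by
        rw [hRa, hu, hvξ, smul_sub, smul_smul, smul_smul]
        have h3 : (κ * ⟪e, ξ⟫ + σ * ⟪w, ξ⟫) / κ = ⟪e, ξ⟫ + ⟪w, ξ⟫ / κ * σ := by
          field_simp
        have h4 : ⟪w, ξ⟫ / κ * κ = ⟪w, ξ⟫ := by field_simp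
        rw [h3, h4]
        module
      simp only
      rw [h1, h2]
    have hRHS : ∀ ξ, F (ξ - ⟪v, ξ⟫ • v) = (fun q : ℝ × E => F (q.2 + q.1 • u)) (⟪u, ξ⟫, R ξ) := by
      intro ξ
      simp only
      congr 1
      rw [hRa, huξ, hvξ, hu]
      conv_lhs => rw [hvw]
      have hs : σ * σ = 1 - κ * κ := by nlinarith [hσ2]
      match_scalars
      · ring
      · linear_combination (-⟪e, ξ⟫) * hs
      · linear_combination (-⟪w, ξ⟫) * hs
    have hΨ₁ : Measurable fun q : ℝ × E =>
        gaussianPDF 0 1 (-(σ * (q.1 / κ))) * F (q.2 + (q.1 / κ) • u) * ‖κ‖ₑ⁻¹ := by fun_prop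
    have hΨ₂ : Measurable fun q : ℝ × E => F (q.2 + q.1 • u) := by fun_prop
    rw [lintegral_congr hL, lintegral_congr hRHS,
      (lintegral_inner_prod hwn hRw hΨ₁ :), (lintegral_inner_prod hun hRu hΨ₂ :),
      ← lintegral_const_mul' _ _ ENNReal.ofReal_ne_top]
    refine lintegral_congr fun ξ => ?_
    exact lintegral_gaussianPDF_tilt hκ (by linarith) (g := fun c => F (R ξ + c • u)) (by fun_prop)

end GaussianTools

end ArithmeticWave

/-! ### Isotropic frames and the absence of singular zeros -/

namespace ArithmeticWave

local notation "⟪" x ", " y "⟫" => inner ℝ x y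

/-- A unit vector field `v` on `ℝ^d`, with values in a Euclidean space, whose partial derivatives
are `c` times vector fields `w k` which form with `v` an orthonormal system. -/
structure IsIsotropicFrame {d : ℕ} {E : Type*} [NormedAddCommGroup E] [InnerProductSpace ℝ E]
    (v : EuclideanSpace ℝ (Fin d) → E) (w : Fin d → EuclideanSpace ℝ (Fin d) → E) (c : ℝ) :
    Prop where
  pos : 0 < c
  contDiff : ContDiff ℝ 1 v
  fderiv_single : ∀ x k, fderiv ℝ v x (EuclideanSpace.single k 1) = c • w k x
  orthonormal : ∀ x, Orthonormal ℝ (Fin.cons (v x) fun k => w k x : Fin (d + 1) → E)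
  lipschitz : ∃ L : ℝ≥0, LipschitzWith L v ∧ ∀ k, LipschitzWith L (w k)

/-- The vector of inner products with the fields `w k`, i.e. the normalised gradient. -/
noncomputable def gradVec {d : ℕ} {E : Type*} [NormedAddCommGroup E] [InnerProductSpace ℝ E]
    (w : Fin d → EuclideanSpace ℝ (Fin d) → E) (x : EuclideanSpace ℝ (Fin d)) (ξ : E) :
    EuclideanSpace ℝ (Fin d) :=
  WithLp.toLp 2 fun k => ⟪w k x, ξ⟫

theorem gaussianReal_Icc_le (ε : ℝ) :
    gaussianReal 0 1 (Set.Icc (-ε) ε) ≤ ENNReal.ofReal ε := by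
  rw [gaussianReal_apply _ one_ne_zero]
  calc _ ≤ ∫⁻ _ in Set.Icc (-ε) ε, ENNReal.ofReal 2⁻¹ := by
        refine lintegral_mono fun s => ?_
        rw [gaussianPDF_zero_one]
        refine ENNReal.ofReal_le_ofReal ?_
        have h1 : (√(2 * Real.pi))⁻¹ ≤ 2⁻¹ := by
          refine inv_anti₀ (by norm_num) (Real.le_sqrt_of_sq_le ?_)
          nlinarith [Real.pi_gt_three]
        have h2 : Real.exp (-s ^ 2 / 2) ≤ 1 := Real.exp_le_one_iff.2 (by nlinarith [sq_nonneg s])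
        nlinarith [Real.exp_pos (-s ^ 2 / 2)]
    _ = ENNReal.ofReal ε := by
        rw [setLIntegral_const, Real.volume_Icc, ← ENNReal.ofReal_mul (by norm_num)]
        congr 1; ring

namespace IsIsotropicFrame

section Basic

variable {d : ℕ} {E : Type*} [NormedAddCommGroup E] [InnerProductSpace ℝ E]
  {v : EuclideanSpace ℝ (Fin d) → E} {w : Fin d → EuclideanSpace ℝ (Fin d) → E} {c : ℝ}

theorem norm_v (h : IsIsotropicFrame v w c) (x : EuclideanSpace ℝ (Fin d)) : ‖v x‖ = 1 := by
  simpa using (h.orthonormal x).1 0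

theorem inner_v_v (h : IsIsotropicFrame v w c) (x : EuclideanSpace ℝ (Fin d)) :
    ⟪v x, v x⟫ = 1 := by
  rw [real_inner_self_eq_norm_sq, h.norm_v]; norm_num

theorem norm_w (h : IsIsotropicFrame v w c) (k : Fin d) (x : EuclideanSpace ℝ (Fin d)) :
    ‖w k x‖ = 1 := by
  simpa using (h.orthonormal x).1 k.succ

theorem inner_v_w (h : IsIsotropicFrame v w c) (x : EuclideanSpace ℝ (Fin d)) (k : Fin d) :
    ⟪v x, w k x⟫ = 0 := by
  simpa using (h.orthonormal x).2 (i := 0) (j := k.succ) (Fin.succ_ne_zero k).symm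

theorem orthonormal_w (h : IsIsotropicFrame v w c) (x : EuclideanSpace ℝ (Fin d)) :
    Orthonormal ℝ fun k => w k x := by
  simpa [Function.comp_def] using (h.orthonormal x).comp Fin.succ (Fin.succ_injective d)

theorem continuous_v (h : IsIsotropicFrame v w c) : Continuous v := h.contDiff.continuous

theorem continuous_w (h : IsIsotropicFrame v w c) (k : Fin d) : Continuous (w k) := by
  obtain ⟨L, -, hL⟩ := h.lipschitz
  exact (hL k).continuous

theorem continuous_gradVec (h : IsIsotropicFrame v w c) :
    Continuous fun p : EuclideanSpace ℝ (Fin d) × E => gradVec w p.1 p.2 := by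
  unfold gradVec
  have := h.continuous_w
  fun_prop

theorem gradVec_sub_smul_v (h : IsIsotropicFrame v w c) (x : EuclideanSpace ℝ (Fin d)) (ξ : E)
    (t : ℝ) : gradVec w x (ξ - t • v x) = gradVec w x ξ := by
  ext k
  simp [gradVec, inner_sub_right, inner_smul_right, real_inner_comm _ (w k x), h.inner_v_w]

theorem hasFDerivAt_inner (h : IsIsotropicFrame v w c) (x : EuclideanSpace ℝ (Fin d)) (ξ : E) :
    HasFDerivAt (fun y => ⟪v y, ξ⟫) (c • innerSL ℝ (gradVec w x ξ)) x := by
  have h1 : HasFDerivAt (fun y => ⟪ξ, v y⟫) ((innerSL ℝ ξ) ∘L (fderiv ℝ v x)) x :=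
    (innerSL ℝ ξ).hasFDerivAt.comp x (h.contDiff.differentiable one_ne_zero x).hasFDerivAt
  have h2 : (innerSL ℝ ξ) ∘L (fderiv ℝ v x) = c • innerSL ℝ (gradVec w x ξ) := by
    ext y
    rw [euclidean_eq_sum_single y]
    simp only [map_sum]
    refine Finset.sum_congr rfl fun k _ => ?_
    rw [map_smul, map_smul]
    congr 1
    simp only [ContinuousLinearMap.comp_apply, h.fderiv_single, map_smul, innerSL_apply_apply,
      smul_apply, EuclideanSpace.inner_single_right, gradVec]
    simp [real_inner_comm]
  rw [← h2]
  simpa only [real_inner_comm] using h1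

theorem enorm_fderiv_inner (h : IsIsotropicFrame v w c) (x : EuclideanSpace ℝ (Fin d)) (ξ : E) :
    ‖fderiv ℝ (fun y => ⟪v y, ξ⟫) x‖ₑ = ENNReal.ofReal c * ‖gradVec w x ξ‖ₑ := by
  rw [(h.hasFDerivAt_inner x ξ).fderiv, enorm_smul, Real.enorm_eq_ofReal h.pos.le,
    ← ofReal_norm (innerSL ℝ _), innerSL_apply_norm, ofReal_norm]

theorem contDiff_inner (h : IsIsotropicFrame v w c) (ξ : E) :
    ContDiff ℝ 1 fun x => ⟪v x, ξ⟫ := h.contDiff.inner ℝ contDiff_const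

end Basic

section SingularZeros

variable {d : ℕ} {E : Type*} [NormedAddCommGroup E] [InnerProductSpace ℝ E]
  [FiniteDimensional ℝ E] [MeasurableSpace E] [BorelSpace E]
  {v : EuclideanSpace ℝ (Fin d) → E} {w : Fin d → EuclideanSpace ℝ (Fin d) → E} {c : ℝ}

/-- The field and its normalised gradient at `x` are d + 1 independent standard Gaussians. Having
one factor more than the dimension of the cube is what rules out singular zeros. -/
theorem measure_abs_inner_le (h : IsIsotropicFrame v w c) (x : EuclideanSpace ℝ (Fin d))
    (ε : ℝ) :
    stdGaussian E {ξ | |⟪v x, ξ⟫| ≤ ε ∧ ∀ k, |⟪w k x, ξ⟫| ≤ ε} ≤ ENNReal.ofReal ε ^ (d + 1) := by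
  have hlaw := hasLaw_inner_orthonormal (h.orthonormal x)
  have hset : {ξ | |⟪v x, ξ⟫| ≤ ε ∧ ∀ k, |⟪w k x, ξ⟫| ≤ ε} =
      (fun (ξ : E) (i : Fin (d + 1)) => ⟪(Fin.cons (v x) fun k => w k x : Fin (d + 1) → E) i, ξ⟫) ⁻¹'
        Set.univ.pi fun _ => Set.Icc (-ε) ε := by
    ext ξ
    simp only [Set.mem_ofPred_eq, abs_le, Set.mem_preimage, Set.mem_pi, Set.mem_univ, true_imp_iff,
      Set.mem_Icc, Fin.forall_fin_succ, Fin.cons_zero, Fin.cons_succ]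
  rw [hset, ← Measure.map_apply_of_aemeasurable hlaw.aemeasurable
    (MeasurableSet.univ_pi fun _ => measurableSet_Icc), hlaw.map_eq, Measure.pi_pi]
  calc _ ≤ ∏ _i : Fin (d + 1), ENNReal.ofReal ε :=
        Finset.prod_le_prod' fun i _ => gaussianReal_Icc_le ε
    _ = _ := by simp

theorem exists_grid_point {N : ℕ} (hN : 0 < N) {x : EuclideanSpace ℝ (Fin d)}
    (hx : x ∈ unitCube d) : ∃ g : Fin d → Fin N,
      ‖x - WithLp.toLp 2 fun i => ((g i : ℕ) : ℝ) / N‖ ≤ d / N := by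
  have hN' : (0 : ℝ) < N := by exact_mod_cast hN
  have hlt : ∀ i, ⌊x i * N⌋₊ < N := fun i => by
    rw [Nat.floor_lt (mul_nonneg (hx i).1 hN'.le)]
    nlinarith [(hx i).2]
  refine ⟨fun i => ⟨⌊x i * N⌋₊, hlt i⟩, (euclidean_norm_le_sum _).trans ?_⟩
  calc _ ≤ ∑ _i : Fin d, 1 / (N : ℝ) := by
        refine Finset.sum_le_sum fun i _ => ?_
        simp only [PiLp.sub_apply]
        have h1 := Nat.floor_le (mul_nonneg (hx i).1 hN'.le)
        have h2 := Nat.lt_floor_add_one (x i * N)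
        rw [abs_le]
        constructor
        · have : (⌊x i * N⌋₊ : ℝ) / N ≤ x i := by rwa [div_le_iff₀ hN']
          have := div_pos one_pos hN'
          linarith
        · rw [sub_le_iff_le_add, ← add_div, le_div_iff₀ hN']
          linarith
    _ = d / N := by simp [div_eq_mul_inv]

/-- Almost surely, the random field `⟪v, ξ⟫` has no singular zero in the unit cube. -/
theorem measure_singularZeros_eq_zero (h : IsIsotropicFrame v w c) :
    stdGaussian E {ξ | ∃ x ∈ unitCube d, ⟪v x, ξ⟫ = 0 ∧ ∀ k, ⟪w k x, ξ⟫ = 0} = 0 := by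
  obtain ⟨L, hLv, hLw⟩ := h.lipschitz
  set Bad := {ξ : E | ∃ x ∈ unitCube d, ⟪v x, ξ⟫ = 0 ∧ ∀ k, ⟪w k x, ξ⟫ = 0} with hBad
  -- On a ball of radius R the random fields share the Lipschitz constant R·L, so a singular zero
  -- forces small values at a nearby grid point.
  have hR : ∀ R : ℕ, stdGaussian E (Bad ∩ Metric.closedBall 0 R) = 0 := by
    intro R
    set C : ℝ := R * L * d with hC
    have hC0 : 0 ≤ C := by positivity
    have hbound : ∀ N : ℕ, stdGaussian E (Bad ∩ Metric.closedBall 0 R) ≤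
        ENNReal.ofReal (C ^ (d + 1) / (N + 1 : ℕ)) := by
      intro N
      have hN : (0 : ℝ) < (N + 1 : ℕ) := by positivity
      set ε : ℝ := C / (N + 1 : ℕ) with hε
      have hε0 : 0 ≤ ε := by positivity
      set pt : (Fin d → Fin (N + 1)) → EuclideanSpace ℝ (Fin d) := fun g =>
        WithLp.toLp 2 fun i => ((g i : ℕ) : ℝ) / (N + 1 : ℕ) with hpt
      have hsub : Bad ∩ Metric.closedBall 0 R ⊆
          ⋃ g, {ξ | |⟪v (pt g), ξ⟫| ≤ ε ∧ ∀ k, |⟪w k (pt g), ξ⟫| ≤ ε} := by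
        rintro ξ ⟨⟨x, hx, hv0, hw0⟩, hξR⟩
        obtain ⟨g, hg⟩ := exists_grid_point (N := N + 1) (Nat.succ_pos N) hx
        have hξ : ‖ξ‖ ≤ R := by simpa using hξR
        have key : ∀ b : EuclideanSpace ℝ (Fin d) → E, LipschitzWith L b → ⟪b x, ξ⟫ = 0 →
            |⟪b (pt g), ξ⟫| ≤ ε := by
          intro b hb hb0
          have h1 : ⟪b (pt g), ξ⟫ = -⟪b x - b (pt g), ξ⟫ := by rw [inner_sub_left, hb0]; ring
          rw [h1, abs_neg]
          have h2 : ‖b x - b (pt g)‖ ≤ L * (d / (N + 1 : ℕ)) := by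
            refine (hb.norm_sub_le _ _).trans ?_
            gcongr
          calc _ ≤ ‖b x - b (pt g)‖ * ‖ξ‖ := abs_real_inner_le_norm _ _
            _ ≤ (L * (d / (N + 1 : ℕ))) * R := by gcongr
            _ = ε := by rw [hε, hC]; ring
        exact Set.mem_iUnion.2 ⟨g, key v hLv hv0, fun k => key (w k) (hLw k) (hw0 k)⟩
      calc _ ≤ stdGaussian E (⋃ g, {ξ | |⟪v (pt g), ξ⟫| ≤ ε ∧ ∀ k, |⟪w k (pt g), ξ⟫| ≤ ε}) :=
            measure_mono hsub
        _ ≤ ∑ g, stdGaussian E {ξ | |⟪v (pt g), ξ⟫| ≤ ε ∧ ∀ k, |⟪w k (pt g), ξ⟫| ≤ ε} :=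
            measure_iUnion_fintype_le _ _
        _ ≤ ∑ _g : Fin d → Fin (N + 1), ENNReal.ofReal ε ^ (d + 1) :=
            Finset.sum_le_sum fun g _ => h.measure_abs_inner_le _ ε
        -- There are (N+1)^d grid points, each of probability at most (C/(N+1))^(d+1).
        _ = ENNReal.ofReal (C ^ (d + 1) / (N + 1 : ℕ)) := by
            rw [Finset.sum_const, Finset.card_univ, Fintype.card_fun, Fintype.card_fin,
              Fintype.card_fin, nsmul_eq_mul, ← ENNReal.ofReal_pow hε0,
              ← ENNReal.ofReal_natCast, ← ENNReal.ofReal_mul (by positivity)]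
            congr 1
            rw [hε]
            rw [div_pow, eq_div_iff hN.ne']
            push_cast
            field_simp
            ring
    have hlim : Tendsto (fun N : ℕ => ENNReal.ofReal (C ^ (d + 1) / (N + 1 : ℕ))) atTop (𝓝 0) := by
      rw [← ENNReal.ofReal_zero]
      refine (ENNReal.continuous_ofReal.tendsto 0).comp ?_
      exact (tendsto_const_div_atTop_nhds_zero_nat (C ^ (d + 1))).comp (tendsto_add_atTop_nat 1)
    exact le_antisymm (ge_of_tendsto' hlim hbound) zero_le
  have hun : Bad = ⋃ R : ℕ, Bad ∩ Metric.closedBall 0 R := by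
    rw [← Set.inter_iUnion, Metric.iUnion_closedBall_nat, Set.inter_univ]
  rw [hun]
  exact measure_iUnion_null hR

end SingularZeros

end IsIsotropicFrame

end ArithmeticWave

/-! ### The weighted Kac–Rice formula -/

namespace ArithmeticWave

local notation "⟪" x ", " y "⟫" => inner ℝ x y

theorem isSigmaCompact_unitCube (d : ℕ) : IsSigmaCompact (unitCube d) := by
  have hset : unitCube d = {x : EuclideanSpace ℝ (Fin d) | ∀ i, x i ∈ Set.Icc (0 : ℝ) 1} ∩
      ⋂ i, {x : EuclideanSpace ℝ (Fin d) | x i < 1} := by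
    ext x
    simp only [unitCube, Set.mem_ofPred_eq, Set.mem_Ico, Set.mem_Icc, Set.mem_inter_iff,
      Set.mem_iInter]
    exact ⟨fun h => ⟨fun i => ⟨(h i).1, (h i).2.le⟩, fun i => (h i).2⟩,
      fun h i => ⟨(h.1 i).1, h.2 i⟩⟩
  rw [hset]
  refine IsSigmaCompact.inter_isOpen (IsCompact.isSigmaCompact ?_)
    (isOpen_iInter_of_finite fun i => isOpen_lt (by fun_prop) continuous_const)
  have hK : IsCompact (Set.univ.pi fun _ : Fin d => Set.Icc (0 : ℝ) 1) :=
    isCompact_univ_pi fun _ => isCompact_Icc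
  have := (EuclideanSpace.equiv (Fin d) ℝ).toHomeomorph.isCompact_preimage.2 hK
  refine this.of_isClosed_subset ?_ (fun x hx i _ => hx i)
  simp only [Set.ofPred_forall]
  exact isClosed_iInter fun i => isClosed_Icc.preimage (by fun_prop)

namespace IsIsotropicFrame

section KacRice

variable {d : ℕ} {E : Type*} [NormedAddCommGroup E] [InnerProductSpace ℝ E]
  [FiniteDimensional ℝ E] [MeasurableSpace E] [BorelSpace E]
  {v : EuclideanSpace ℝ (Fin d) → E} {w : Fin d → EuclideanSpace ℝ (Fin d) → E} {c : ℝ}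

omit [FiniteDimensional ℝ E] in
theorem measurable_zeroMeasure (h : IsIsotropicFrame v w c) (m : ℕ)
    {S : Set (EuclideanSpace ℝ (Fin d))} (hS : IsSigmaCompact S) :
    Measurable fun ξ : E => μHE[m] {x | x ∈ S ∧ ⟪v x, ξ⟫ = 0} := by
  have := h.continuous_v
  exact measurable_euclideanHausdorffMeasure_fiber (T := E) m hS (F := fun p => ⟪v p.2, p.1⟫)
    (by fun_prop)

/-- The level function: on `{⟪e, v⟫ ≠ 0}`, the field `⟪v, ζ + s • e⟫` vanishes where `level ζ`
takes the value `s`. -/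
noncomputable def level (v : EuclideanSpace ℝ (Fin d) → E) (e ζ : E)
    (x : EuclideanSpace ℝ (Fin d)) : ℝ :=
  -(⟪v x, ζ⟫ / ⟪e, v x⟫)

omit [FiniteDimensional ℝ E] [MeasurableSpace E] [BorelSpace E] in
theorem inner_add_level {e ζ : E} {x y : EuclideanSpace ℝ (Fin d)} (hy : ⟪e, v y⟫ ≠ 0) :
    ⟪v y, ζ + level v e ζ x • e⟫ = ⟪e, v y⟫ * (level v e ζ x - level v e ζ y) := by
  have h1 : ⟪v y, e⟫ = ⟪e, v y⟫ := real_inner_comm _ _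
  rw [inner_add_right, inner_smul_right, h1]
  nth_rw 3 [level]
  field_simp
  ring

omit [FiniteDimensional ℝ E] [MeasurableSpace E] [BorelSpace E] in
theorem contDiffAt_level (h : IsIsotropicFrame v w c) {e ζ : E} {x : EuclideanSpace ℝ (Fin d)}
    (hx : ⟪e, v x⟫ ≠ 0) : ContDiffAt ℝ 1 (level v e ζ) x :=
  ((h.contDiff.inner ℝ contDiff_const).contDiffAt.div
    (contDiff_const.inner ℝ h.contDiff).contDiffAt hx).neg

omit [FiniteDimensional ℝ E] [MeasurableSpace E] [BorelSpace E] in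
-- Near `x` the field factors as ⟪e, v y⟫ times a difference of levels. The second factor vanishes
-- at `x`, so only one term of the product rule survives.
theorem fderiv_level (h : IsIsotropicFrame v w c) {e ζ : E} {x : EuclideanSpace ℝ (Fin d)}
    (hx : ⟪e, v x⟫ ≠ 0) :
    fderiv ℝ (fun y => ⟪v y, ζ + level v e ζ x • e⟫) x = -(⟪e, v x⟫ • fderiv ℝ (level v e ζ) x) := by
  have hev : (fun y => ⟪v y, ζ + level v e ζ x • e⟫) =ᶠ[𝓝 x]
      fun y => ⟪e, v y⟫ * (level v e ζ x - level v e ζ y) := by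
    have : ∀ᶠ y in 𝓝 x, ⟪e, v y⟫ ≠ 0 :=
      (continuous_const.inner h.continuous_v).continuousAt.eventually_ne hx
    filter_upwards [this] with y hy using inner_add_level hy
  rw [hev.fderiv_eq]
  have h1 : HasFDerivAt (fun y => ⟪e, v y⟫) (fderiv ℝ (fun y => ⟪e, v y⟫) x) x :=
    ((contDiff_const.inner ℝ h.contDiff).differentiable one_ne_zero x).hasFDerivAt
  have h2 : HasFDerivAt (fun y => level v e ζ x - level v e ζ y) (-fderiv ℝ (level v e ζ) x) x :=
    ((h.contDiffAt_level hx).differentiableAt one_ne_zero).hasFDerivAt.const_sub _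
  rw [(h1.fun_mul h2).fderiv]
  simp

omit [FiniteDimensional ℝ E] [MeasurableSpace E] [BorelSpace E] in
theorem enorm_fderiv_level (h : IsIsotropicFrame v w c) {e ζ : E} {x : EuclideanSpace ℝ (Fin d)}
    (hx : ⟪e, v x⟫ ≠ 0) : ‖fderiv ℝ (level v e ζ) x‖ₑ =
      ENNReal.ofReal c * ‖gradVec w x (ζ + level v e ζ x • e)‖ₑ * ‖⟪e, v x⟫‖ₑ⁻¹ := by
  rw [← h.enorm_fderiv_inner, h.fderiv_level hx, enorm_neg, enorm_smul, mul_comm, ← mul_assoc,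
    ENNReal.inv_mul_cancel (by simpa using hx) (by simp), one_mul]

/-- Resampling along `e` preserves the Gaussian measure, so a null set is null on almost every line
parallel to `e`. The measurable hull is used because `B` need not be measurable. -/
theorem ae_ae_notMem_of_measure_eq_zero {e : E} (he : ‖e‖ = 1) {B : Set E}
    (hB : stdGaussian E B = 0) :
    ∀ᵐ ξ ∂stdGaussian E, ∀ᵐ s ∂gaussianReal 0 1, ξ - ⟪e, ξ⟫ • e + s • e ∉ B := by
  have hm := measurableSet_toMeasurable (stdGaussian E) B
  have hF : Measurable ((toMeasurable (stdGaussian E) B).indicator fun _ => (1 : ℝ≥0∞)) :=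
    measurable_const.indicator hm
  have h := lintegral_resample he hF
  rw [lintegral_indicator_const hm, measure_toMeasurable, hB, mul_zero] at h
  have h2 := (lintegral_eq_zero_iff (by fun_prop)).1 h.symm
  filter_upwards [h2] with ξ hξ
  have h3 := (lintegral_eq_zero_iff (by fun_prop)).1 hξ
  filter_upwards [h3] with s hs hsB
  have : (toMeasurable (stdGaussian E) B).indicator (fun _ => (1 : ℝ≥0∞))
      (ξ - ⟪e, ξ⟫ • e + s • e) = 1 := Set.indicator_of_mem (subset_toMeasurable _ _ hsB) _
  rw [this] at hs
  simp at hs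

/-- Write ξ = ζ + s·e with s resampled. The zeros in `S` form the level set {ℓ = s}, so integrating
over s is the coarea formula for ℓ. At fixed x the remaining integral over ξ sees the projection
along `e` onto the hyperplane orthogonal to v x, which `lintegral_oblique_projection` turns into the
orthogonal projection. -/
theorem kacRice_local (h : IsIsotropicFrame v w c) {S : Set (EuclideanSpace ℝ (Fin d))}
    (hS : IsSigmaCompact S) (hScube : S ⊆ unitCube d) {e : E} (he : ‖e‖ = 1)
    (heS : ∀ x ∈ S, ⟪e, v x⟫ ≠ 0) {G : E → ℝ≥0∞} (hG : Measurable G) :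
    ∫⁻ ξ, G ξ * μHE[d - 1] {x | x ∈ S ∧ ⟪v x, ξ⟫ = 0} ∂stdGaussian E =
      ∫⁻ x in S, ENNReal.ofReal (√(2 * Real.pi))⁻¹ * ∫⁻ ξ, G (ξ - ⟪v x, ξ⟫ • v x) *
        (ENNReal.ofReal c * ‖gradVec w x ξ‖ₑ) ∂stdGaussian E := by
  have hVm := h.measurable_zeroMeasure (d - 1) hS
  have hcv := h.continuous_v
  have hcg := h.continuous_gradVec
  have hpm := measurable_gaussianPDF 0 1
  have hSm : MeasurableSet S := IsSigmaCompact.measurableSet hS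
  set g : E → E := fun ξ => ξ - ⟪e, ξ⟫ • e with hg
  have hgm : Measurable g := by fun_prop
  have hinner : ∀ᵐ ξ ∂stdGaussian E,
      ∫⁻ s, G (g ξ + s • e) * μHE[d - 1] {x | x ∈ S ∧ ⟪v x, g ξ + s • e⟫ = 0} ∂gaussianReal 0 1 =
      ∫⁻ x in S, gaussianPDF 0 1 (⟪e, ξ⟫ - ⟪v x, ξ⟫ / ⟪e, v x⟫) *
        (G (ξ - (⟪v x, ξ⟫ / ⟪e, v x⟫) • e) * (ENNReal.ofReal c *
          ‖gradVec w x (ξ - (⟪v x, ξ⟫ / ⟪e, v x⟫) • e)‖ₑ)) * ‖⟪e, v x⟫‖ₑ⁻¹ := by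
    filter_upwards [ae_ae_notMem_of_measure_eq_zero he h.measure_singularZeros_eq_zero] with ξ hξ
    set ζ := g ξ with hζ
    set ℓ := level v e ζ with hℓ
    have hℓm : Measurable ℓ := by
      have h1 : Measurable fun x => ⟪v x, ζ⟫ := (by fun_prop : Continuous _).measurable
      have h2 : Measurable fun x => ⟪e, v x⟫ := (by fun_prop : Continuous _).measurable
      exact (h1.div h2).neg
    set O : Set (EuclideanSpace ℝ (Fin d)) := {x | ⟪e, v x⟫ ≠ 0 ∧ fderiv ℝ ℓ x ≠ 0} with hO
    have hOo : IsOpen O := by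
      rw [isOpen_iff_mem_nhds]
      rintro x ⟨hx1, hx2⟩
      have h1 : ∀ᶠ y in 𝓝 x, ⟪e, v y⟫ ≠ 0 :=
        (continuous_const.inner h.continuous_v).continuousAt.eventually_ne hx1
      have h2 : ∀ᶠ y in 𝓝 x, fderiv ℝ ℓ y ≠ 0 :=
        ((h.contDiffAt_level hx1).fderiv_right (m := 0) (by simp)).continuousAt.eventually_ne hx2
      exact h1.and h2
    have hSO : IsSigmaCompact (S ∩ O) := IsSigmaCompact.inter_isOpen hS hOo
    have hzero : ∀ s, ∀ x ∈ S, ⟪v x, ζ + s • e⟫ = 0 ↔ ℓ x = s := by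
      intro s x hx
      have h1 : ⟪v x, e⟫ = ⟪e, v x⟫ := real_inner_comm _ _
      have h2 := heS x hx
      rw [inner_add_right, inner_smul_right, h1, hℓ, level]
      constructor
      · intro h3
        field_simp
        linarith
      · rintro rfl
        field_simp
        ring
    -- A critical point of ℓ on the level s would be a singular zero of the field, which is excluded
    -- for almost every s.
    have hae : ∀ᵐ s ∂gaussianReal 0 1, G (ζ + s • e) * μHE[d - 1] {x | x ∈ S ∧ ⟪v x, ζ + s • e⟫ = 0}
        = G (ζ + s • e) * μHE[d - 1] ((S ∩ O) ∩ ℓ ⁻¹' {s}) := by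
      filter_upwards [hξ] with s hs
      congr 2
      ext x
      constructor
      · rintro ⟨hx, hx0⟩
        have hℓx := (hzero s x hx).1 hx0
        refine ⟨⟨hx, heS x hx, fun hd0 => hs ?_⟩, hℓx⟩
        refine ⟨x, hScube hx, hx0, fun k => ?_⟩
        have h1 := h.enorm_fderiv_level (ζ := ζ) (heS x hx)
        have h0 : ‖fderiv ℝ ℓ x‖ₑ = 0 := by rw [hd0, ← ofReal_norm, norm_zero, ENNReal.ofReal_zero]
        rw [← hℓ, h0, hℓx] at h1
        have h2 : gradVec w x (ζ + s • e) = 0 := by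
          have h3 := h1.symm
          rw [mul_eq_zero, mul_eq_zero] at h3
          rcases h3 with (h3 | h3) | h3
          · exact absurd h3 (by simpa using h.pos)
          · simpa using h3
          · simp at h3
        have h4 := congrArg (fun z => z.ofLp k) h2
        simpa [gradVec] using h4
      · rintro ⟨⟨hx, -⟩, hs'⟩
        exact ⟨hx, (hzero s x hx).2 hs'⟩
    have hfib : Measurable fun s : ℝ => μHE[d - 1] ((S ∩ O) ∩ ℓ ⁻¹' {s}) := by
      have := measurable_euclideanHausdorffMeasure_fiber (T := ℝ) (d - 1) hSO
        (F := fun p => ℓ p.2 - p.1) (by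
          refine ContinuousOn.sub ?_ continuous_fst.continuousOn
          exact ContinuousOn.comp (g := ℓ) (t := S ∩ O) (fun x hx =>
            (h.contDiffAt_level hx.2.1).continuousAt.continuousWithinAt)
            continuous_snd.continuousOn fun p hp => hp.2)
      convert this using 3
      exact Set.ext fun x => and_congr_right fun _ => sub_eq_zero.symm
    rw [lintegral_congr_ae hae, lintegral_gaussianReal_eq _ (by fun_prop)]
    simp_rw [← mul_assoc]
    have hco := lintegral_coarea hSO hℓm (fun x hx => h.contDiffAt_level hx.2.1)
      (fun x hx => hx.2.2) (ψ := fun s => gaussianPDF 0 1 s * G (ζ + s • e)) (by fun_prop)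
    rw [finrank_euclideanSpace_fin] at hco
    rw [hco]
    -- Critical points of ℓ may be restored: the integrand vanishes there.
    have hrest : ∫⁻ x in S ∩ O, gaussianPDF 0 1 (ℓ x) * G (ζ + ℓ x • e) * ‖fderiv ℝ ℓ x‖ₑ =
        ∫⁻ x in S, gaussianPDF 0 1 (ℓ x) * G (ζ + ℓ x • e) * ‖fderiv ℝ ℓ x‖ₑ := by
      rw [← lintegral_indicator (hSm.inter hOo.measurableSet), ← lintegral_indicator hSm]
      refine lintegral_congr fun x => ?_
      by_cases hx : x ∈ S
      · by_cases hx2 : x ∈ O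
        · rw [Set.indicator_of_mem (show x ∈ S ∩ O from ⟨hx, hx2⟩), Set.indicator_of_mem hx]
        · rw [Set.indicator_of_notMem (fun hh : x ∈ S ∩ O => hx2 hh.2), Set.indicator_of_mem hx]
          have : fderiv ℝ ℓ x = 0 := by
            by_contra hne
            exact hx2 ⟨heS x hx, hne⟩
          rw [this, ← ofReal_norm (0 : _ →L[ℝ] ℝ), norm_zero, ENNReal.ofReal_zero, mul_zero]
      · rw [Set.indicator_of_notMem hx, Set.indicator_of_notMem (fun hh : x ∈ S ∩ O => hx hh.1)]
    rw [hrest]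
    refine setLIntegral_congr_fun hSm fun x hx => ?_
    have hex := heS x hx
    have hve : ⟪v x, e⟫ = ⟪e, v x⟫ := real_inner_comm _ _
    have hℓx : ℓ x = ⟪e, ξ⟫ - ⟪v x, ξ⟫ / ⟪e, v x⟫ := by
      rw [hℓ, level, hζ, hg]
      simp only [inner_sub_right, inner_smul_right, hve]
      field_simp
      ring
    have hvec : ζ + ℓ x • e = ξ - (⟪v x, ξ⟫ / ⟪e, v x⟫) • e := by
      rw [hℓx, hζ, hg]
      module
    rw [hℓ, h.enorm_fderiv_level hex, ← hℓ, hvec, hℓx]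
    ring
  rw [lintegral_resample he (by fun_prop), lintegral_congr_ae hinner]
  have hmeas : Measurable (Function.uncurry fun (ξ : E) (x : EuclideanSpace ℝ (Fin d)) =>
      gaussianPDF 0 1 (⟪e, ξ⟫ - ⟪v x, ξ⟫ / ⟪e, v x⟫) *
        (G (ξ - (⟪v x, ξ⟫ / ⟪e, v x⟫) • e) * (ENNReal.ofReal c *
          ‖gradVec w x (ξ - (⟪v x, ξ⟫ / ⟪e, v x⟫) • e)‖ₑ)) * ‖⟪e, v x⟫‖ₑ⁻¹) := by
    have h1 : Measurable fun p : E × EuclideanSpace ℝ (Fin d) => ⟪v p.2, p.1⟫ :=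
      (by fun_prop : Continuous _).measurable
    have h2 : Measurable fun p : E × EuclideanSpace ℝ (Fin d) => ⟪e, v p.2⟫ :=
      (by fun_prop : Continuous _).measurable
    have h3 : Measurable fun p : E × EuclideanSpace ℝ (Fin d) => ⟪v p.2, p.1⟫ / ⟪e, v p.2⟫ :=
      h1.div h2
    have h4 : Measurable fun p : E × EuclideanSpace ℝ (Fin d) =>
        p.1 - (⟪v p.2, p.1⟫ / ⟪e, v p.2⟫) • e := measurable_fst.sub (h3.smul_const e)
    have h5 : Measurable fun p : E × EuclideanSpace ℝ (Fin d) =>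
        gradVec w p.2 (p.1 - (⟪v p.2, p.1⟫ / ⟪e, v p.2⟫) • e) :=
      hcg.measurable.comp (measurable_snd.prodMk h4)
    have h6 : Measurable fun p : E × EuclideanSpace ℝ (Fin d) => ⟪e, p.1⟫ := by fun_prop
    exact ((hpm.comp (h6.sub h3)).mul ((hG.comp h4).mul (h5.enorm.const_mul _))).mul h2.enorm.inv
  rw [lintegral_lintegral_swap hmeas.aemeasurable]
  refine setLIntegral_congr_fun hSm fun x hx => ?_
  have hgx : Measurable fun ζ : E => G ζ * (ENNReal.ofReal c * ‖gradVec w x ζ‖ₑ) := by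
    have : Measurable fun ζ : E => gradVec w x ζ :=
      hcg.measurable.comp (measurable_const.prodMk measurable_id)
    exact hG.mul (this.enorm.const_mul _)
  rw [lintegral_oblique_projection he (h.norm_v x) (heS x hx) hgx]
  simp_rw [h.gradVec_sub_smul_v]

/-- The Kac–Rice formula, with an arbitrary weight, for the zero set of `⟪v, ξ⟫`. -/
theorem kacRice (h : IsIsotropicFrame v w c) {G : E → ℝ≥0∞} (hG : Measurable G) :
    ∫⁻ ξ, G ξ * μHE[d - 1] {x | x ∈ unitCube d ∧ ⟪v x, ξ⟫ = 0} ∂stdGaussian E =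
      ∫⁻ x in unitCube d, ENNReal.ofReal (√(2 * Real.pi))⁻¹ *
        ∫⁻ ξ, G (ξ - ⟪v x, ξ⟫ • v x) * (ENNReal.ofReal c * ‖gradVec w x ξ‖ₑ) ∂stdGaussian E := by
  have hcv := h.continuous_v
  -- Around y the direction e = v y is admissible, because ⟪v y, v x⟫ equals 1 at x = y.
  set U : EuclideanSpace ℝ (Fin d) → Set (EuclideanSpace ℝ (Fin d)) :=
    fun y => {x | ⟪v y, v x⟫ ≠ 0} with hUdef
  have hUo : ∀ y, IsOpen (U y) := fun y => isOpen_ne_fun (by fun_prop) continuous_const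
  have hUy : ∀ y, U y ∈ 𝓝 y := fun y => (hUo y).mem_nhds (by
    show ⟪v y, v y⟫ ≠ 0
    rw [h.inner_v_v y]; exact one_ne_zero)
  obtain ⟨t, htc, htU⟩ := TopologicalSpace.countable_cover_nhds hUy
  have htne : t.Nonempty := by
    by_contra hne
    rw [Set.not_nonempty_iff_eq_empty.1 hne] at htU
    simp at htU
    exact Set.empty_ne_univ htU
  obtain ⟨y, rfl⟩ := htc.exists_eq_range htne
  set A : ℕ → Set (EuclideanSpace ℝ (Fin d)) := fun i =>
    unitCube d ∩ disjointed (fun i => U (y i)) i with hAdef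
  have hAs : ∀ i, IsSigmaCompact (A i) := fun i =>
    IsSigmaCompact.inter_disjointed (isSigmaCompact_unitCube d) (fun i => hUo _) i
  have hAd : Pairwise (Function.onFun Disjoint A) := fun i j hij =>
    (disjoint_disjointed (fun i => U (y i)) hij).mono Set.inter_subset_right Set.inter_subset_right
  have hAS : unitCube d = ⋃ i, A i := by
    rw [← Set.inter_iUnion, iUnion_disjointed, Set.left_eq_inter]
    simp only [Set.biUnion_range] at htU
    rw [htU]; exact Set.subset_univ _
  have hAm : ∀ i, MeasurableSet (A i) := fun i => IsSigmaCompact.measurableSet (hAs i)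
  have hL : ∀ ξ : E, μHE[d - 1] {x | x ∈ unitCube d ∧ ⟪v x, ξ⟫ = 0} =
      ∑' i, μHE[d - 1] {x | x ∈ A i ∧ ⟪v x, ξ⟫ = 0} := by
    intro ξ
    have h1 : {x | x ∈ unitCube d ∧ ⟪v x, ξ⟫ = 0} = ⋃ i, {x | x ∈ A i ∧ ⟪v x, ξ⟫ = 0} := by
      rw [hAS]
      ext x
      simp only [Set.mem_ofPred_eq, Set.mem_iUnion, exists_and_right]
    rw [h1]
    refine measure_iUnion (fun i j hij => (hAd hij).mono (fun x hx => hx.1) (fun x hx => hx.1))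
      fun i => (hAm i).inter ?_
    exact (isClosed_eq (by fun_prop) continuous_const : IsClosed {x | ⟪v x, ξ⟫ = 0}).measurableSet
  simp_rw [hL, ← ENNReal.tsum_mul_left]
  have hGV : ∀ i, Measurable fun ξ => G ξ * μHE[d - 1] {x | x ∈ A i ∧ ⟪v x, ξ⟫ = 0} :=
    fun i => hG.mul (h.measurable_zeroMeasure (d - 1) (hAs i))
  rw [lintegral_tsum fun i => (hGV i).aemeasurable]
  conv_rhs => rw [hAS]
  rw [lintegral_iUnion hAm hAd]
  congr 1
  ext i
  exact h.kacRice_local (hAs i) Set.inter_subset_left (h.norm_v (y i))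
    (fun x hx => disjointed_subset (fun i => U (y i)) i hx.2) hG

end KacRice

end IsIsotropicFrame

end ArithmeticWave

namespace ArithmeticWave

/-! ### Hermite polynomials: generating series and the multinomial formula -/

section HermiteAlgebra

theorem derivative_hermite_succ (q : ℕ) :
    Polynomial.derivative (Polynomial.hermite (q + 1)) = (q + 1 : ℤ) • Polynomial.hermite q := by
  induction q with
  | zero => simp
  | succ q ih =>
    rw [Polynomial.hermite_succ (q + 1), Polynomial.derivative_sub, Polynomial.derivative_mul, ih,
      Polynomial.derivative_smul, Polynomial.derivative_X, Polynomial.hermite_succ q]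
    simp only [zsmul_eq_mul]
    push_cast
    ring

theorem hermiteFun_zero (y : ℝ) : hermiteFun 0 y = 1 := by simp [hermiteFun]

theorem hermiteFun_one (y : ℝ) : hermiteFun 1 y = y := by simp [hermiteFun]

theorem hermiteFun_succ (q : ℕ) (y : ℝ) :
    hermiteFun (q + 1) y = y * hermiteFun q y - q * hermiteFun (q - 1) y := by
  rcases q with _ | q
  · simp [hermiteFun]
  · rw [hermiteFun, Polynomial.hermite_succ (q + 1), derivative_hermite_succ]
    simp [hermiteFun]

theorem hermiteFun_add_two (q : ℕ) (y : ℝ) :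
    hermiteFun (q + 2) y = y * hermiteFun (q + 1) y - (q + 1) * hermiteFun q y := by
  simpa using hermiteFun_succ (q + 1) y

theorem continuous_hermiteFun (q : ℕ) : Continuous (hermiteFun q) :=
  Polynomial.continuous_aeval _

theorem hasDerivAt_hermiteFun (q : ℕ) (y : ℝ) :
    HasDerivAt (hermiteFun q) (q * hermiteFun (q - 1) y) y := by
  have h := (Polynomial.hermite q).hasDerivAt_aeval y
  have h1 : Polynomial.aeval y (Polynomial.derivative (Polynomial.hermite q)) =
      q * hermiteFun (q - 1) y := by
    rcases q with _ | q
    · simp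
    · rw [derivative_hermite_succ]
      simp [hermiteFun]
  rw [h1] at h
  exact h

theorem hermiteFun_neg (q : ℕ) (y : ℝ) : hermiteFun q (-y) = (-1) ^ q * hermiteFun q y := by
  induction q using Nat.twoStepInduction with
  | zero => simp [hermiteFun_zero]
  | one => simp [hermiteFun_one]
  | more q h0 h1 =>
    rw [hermiteFun_add_two, hermiteFun_add_two, h0, h1]
    ring

/-- The Hermite polynomials of variance `s`, normalised to be monic. -/
noncomputable def scaledHermite (s y : ℝ) : ℕ → ℝ
  | 0 => 1
  | 1 => y
  | q + 2 => y * scaledHermite s y (q + 1) - (q + 1) * s * scaledHermite s y q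

theorem scaledHermite_one (q : ℕ) (y : ℝ) : scaledHermite 1 y q = hermiteFun q y := by
  induction q using Nat.twoStepInduction with
  | zero => simp [hermiteFun_zero, scaledHermite]
  | one => simp [hermiteFun_one, scaledHermite]
  | more q h0 h1 => rw [hermiteFun_add_two, scaledHermite, h0, h1, mul_one]

theorem scaledHermite_sq (q : ℕ) (t y : ℝ) :
    scaledHermite (t ^ 2) (t * y) q = t ^ q * hermiteFun q y := by
  induction q using Nat.twoStepInduction with
  | zero => simp [hermiteFun_zero, scaledHermite]
  | one => simp [hermiteFun_one, scaledHermite]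
  | more q h0 h1 =>
    rw [hermiteFun_add_two, scaledHermite, h0, h1]
    ring

/-- The generating series `exp(yX - sX²/2)`. -/
noncomputable def hermiteSeries (s y : ℝ) : PowerSeries ℝ :=
  PowerSeries.mk fun q => scaledHermite s y q / q.factorial

/-- The three-term recurrence is the differential equation F' = (y - sX)F. Since the factors y - sX
add up under products of series, uniqueness of solutions yields the addition formula
`hermiteSeries_add`. -/
theorem derivative_hermiteSeries (s y : ℝ) :
    PowerSeries.derivative ℝ (hermiteSeries s y) =
      (PowerSeries.C y - PowerSeries.C s * PowerSeries.X) * hermiteSeries s y := by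
  ext q
  rw [PowerSeries.coeff_derivative, sub_mul, map_sub,
    PowerSeries.coeff_C_mul, mul_assoc, PowerSeries.coeff_C_mul]
  rcases q with _ | q
  · simp [hermiteSeries, scaledHermite]
  · rw [PowerSeries.coeff_succ_X_mul]
    simp only [hermiteSeries, PowerSeries.coeff_mk, scaledHermite, Nat.factorial_succ]
    have h1 : (q.factorial : ℝ) ≠ 0 := by positivity
    have h2 : ((q : ℝ) + 1) ≠ 0 := by positivity
    have h3 : ((q : ℝ) + 1 + 1) ≠ 0 := by positivity
    push_cast
    field_simp

theorem powerSeries_eq_of_derivative_eq_mul {F G A : PowerSeries ℝ}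
    (hF : PowerSeries.derivative ℝ F = A * F) (hG : PowerSeries.derivative ℝ G = A * G)
    (h0 : PowerSeries.coeff 0 F = PowerSeries.coeff 0 G) : F = G := by
  ext q
  induction q using Nat.strong_induction_on with
  | _ q ih =>
    rcases q with _ | q
    · exact h0
    · have h1 := congrArg (PowerSeries.coeff q) hF
      have h2 := congrArg (PowerSeries.coeff q) hG
      rw [PowerSeries.coeff_derivative, PowerSeries.coeff_mul]
        at h1 h2
      have h3 : PowerSeries.coeff (q + 1) F * ((q : ℝ) + 1) =
          PowerSeries.coeff (q + 1) G * ((q : ℝ) + 1) := by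
        rw [h1, h2]
        refine Finset.sum_congr rfl fun p hp => ?_
        rw [ih p.2 (by have := Finset.HasAntidiagonal.mem_antidiagonal.1 hp; omega)]
      exact mul_right_cancel₀ (by positivity) h3

theorem hermiteSeries_add (s₁ s₂ y₁ y₂ : ℝ) :
    hermiteSeries (s₁ + s₂) (y₁ + y₂) = hermiteSeries s₁ y₁ * hermiteSeries s₂ y₂ := by
  refine powerSeries_eq_of_derivative_eq_mul (derivative_hermiteSeries _ _) ?_ ?_
  · rw [Derivation.leibniz, derivative_hermiteSeries, derivative_hermiteSeries]
    simp only [smul_eq_mul, map_add]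
    ring
  · simp [hermiteSeries, scaledHermite, PowerSeries.coeff_mul]

theorem hermiteSeries_zero : hermiteSeries 0 0 = 1 := by
  refine powerSeries_eq_of_derivative_eq_mul (A := 0) ?_ ?_ ?_
  · rw [derivative_hermiteSeries]; simp
  · simp
  · simp [hermiteSeries, scaledHermite]

theorem hermiteSeries_sum {κ : Type*} (T : Finset κ) (s y : κ → ℝ) :
    hermiteSeries (∑ i ∈ T, s i) (∑ i ∈ T, y i) = ∏ i ∈ T, hermiteSeries (s i) (y i) := by
  classical
  induction T using Finset.induction_on with
  | empty => simp [hermiteSeries_zero]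
  | insert i T hi ih =>
    rw [Finset.sum_insert hi, Finset.sum_insert hi, Finset.prod_insert hi, hermiteSeries_add, ih]

/-- Compare coefficients of the product of generating series. The variances are formal parameters,
unrelated to any law of the arguments; this allows some arguments to be replaced by constants later.
-/
theorem scaledHermite_add (s₁ s₂ y₁ y₂ : ℝ) (q : ℕ) :
    scaledHermite (s₁ + s₂) (y₁ + y₂) q =
      ∑ p ∈ Finset.HasAntidiagonal.antidiagonal q, (q.choose p.1 : ℝ) *
        (scaledHermite s₁ y₁ p.1 * scaledHermite s₂ y₂ p.2) := by
  have h := congrArg (PowerSeries.coeff q) (hermiteSeries_add s₁ s₂ y₁ y₂)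
  rw [PowerSeries.coeff_mul] at h
  simp only [hermiteSeries, PowerSeries.coeff_mk] at h
  rw [div_eq_iff (by positivity), Finset.sum_mul] at h
  rw [h]
  refine Finset.sum_congr rfl fun p hp => ?_
  rw [← Finset.HasAntidiagonal.mem_antidiagonal.1 hp, Nat.cast_add_choose]
  field_simp

theorem scaledHermite_sum {κ : Type*} [Fintype κ] [DecidableEq κ] (t z : κ → ℝ) (q : ℕ) :
    scaledHermite (∑ i, t i ^ 2) (∑ i, t i * z i) q =
      ∑ m ∈ Finset.piAntidiag (Finset.univ : Finset κ) q, (Nat.multinomial Finset.univ m : ℝ) *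
        ((∏ i, t i ^ m i) * ∏ i, hermiteFun (m i) (z i)) := by
  have h := congrArg (PowerSeries.coeff q)
    (hermiteSeries_sum Finset.univ (fun i => t i ^ 2) fun i => t i * z i)
  rw [PowerSeries.coeff_prod] at h
  simp only [hermiteSeries, PowerSeries.coeff_mk, scaledHermite_sq] at h
  rw [div_eq_iff (by positivity), Finset.sum_mul] at h
  rw [h]
  refine Finset.sum_nbij' (fun m => ⇑m) (fun m => Finsupp.equivFunOnFinite.symm m) ?_ ?_ ?_ ?_ ?_
  · intro m hm
    rw [Finset.mem_finsuppAntidiag] at hm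
    simp [Finset.mem_piAntidiag, hm.1]
  · intro m hm
    rw [Finset.mem_piAntidiag] at hm
    simp [Finset.mem_finsuppAntidiag, hm.1]
  · intro m _; ext; simp
  · intro m _; simp
  · intro m hm
    rw [Finset.mem_finsuppAntidiag] at hm
    have hne : (∏ i, ((m i).factorial : ℝ)) ≠ 0 := Finset.prod_ne_zero_iff.2 fun i _ => by positivity
    have hmul : (∏ i, ((m i).factorial : ℝ)) * (Nat.multinomial Finset.univ m : ℝ) =
        (q.factorial : ℝ) := by
      have := Nat.multinomial_spec Finset.univ (m : κ → ℕ)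
      rw [hm.1] at this
      exact_mod_cast this
    rw [← hmul, Finset.prod_div_distrib, Finset.prod_mul_distrib]
    field_simp

theorem hermiteFun_sum {κ : Type*} [Fintype κ] [DecidableEq κ] {t : κ → ℝ}
    (ht : ∑ i, t i ^ 2 = 1) (z : κ → ℝ) (q : ℕ) :
    hermiteFun q (∑ i, t i * z i) =
      ∑ m ∈ Finset.piAntidiag (Finset.univ : Finset κ) q, (Nat.multinomial Finset.univ m : ℝ) *
        ((∏ i, t i ^ m i) * ∏ i, hermiteFun (m i) (z i)) := by
  rw [← scaledHermite_one, ← ht, scaledHermite_sum]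

end HermiteAlgebra

/-! ### Polynomial growth, as an integrability criterion -/

section PolyGrowth

/-- `|g| ≤ C (1 + N)^k` for some constants `C` and `k`. -/
def PolyGrowth {α : Type*} (N g : α → ℝ) : Prop :=
  ∃ (C : ℝ) (k : ℕ), ∀ a, |g a| ≤ C * (1 + |N a|) ^ k

variable {α : Type*} {N f g : α → ℝ}

theorem PolyGrowth.of_abs_le (h : ∀ a, |g a| ≤ |N a|) : PolyGrowth N g :=
  ⟨1, 1, fun a => by have := h a; linarith⟩

theorem PolyGrowth.const (c : ℝ) : PolyGrowth N fun _ => c := ⟨|c|, 0, fun a => by simp⟩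

theorem PolyGrowth.mul (hf : PolyGrowth N f) (hg : PolyGrowth N g) :
    PolyGrowth N fun a => f a * g a := by
  obtain ⟨C, k, h⟩ := hf
  obtain ⟨D, l, h'⟩ := hg
  refine ⟨C * D, k + l, fun a => ?_⟩
  rw [abs_mul, pow_add, mul_mul_mul_comm]
  exact mul_le_mul (h a) (h' a) (abs_nonneg _) ((abs_nonneg _).trans (h a))

theorem PolyGrowth.add (hf : PolyGrowth N f) (hg : PolyGrowth N g) :
    PolyGrowth N fun a => f a + g a := by
  obtain ⟨C, k, h⟩ := hf
  obtain ⟨D, l, h'⟩ := hg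
  refine ⟨|C| + |D|, k + l, fun a => (abs_add_le _ _).trans ?_⟩
  have h1 : 1 ≤ 1 + |N a| := by linarith [abs_nonneg (N a)]
  rw [add_mul]
  refine add_le_add ((h a).trans ?_) ((h' a).trans ?_)
  · exact mul_le_mul (le_abs_self _) (pow_le_pow_right₀ h1 (by omega)) (by positivity)
      (abs_nonneg _)
  · exact mul_le_mul (le_abs_self _) (pow_le_pow_right₀ h1 (by omega)) (by positivity)
      (abs_nonneg _)

theorem PolyGrowth.const_mul (c : ℝ) (hf : PolyGrowth N f) : PolyGrowth N fun a => c * f a :=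
  (PolyGrowth.const c).mul hf

theorem PolyGrowth.sum {κ : Type*} {T : Finset κ} {f : κ → α → ℝ}
    (h : ∀ i ∈ T, PolyGrowth N (f i)) : PolyGrowth N fun a => ∑ i ∈ T, f i a := by
  classical
  induction T using Finset.induction_on with
  | empty => simpa using PolyGrowth.const 0
  | insert i T hi ih =>
    simp only [Finset.sum_insert hi]
    exact (h i (Finset.mem_insert_self _ _)).add
      (ih fun j hj => h j (Finset.mem_insert_of_mem hj))

theorem PolyGrowth.prod {κ : Type*} {T : Finset κ} {f : κ → α → ℝ}
    (h : ∀ i ∈ T, PolyGrowth N (f i)) : PolyGrowth N fun a => ∏ i ∈ T, f i a := by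
  classical
  induction T using Finset.induction_on with
  | empty => simpa using PolyGrowth.const 1
  | insert i T hi ih =>
    simp only [Finset.prod_insert hi]
    exact (h i (Finset.mem_insert_self _ _)).mul
      (ih fun j hj => h j (Finset.mem_insert_of_mem hj))

theorem PolyGrowth.pow (hf : PolyGrowth N f) (q : ℕ) : PolyGrowth N fun a => f a ^ q := by
  induction q with
  | zero => simpa using PolyGrowth.const 1
  | succ q ih => simpa only [pow_succ] using ih.mul hf

theorem PolyGrowth.scaledHermite (s : ℝ) (hf : PolyGrowth N f) (q : ℕ) :
    PolyGrowth N fun a => scaledHermite s (f a) q := by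
  induction q using Nat.twoStepInduction with
  | zero => simpa [ArithmeticWave.scaledHermite] using PolyGrowth.const 1
  | one => simpa [ArithmeticWave.scaledHermite] using hf
  | more q h0 h1 =>
    simp only [ArithmeticWave.scaledHermite, sub_eq_add_neg, ← neg_mul]
    exact (hf.mul h1).add (h0.const_mul _)

theorem PolyGrowth.hermiteFun (hf : PolyGrowth N f) (q : ℕ) :
    PolyGrowth N fun a => hermiteFun q (f a) := by
  simpa only [scaledHermite_one] using hf.scaledHermite 1 q

end PolyGrowth

end ArithmeticWave

namespace ArithmeticWave

local notation "⟪" x ", " y "⟫" => inner ℝ x y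

/-! ### Gaussian moments, Stein's identity, orthogonality of Hermite polynomials -/

section Moments

variable {E : Type*} [NormedAddCommGroup E] [NormedSpace ℝ E] [CompleteSpace E]
  [SecondCountableTopology E] [MeasurableSpace E] [BorelSpace E]

theorem integrable_one_add_norm_pow (μ : Measure E) [IsGaussian μ] (k : ℕ) :
    Integrable (fun ξ => (1 + ‖ξ‖) ^ k) μ := by
  rcases Nat.eq_zero_or_pos k with rfl | hk
  · simp
  have h1 : MemLp (fun ξ : E => 1 + ‖ξ‖) k μ :=
    (memLp_const (1 : ℝ)).add (IsGaussian.memLp_id μ k (by simp)).norm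
  refine (h1.integrable_norm_pow hk.ne').congr (ae_of_all _ fun ξ => ?_)
  have : 0 ≤ 1 + ‖ξ‖ := by positivity
  simp [abs_of_nonneg this]

theorem PolyGrowth.integrable {μ : Measure E} [IsGaussian μ] {g : E → ℝ}
    (hg : PolyGrowth (fun ξ => ‖ξ‖) g) (hm : AEStronglyMeasurable g μ) : Integrable g μ := by
  obtain ⟨C, k, h⟩ := hg
  refine ((integrable_one_add_norm_pow μ k).const_mul C).mono' hm (ae_of_all _ fun ξ => ?_)
  simpa using h ξ

theorem PolyGrowth.memLp_two {μ : Measure E} [IsGaussian μ] {g : E → ℝ}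
    (hg : PolyGrowth (fun ξ => ‖ξ‖) g) (hm : AEStronglyMeasurable g μ) : MemLp g 2 μ :=
  (memLp_two_iff_integrable_sq hm).2 ((hg.pow 2).integrable (hm.pow 2))

end Moments

section Stein

theorem hasDerivAt_gaussianPDFReal (y : ℝ) :
    HasDerivAt (gaussianPDFReal 0 1) (-(y * gaussianPDFReal 0 1 y)) y := by
  have h1 : HasDerivAt (fun y : ℝ => -(y - 0) ^ 2 / (2 * ((1 : ℝ≥0) : ℝ))) (-y) y := by
    have := ((((hasDerivAt_id y).sub_const 0).pow 2).neg).div_const (2 * ((1 : ℝ≥0) : ℝ))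
    refine this.congr_deriv ?_
    simp
    ring
  have h2 := h1.exp.const_mul (√(2 * Real.pi * ((1 : ℝ≥0) : ℝ)))⁻¹
  rw [gaussianPDFReal_def]
  refine h2.congr_deriv ?_
  ring

theorem integrable_gaussianPDFReal_mul {g : ℝ → ℝ} (hg : Integrable g (gaussianReal 0 1)) :
    Integrable fun y => gaussianPDFReal 0 1 y * g y := by
  rw [gaussianReal_of_var_ne_zero 0 one_ne_zero, integrable_withDensity_iff_integrable_smul'
    (measurable_gaussianPDF 0 1) (ae_of_all _ fun y => gaussianPDF_lt_top)] at hg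
  refine hg.congr (ae_of_all _ fun y => ?_)
  simp [gaussianPDF, ENNReal.toReal_ofReal (gaussianPDFReal_nonneg 0 1 y)]

/-- Integration by parts: with φ the Gaussian density, φ(g' - y·g) is the derivative of the
integrable function φ·g. -/
theorem stein_gaussianReal {g g' : ℝ → ℝ} (hd : ∀ y, HasDerivAt g (g' y) y)
    (hg : PolyGrowth (fun y => ‖y‖) g) (hg' : PolyGrowth (fun y => ‖y‖) g')
    (hc' : Continuous g') :
    ∫ y, y * g y ∂gaussianReal 0 1 = ∫ y, g' y ∂gaussianReal 0 1 := by
  have hc : Continuous g := continuous_iff_continuousAt.2 fun y => (hd y).continuousAt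
  have hid : PolyGrowth (fun y : ℝ => ‖y‖) fun y => y := PolyGrowth.of_abs_le fun y => by simp
  have i1 : Integrable (fun y => y * g y) (gaussianReal 0 1) :=
    (hid.mul hg).integrable (by fun_prop)
  have i2 : Integrable g' (gaussianReal 0 1) := hg'.integrable (by fun_prop)
  have i0 : Integrable g (gaussianReal 0 1) := hg.integrable (by fun_prop)
  have key := integral_eq_zero_of_hasDerivAt_of_integrable
    (f := fun y => gaussianPDFReal 0 1 y * g y)
    (f' := fun y => gaussianPDFReal 0 1 y * (g' y - y * g y)) (fun y => by
      refine ((hasDerivAt_gaussianPDFReal y).mul (hd y)).congr_deriv ?_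
      ring) (integrable_gaussianPDFReal_mul (i2.sub i1)) (integrable_gaussianPDFReal_mul i0)
  have h3 : ∫ y, (g' y - y * g y) ∂gaussianReal 0 1 = 0 := by
    rw [integral_gaussianReal_eq_integral_smul one_ne_zero]
    simpa using key
  rw [integral_sub i2 i1] at h3
  linarith

/-- Stein's identity applied to H_p·H_q gives E[H_{p+1} H_q] = q·E[H_p H_{q-1}], and induction
lowers both indices together. -/
theorem integral_hermiteFun_mul_hermiteFun (p q : ℕ) :
    ∫ y, hermiteFun p y * hermiteFun q y ∂gaussianReal 0 1 =
      if p = q then (q.factorial : ℝ) else 0 := by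
  have hid : PolyGrowth (fun y : ℝ => ‖y‖) fun y => y := PolyGrowth.of_abs_le fun y => by simp
  have hH := fun q => continuous_hermiteFun q
  have step : ∀ p q : ℕ, ∫ y, hermiteFun (p + 1) y * hermiteFun q y ∂gaussianReal 0 1 =
      q * ∫ y, hermiteFun p y * hermiteFun (q - 1) y ∂gaussianReal 0 1 := by
    intro p q
    have hpq := (hid.hermiteFun p).mul (hid.hermiteFun q)
    have h1 : PolyGrowth (fun y : ℝ => ‖y‖) fun y =>
        p * hermiteFun (p - 1) y * hermiteFun q y :=
      ((hid.hermiteFun (p - 1)).const_mul p).mul (hid.hermiteFun q)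
    have h2 : PolyGrowth (fun y : ℝ => ‖y‖) fun y =>
        hermiteFun p y * (q * hermiteFun (q - 1) y) :=
      (hid.hermiteFun p).mul ((hid.hermiteFun (q - 1)).const_mul q)
    have hst := stein_gaussianReal
      (fun y => (hasDerivAt_hermiteFun p y).fun_mul (hasDerivAt_hermiteFun q y)) hpq (h1.add h2)
      (by fun_prop)
    have c1 : AEStronglyMeasurable (fun y => p * hermiteFun (p - 1) y * hermiteFun q y)
      (gaussianReal 0 1) := by fun_prop
    have c2 : AEStronglyMeasurable (fun y => hermiteFun p y * (q * hermiteFun (q - 1) y))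
      (gaussianReal 0 1) := by fun_prop
    have c3 : AEStronglyMeasurable (fun y => y * (hermiteFun p y * hermiteFun q y))
      (gaussianReal 0 1) := by fun_prop
    rw [integral_add (h1.integrable c1) (h2.integrable c2)] at hst
    have : ∀ y, hermiteFun (p + 1) y * hermiteFun q y =
        y * (hermiteFun p y * hermiteFun q y) - p * hermiteFun (p - 1) y * hermiteFun q y := by
      intro y; rw [hermiteFun_succ]; ring
    simp only [this]
    rw [integral_sub ((hid.mul hpq).integrable c3) (h1.integrable c1), hst, add_sub_cancel_left,
      ← integral_const_mul]
    congr 1; ext y; ring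
  induction p generalizing q with
  | zero =>
    rcases q with _ | q
    · simp [hermiteFun_zero]
    · have := step q 0
      simp only [Nat.cast_zero, zero_mul] at this
      simp only [mul_comm (hermiteFun 0 _)]
      rw [this, if_neg (by omega)]
  | succ p ih =>
    rw [step]
    rcases q with _ | q
    · simp
    · simp only [Nat.add_sub_cancel, ih, Nat.add_right_cancel_iff, Nat.factorial_succ]
      split_ifs <;> push_cast <;> ring

theorem integral_hermiteFun {q : ℕ} (hq : q ≠ 0) : ∫ y, hermiteFun q y ∂gaussianReal 0 1 = 0 := by
  simpa [hermiteFun_zero, hq] using integral_hermiteFun_mul_hermiteFun q 0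

end Stein

end ArithmeticWave

namespace ArithmeticWave

local notation "⟪" x ", " y "⟫" => inner ℝ x y

/-! ### Hermite polynomials of linear functionals of a Gaussian vector -/

section GaussianHermite

variable {E : Type*} [NormedAddCommGroup E] [InnerProductSpace ℝ E]

theorem polyGrowth_inner (u : E) : PolyGrowth (fun ξ : E => ‖ξ‖) fun ξ => ⟪u, ξ⟫ :=
  ⟨‖u‖, 1, fun ξ => by
    have := abs_real_inner_le_norm u ξ
    rw [abs_norm, pow_one]
    nlinarith [norm_nonneg u]⟩

theorem Orthonormal.norm_sub_sum_sq {κ : Type*} [Fintype κ] {b : κ → E} (hb : Orthonormal ℝ b)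
    (u : E) : ‖u - ∑ j, ⟪b j, u⟫ • b j‖ ^ 2 = ‖u‖ ^ 2 - ∑ j, ⟪b j, u⟫ ^ 2 := by
  rw [norm_sub_sq_real, inner_sum]
  have h1 : ‖∑ j, ⟪b j, u⟫ • b j‖ ^ 2 = ∑ j, ⟪b j, u⟫ ^ 2 := by
    rw [← real_inner_self_eq_norm_sq, hb.inner_sum]
    simp [sq]
  have h2 : ∑ j, ⟪u, ⟪b j, u⟫ • b j⟫ = ∑ j, ⟪b j, u⟫ ^ 2 := by
    refine Finset.sum_congr rfl fun j _ => ?_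
    rw [real_inner_smul_right, real_inner_comm, sq]
  rw [h1, h2]
  ring

theorem Orthonormal.inner_sub_sum_eq_zero {κ : Type*} [Fintype κ] {b : κ → E}
    (hb : Orthonormal ℝ b) (u : E) (i : κ) : ⟪b i, u - ∑ j, ⟪b j, u⟫ • b j⟫ = 0 := by
  rw [inner_sub_right, hb.inner_right_fintype, sub_self]

variable [FiniteDimensional ℝ E] [MeasurableSpace E] [BorelSpace E]

theorem integral_hermiteFun_inner {u : E} (hu : ‖u‖ = 1) {q : ℕ} (hq : q ≠ 0) :
    ∫ ξ, hermiteFun q ⟪u, ξ⟫ ∂stdGaussian E = 0 := by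
  rw [← integral_hermiteFun hq,
    ← (hasLaw_inner_unit hu).integral_comp (continuous_hermiteFun q).aestronglyMeasurable]
  rfl

theorem integral_scaledHermite_inner (p : E) {r : ℕ} (hr : r ≠ 0) :
    ∫ ξ, scaledHermite (‖p‖ ^ 2) ⟪p, ξ⟫ r ∂stdGaussian E = 0 := by
  by_cases hp : p = 0
  · subst hp
    have h0 := scaledHermite_sq r 0 0
    simp only [ne_eq, OfNat.ofNat_ne_zero, not_false_eq_true, zero_pow, mul_zero, hr,
      zero_mul] at h0
    simp [h0]
  · have h1 : ∀ ξ : E, ⟪p, ξ⟫ = ‖p‖ * ⟪‖p‖⁻¹ • p, ξ⟫ := by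
      intro ξ
      rw [real_inner_smul_left, mul_inv_cancel_left₀ (norm_ne_zero_iff.2 hp)]
    simp only [h1, scaledHermite_sq, integral_const_mul]
    rw [integral_hermiteFun_inner (by simp [norm_smul, hp]) hr, mul_zero]

theorem continuous_scaledHermite (s : ℝ) (q : ℕ) : Continuous fun y => scaledHermite s y q := by
  induction q using Nat.twoStepInduction with
  | zero => simp only [scaledHermite]; fun_prop
  | one => simp only [scaledHermite]; fun_prop
  | more q h0 h1 => simp only [scaledHermite]; fun_prop

/-- Integrating out the component of `u` orthogonal to an orthonormal family. -/
theorem integral_mul_hermiteFun_add {κ : Type*} [Fintype κ] [DecidableEq κ] {b : κ → E}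
    (hb : Orthonormal ℝ b) {u : E} (hu : ‖u‖ = 1) {Φ : (κ → ℝ) → ℝ} (hΦ : Continuous Φ)
    (hΦg : PolyGrowth (fun ξ : E => ‖ξ‖) fun ξ => Φ fun j => ⟪b j, ξ⟫)
    {y : (κ → ℝ) → κ → ℝ} (hy : Continuous y)
    (hyg : ∀ i, PolyGrowth (fun ξ : E => ‖ξ‖) fun ξ => y (fun j => ⟪b j, ξ⟫) i) (q : ℕ) :
    ∫ ξ, Φ (fun j => ⟪b j, ξ⟫) * hermiteFun q (∑ i, ⟪b i, u⟫ * y (fun j => ⟪b j, ξ⟫) i +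
        ⟪u - ∑ j, ⟪b j, u⟫ • b j, ξ⟫) ∂stdGaussian E =
      ∑ m ∈ Finset.piAntidiag (Finset.univ : Finset κ) q, (Nat.multinomial Finset.univ m : ℝ) *
        ((∏ i, ⟪b i, u⟫ ^ m i) *
          ∫ ξ, Φ (fun j => ⟪b j, ξ⟫) * ∏ i, hermiteFun (m i) (y (fun j => ⟪b j, ξ⟫) i)
            ∂stdGaussian E) := by
  set p := u - ∑ j, ⟪b j, u⟫ • b j with hp
  set S := ∑ j, ⟪b j, u⟫ ^ 2 with hS
  have hyi : ∀ i, Continuous fun z => y z i := fun i => (continuous_apply i).comp hy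
  have hH := fun q => continuous_hermiteFun q
  -- Pythagoras for u splits the unit variance between the span of `b` and the orthogonal remainder
  -- `p`.
  have hsum : S + ‖p‖ ^ 2 = 1 := by
    rw [hp, Orthonormal.norm_sub_sum_sq hb, hu]; ring
  let A : (κ → ℝ) → ℝ := fun z => ∑ i, ⟪b i, u⟫ * y z i
  have hA : Continuous A := by fun_prop
  have hAg : PolyGrowth (fun ξ : E => ‖ξ‖) fun ξ => A fun j => ⟪b j, ξ⟫ :=
    PolyGrowth.sum fun i _ => (hyg i).const_mul _
  let R : E →L[ℝ] (κ → ℝ) := ContinuousLinearMap.pi fun j => innerSL ℝ (b j)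
  have hR : R p = 0 := by
    ext i
    simpa [R] using Orthonormal.inner_sub_sum_eq_zero hb u i
  have hind := indepFun_inner_of_apply_eq_zero hR
  let G : ℕ → (κ → ℝ) → ℝ := fun i z => Φ z * scaledHermite S (A z) i
  have hG : ∀ i, Continuous (G i) := fun i => hΦ.mul ((continuous_scaledHermite S i).comp hA)
  have hGg : ∀ i, PolyGrowth (fun ξ : E => ‖ξ‖) fun ξ => G i (R ξ) := fun i =>
    hΦg.mul (hAg.scaledHermite S i)
  have hBg : ∀ r, PolyGrowth (fun ξ : E => ‖ξ‖) fun ξ => scaledHermite (‖p‖ ^ 2) ⟪p, ξ⟫ r :=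
    fun r => (polyGrowth_inner p).scaledHermite _ r
  have hBc : ∀ r, Continuous fun ξ : E => scaledHermite (‖p‖ ^ 2) ⟪p, ξ⟫ r := fun r =>
    (continuous_scaledHermite _ r).comp (by fun_prop)
  have hGc : ∀ i, Continuous fun ξ => G i (R ξ) := fun i => (hG i).comp R.continuous
  have hexp : ∀ ξ, Φ (fun j => ⟪b j, ξ⟫) * hermiteFun q (∑ i, ⟪b i, u⟫ * y (fun j => ⟪b j, ξ⟫) i +
      ⟪p, ξ⟫) = ∑ k ∈ Finset.HasAntidiagonal.antidiagonal q, (q.choose k.1 : ℝ) *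
        (G k.1 (R ξ) * scaledHermite (‖p‖ ^ 2) ⟪p, ξ⟫ k.2) := by
    intro ξ
    rw [← scaledHermite_one, ← hsum, scaledHermite_add, Finset.mul_sum]
    refine Finset.sum_congr rfl fun k _ => ?_
    simp only [G, A, R, ContinuousLinearMap.coe_pi', innerSL_apply_apply]
    ring
  -- The component along `p` is independent of R ξ, and its Hermite polynomials of positive degree
  -- are centred. Only the term with r = 0 of the binomial expansion survives.
  have hprod : ∀ i r, ∫ ξ, G i (R ξ) * scaledHermite (‖p‖ ^ 2) ⟪p, ξ⟫ r ∂stdGaussian E =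
      if r = 0 then ∫ ξ, G i (R ξ) ∂stdGaussian E else 0 := by
    intro i r
    split_ifs with hr
    · simp [hr, scaledHermite]
    · have h := (hind.symm.comp (hG i).measurable
        (continuous_scaledHermite (‖p‖ ^ 2) r).measurable).integral_fun_mul_eq_mul_integral
        (hGc i).aestronglyMeasurable (hBc r).aestronglyMeasurable
      simp only [Function.comp_apply] at h
      rw [h, integral_scaledHermite_inner p hr, mul_zero]
  simp only [hexp]
  rw [integral_finsetSum _ fun k _ => (((hGg k.1).mul (hBg k.2)).integrable
    ((hGc k.1).mul (hBc k.2)).aestronglyMeasurable).const_mul _]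
  simp only [integral_const_mul, hprod]
  rw [Finset.sum_eq_single (q, 0)]
  · simp only [Nat.choose_self, Nat.cast_one, one_mul, if_true]
    have hexp2 : ∀ ξ, G q (R ξ) = ∑ m ∈ Finset.piAntidiag (Finset.univ : Finset κ) q,
        (Nat.multinomial Finset.univ m : ℝ) * ((∏ i, ⟪b i, u⟫ ^ m i) *
          (Φ (fun j => ⟪b j, ξ⟫) * ∏ i, hermiteFun (m i) (y (fun j => ⟪b j, ξ⟫) i))) := by
      intro ξ
      simp only [G, A, hS, scaledHermite_sum, Finset.mul_sum]
      refine Finset.sum_congr rfl fun m _ => ?_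
      simp only [R, ContinuousLinearMap.coe_pi', innerSL_apply_apply]
      ring
    simp only [hexp2]
    rw [integral_finsetSum]
    · simp only [integral_const_mul]
    · intro m _
      refine (Integrable.const_mul ?_ _).const_mul _
      refine (hΦg.mul (PolyGrowth.prod fun i _ => (hyg i).hermiteFun (m i))).integrable ?_
      refine Continuous.aestronglyMeasurable ?_
      have hZ : Continuous fun ξ : E => fun j => ⟪b j, ξ⟫ := by fun_prop
      exact (hΦ.comp hZ).mul (continuous_finsetProd _ fun i _ =>
        (hH (m i)).comp ((hyi i).comp hZ))
  · intro k hk hk0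
    have : k.2 ≠ 0 := by
      rintro h0
      have := Finset.HasAntidiagonal.mem_antidiagonal.1 hk
      exact hk0 (Prod.ext (by omega) h0)
    simp [this]
  · intro h
    exact absurd (Finset.HasAntidiagonal.mem_antidiagonal.2 (by simp)) h

theorem integral_mul_hermiteFun_inner {κ : Type*} [Fintype κ] [DecidableEq κ] {b : κ → E}
    (hb : Orthonormal ℝ b) {u : E} (hu : ‖u‖ = 1) {Φ : (κ → ℝ) → ℝ} (hΦ : Continuous Φ)
    (hΦg : PolyGrowth (fun ξ : E => ‖ξ‖) fun ξ => Φ fun j => ⟪b j, ξ⟫) (q : ℕ) :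
    ∫ ξ, Φ (fun j => ⟪b j, ξ⟫) * hermiteFun q ⟪u, ξ⟫ ∂stdGaussian E =
      ∑ m ∈ Finset.piAntidiag (Finset.univ : Finset κ) q, (Nat.multinomial Finset.univ m : ℝ) *
        ((∏ i, ⟪b i, u⟫ ^ m i) *
          ∫ ξ, Φ (fun j => ⟪b j, ξ⟫) * ∏ i, hermiteFun (m i) ⟪b i, ξ⟫ ∂stdGaussian E) := by
  refine Eq.trans ?_ (integral_mul_hermiteFun_add hb hu hΦ hΦg (y := id) continuous_id
    (fun i => polyGrowth_inner (b i)) q)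
  congr 1
  ext ξ
  congr 2
  simp only [id, inner_sub_left, sum_inner, real_inner_smul_left]
  ring

theorem integral_prod_hermiteFun_mul {κ : Type*} [Fintype κ] {b : κ → E} (hb : Orthonormal ℝ b)
    (m m' : κ → ℕ) :
    ∫ ξ, (∏ i, hermiteFun (m i) ⟪b i, ξ⟫) * ∏ i, hermiteFun (m' i) ⟪b i, ξ⟫ ∂stdGaussian E =
      ∏ i, if m i = m' i then ((m' i).factorial : ℝ) else 0 := by
  have hH := fun q => continuous_hermiteFun q
  have hc : ∀ m : κ → ℕ, Continuous fun z : κ → ℝ => ∏ i, hermiteFun (m i) (z i) := fun m =>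
    continuous_finsetProd _ fun i _ => (hH (m i)).comp (continuous_apply i)
  have h := (hasLaw_inner_orthonormal hb).integral_comp
    (f := fun z : κ → ℝ => (∏ i, hermiteFun (m i) (z i)) * ∏ i, hermiteFun (m' i) (z i))
    ((hc m).mul (hc m')).aestronglyMeasurable
  simp only [Function.comp_def] at h
  rw [h]
  simp only [← Finset.prod_mul_distrib]
  rw [integral_fintype_prod_eq_prod (𝕜 := ℝ)
    (fun i z => hermiteFun (m i) z * hermiteFun (m' i) z)]
  exact Finset.prod_congr rfl fun i _ => integral_hermiteFun_mul_hermiteFun _ _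

/-- Expand H_q(⟪u, ξ⟫) by the multinomial formula; orthogonality keeps only the index `m`, and its
multinomial coefficient times ∏ m_i! is q!. -/
theorem integral_prod_hermiteFun_mul_hermiteFun_inner {κ : Type*} [Fintype κ] {b : κ → E}
    (hb : Orthonormal ℝ b) {u : E} (hu : ‖u‖ = 1) (m : κ → ℕ) (q : ℕ) :
    ∫ ξ, (∏ i, hermiteFun (m i) ⟪b i, ξ⟫) * hermiteFun q ⟪u, ξ⟫ ∂stdGaussian E =
      if ∑ i, m i = q then (q.factorial : ℝ) * ∏ i, ⟪b i, u⟫ ^ m i else 0 := by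
  classical
  have hH := fun q => continuous_hermiteFun q
  have hc : Continuous fun z : κ → ℝ => ∏ i, hermiteFun (m i) (z i) :=
    continuous_finsetProd _ fun i _ => (hH (m i)).comp (continuous_apply i)
  rw [integral_mul_hermiteFun_inner hb hu hc
    (PolyGrowth.prod fun i _ => (polyGrowth_inner (b i)).hermiteFun (m i)) q]
  simp only [integral_prod_hermiteFun_mul hb]
  have hz : ∀ m' : κ → ℕ, m' ≠ m →
      (∏ i, if m i = m' i then ((m' i).factorial : ℝ) else 0) = 0 := by
    intro m' hne
    obtain ⟨i, hi⟩ := Function.ne_iff.1 hne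
    exact Finset.prod_eq_zero (Finset.mem_univ i) (if_neg (Ne.symm hi))
  split_ifs with hq
  · rw [Finset.sum_eq_single m]
    · have hmul : (∏ i, ((m i).factorial : ℝ)) * (Nat.multinomial Finset.univ m : ℝ) =
          (q.factorial : ℝ) := by
        have := Nat.multinomial_spec Finset.univ m
        rw [hq] at this
        exact_mod_cast this
      simp only [if_true]
      rw [← hmul]
      ring
    · intro m' _ hne
      rw [hz m' hne, mul_zero, mul_zero]
    · intro h
      exact absurd (Finset.mem_piAntidiag.2 ⟨hq, by simp⟩) h
  · refine Finset.sum_eq_zero fun m' hm' => ?_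
    rw [hz m', mul_zero, mul_zero]
    rintro rfl
    exact hq (Finset.mem_piAntidiag.1 hm').1

end GaussianHermite

end ArithmeticWave

namespace ArithmeticWave

local notation "⟪" x ", " y "⟫" => inner ℝ x y

/-! ### Wiener chaoses: orthogonality and polarization -/

section HilbertSum

variable {H : Type*} [NormedAddCommGroup H] [InnerProductSpace ℝ H] [CompleteSpace H]

/-- The hypothesis asks completeness of the family only against `F`: it places `F` in the double
orthogonal of the sum of the spaces, that is in its closure, where the orthogonal decomposition
holds. -/
theorem hasSum_starProjection_of_orthogonal {ι : Type*} (K : ι → Submodule ℝ H)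
    [∀ i, CompleteSpace (K i)] (hK : Pairwise fun i j => K i ⟂ K j) {F : H}
    (hF : ∀ R : H, (∀ i, R ∈ (K i)ᗮ) → ⟪R, F⟫ = 0) :
    HasSum (fun i => (K i).starProjection F) F := by
  classical
  have hV : OrthogonalFamily ℝ (fun i => K i) fun i => (K i).subtypeₗᵢ :=
    OrthogonalFamily.of_pairwise hK
  have hmem : F ∈ (⨆ i, K i).topologicalClosure := by
    rw [← Submodule.orthogonal_orthogonal_eq_closure, Submodule.mem_orthogonal]
    intro R hR
    refine hF R fun i => ?_
    exact Submodule.orthogonal_le (le_iSup K i) hR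
  have hr := hV.range_linearIsometry
  have hs : (⨆ i, LinearMap.range (K i).subtypeₗᵢ.toLinearMap) = ⨆ i, K i := by
    congr 1; ext1 i; simp
  rw [hs] at hr
  rw [← hr] at hmem
  obtain ⟨f, hf⟩ := hmem
  have hsum := hV.hasSum_linearIsometry f
  have hf' : hV.linearIsometry f = F := hf
  rw [hf'] at hsum
  simp only [Submodule.coe_subtypeₗᵢ, Submodule.coe_subtype] at hsum
  have hp : ∀ j, (K j).starProjection F = f j := by
    intro j
    have h1 := hsum.mapL (K j).starProjection
    have h2 : HasSum (fun i => (K j).starProjection (f i : H)) (f j : H) := by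
      convert hasSum_ite_eq j (f j : H) using 2 with i
      split_ifs with hij
      · subst hij
        exact Submodule.starProjection_eq_self_iff.2 (f i).2
      · rw [Submodule.starProjection_apply_eq_zero_iff]
        exact (Submodule.isOrtho_iff_le.1 (hK hij)) (f i).2
    exact h1.unique h2
  simpa only [hp] using hsum

end HilbertSum

theorem mem_orthogonal_span {H : Type*} [NormedAddCommGroup H] [InnerProductSpace ℝ H] {S : Set H}
    {F : H} (hF : ∀ G ∈ S, ⟪G, F⟫ = 0) : F ∈ (Submodule.span ℝ S)ᗮ := by
  rw [Submodule.mem_orthogonal]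
  intro G hG
  induction hG using Submodule.span_induction with
  | mem G hG => exact hF G hG
  | zero => exact inner_zero_left F
  | add G G' _ _ h h' => rw [inner_add_left, h, h', add_zero]
  | smul c G _ h => rw [real_inner_smul_left, h, mul_zero]

section Chaos

theorem inner_lp_two_eq_integral {Ω : Type*} [MeasurableSpace Ω] {P : Measure Ω} (F G : Lp ℝ 2 P) :
    ⟪F, G⟫ = ∫ ω, F ω * G ω ∂P := by
  rw [L2.inner_def]
  congr 1
  ext ω
  simp [mul_comm]

variable {E : Type*} [NormedAddCommGroup E] [InnerProductSpace ℝ E] [FiniteDimensional ℝ E]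
  [MeasurableSpace E] [BorelSpace E]

theorem integral_inner_mul_inner (u v : E) :
    ∫ ξ, ⟪u, ξ⟫ * ⟪v, ξ⟫ ∂stdGaussian E = ⟪u, v⟫ := by
  have h : covarianceBilin (stdGaussian E) u v = ⟪u, v⟫ := by
    rw [covarianceBilin_stdGaussian]; rfl
  rw [← h, covarianceBilin_apply IsGaussian.memLp_two_id]
  simp

theorem integral_eval_mul_eval_pi {k : ℕ} (i j : Fin k) :
    ∫ z : Fin k → ℝ, z i * z j ∂(Measure.pi fun _ => gaussianReal 0 1) =
      if i = j then 1 else 0 := by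
  have hb := (EuclideanSpace.basisFun (Fin k) ℝ).orthonormal
  have h := (hasLaw_inner_orthonormal hb).integral_comp (f := fun z : Fin k → ℝ => z i * z j)
    (by fun_prop)
  rw [← h]
  simp only [Function.comp_def]
  rw [integral_inner_mul_inner, orthonormal_iff_ite.1 hb]

/-- The Gaussian space of the coefficients consists of the linear functionals of a standard
Gaussian vector `ξ`. -/
structure IsGaussianModel {Ω : Type*} [MeasurableSpace Ω] {d : ℕ} (P : Measure Ω) (n : ℕ)
    (a : (Fin d → ℤ) → Ω → ℂ) (ξ : Ω → E) : Prop where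
  hasLaw : HasLaw ξ (stdGaussian E) P
  mem_iff : ∀ F : Lp ℝ 2 P, F ∈ gaussianSpace P n a ↔ ∃ u : E, F =ᵐ[P] fun ω => ⟪u, ξ ω⟫

namespace IsGaussianModel

variable {Ω : Type*} [MeasurableSpace Ω] {d : ℕ} {P : Measure Ω} {n : ℕ}
  {a : (Fin d → ℤ) → Ω → ℂ} {ξ : Ω → E} (h : IsGaussianModel P n a ξ)

include h

omit [BorelSpace E] in
theorem memLp_comp {g : E → ℝ} {p : ℝ≥0∞} (hg : MemLp g p (stdGaussian E)) :
    MemLp (fun ω => g (ξ ω)) p P := by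
  have := h.hasLaw.map_eq
  rw [← this] at hg
  exact hg.comp_of_map h.hasLaw.aemeasurable

theorem memLp_of_polyGrowth {g : E → ℝ} (hg : PolyGrowth (fun ξ => ‖ξ‖) g) (hc : Continuous g) :
    MemLp (fun ω => g (ξ ω)) 2 P :=
  h.memLp_comp (hg.memLp_two hc.aestronglyMeasurable)

theorem memLp_hermiteFun_inner (u : E) (q : ℕ) :
    MemLp (fun ω => hermiteFun q ⟪u, ξ ω⟫) 2 P :=
  h.memLp_of_polyGrowth (g := fun ξ => hermiteFun q ⟪u, ξ⟫) ((polyGrowth_inner u).hermiteFun q)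
    ((continuous_hermiteFun q).comp (by fun_prop))

theorem memLp_prod_hermiteFun_inner {κ : Type*} [Fintype κ] (b : κ → E) (m : κ → ℕ) :
    MemLp (fun ω => ∏ i, hermiteFun (m i) ⟪b i, ξ ω⟫) 2 P :=
  h.memLp_of_polyGrowth (g := fun ξ => ∏ i, hermiteFun (m i) ⟪b i, ξ⟫)
    (PolyGrowth.prod fun i _ => (polyGrowth_inner (b i)).hermiteFun (m i))
    (continuous_finsetProd _ fun i _ => (continuous_hermiteFun (m i)).comp (by fun_prop))

/-- The covariance of ⟪u, ξ⟫ and ⟪u', ξ⟫ is ⟪u, u'⟫, so a standard Gaussian vector in the Gaussian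
space comes from orthonormal vectors of `E`. -/
theorem exists_orthonormal {k : ℕ} {ζ : Fin k → Lp ℝ 2 P} (hζ : ∀ i, ζ i ∈ gaussianSpace P n a)
    (hlaw : HasLaw (fun ω i => ζ i ω) (Measure.pi fun _ : Fin k => gaussianReal 0 1) P) :
    ∃ b : Fin k → E, Orthonormal ℝ b ∧ ∀ i, ζ i =ᵐ[P] fun ω => ⟪b i, ξ ω⟫ := by
  choose b hb using fun i => (h.mem_iff (ζ i)).1 (hζ i)
  refine ⟨b, ?_, hb⟩
  rw [orthonormal_iff_ite]
  intro i j
  have h1 := hlaw.integral_comp (f := fun z : Fin k → ℝ => z i * z j) (by fun_prop)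
  have h2 := h.hasLaw.integral_comp (f := fun ξ : E => ⟪b i, ξ⟫ * ⟪b j, ξ⟫) (by fun_prop)
  rw [integral_eval_mul_eval_pi] at h1
  rw [integral_inner_mul_inner] at h2
  rw [← h1, ← h2]
  refine integral_congr_ae ?_
  filter_upwards [hb i, hb j] with ω hi hj
  simp [hi, hj]

theorem prod_hermiteFun_mem {k : ℕ} (hk : 1 ≤ k) {b : Fin k → E} (hb : Orthonormal ℝ b)
    (m : Fin k → ℕ) :
    (h.memLp_prod_hermiteFun_inner b m).toLp _ ∈ wienerChaos P n a (∑ i, m i) := by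
  refine Submodule.le_topologicalClosure _ (Submodule.subset_span ?_)
  have hL : ∀ i, MemLp (fun ω => ⟪b i, ξ ω⟫) 2 P := fun i =>
    h.memLp_of_polyGrowth (polyGrowth_inner (b i)) (by fun_prop)
  refine ⟨k, hk, m, fun i => (hL i).toLp _, rfl, fun i => ?_, ?_, ?_⟩
  · exact (h.mem_iff _).2 ⟨b i, (hL i).coeFn_toLp⟩
  · refine ((hasLaw_inner_orthonormal hb).comp h.hasLaw).congr ?_
    filter_upwards [ae_all_iff.2 fun i => (hL i).coeFn_toLp] with ω hω
    ext i
    exact hω i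
  · filter_upwards [ae_all_iff.2 fun i => (hL i).coeFn_toLp,
      (h.memLp_prod_hermiteFun_inner b m).coeFn_toLp] with ω hω hω'
    rw [hω']
    exact Finset.prod_congr rfl fun i _ => by rw [hω i]

theorem hermiteFun_inner_mem {u : E} (hu : ‖u‖ = 1) (q : ℕ) :
    (h.memLp_hermiteFun_inner u q).toLp _ ∈ wienerChaos P n a q := by
  have hb : Orthonormal ℝ (fun _ : Fin 1 => u) :=
    ⟨fun _ => hu, fun i j hij => absurd (Subsingleton.elim i j) hij⟩
  have := h.prod_hermiteFun_mem le_rfl hb fun _ => q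
  simpa using this

/-- Polarization: the products of Hermite polynomials spanning a chaos are controlled by the
Hermite polynomials of single unit variables. -/
theorem mem_orthogonal_wienerChaos {F : Lp ℝ 2 P} {q : ℕ}
    (hF : ∀ u : E, ‖u‖ = 1 → ∫ ω, F ω * hermiteFun q ⟪u, ξ ω⟫ ∂P = 0) :
    F ∈ (wienerChaos P n a q)ᗮ := by
  classical
  rw [wienerChaos, Submodule.orthogonal_closure]
  refine mem_orthogonal_span ?_
  rintro G ⟨k, hk, m, ζ, hm, hζ, hlaw, hG⟩
  obtain ⟨b, hb, hbζ⟩ := h.exists_orthonormal hζ hlaw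
  let c : (Fin k → ℕ) → ℝ := fun m' => ∫ ω, F ω * ∏ i, hermiteFun (m' i) ⟪b i, ξ ω⟫ ∂P
  have hint : ∀ m' : Fin k → ℕ, Integrable (fun ω => F ω * ∏ i, hermiteFun (m' i) ⟪b i, ξ ω⟫) P := fun m' =>
    (Lp.memLp F).integrable_mul (h.memLp_prod_hermiteFun_inner b m')
  -- Test with u = ∑ t_i b_i, a unit vector: the multinomial formula gives a polynomial in t
  -- vanishing on the unit sphere.
  have hunit : ∀ t : Fin k → ℝ, ∑ i, t i ^ 2 = 1 →
      ∑ m' ∈ Finset.piAntidiag (Finset.univ : Finset (Fin k)) q,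
        (Nat.multinomial Finset.univ m' : ℝ) * c m' * ∏ i, t i ^ m' i = 0 := by
    intro t ht
    have hn : ‖∑ i, t i • b i‖ = 1 := by
      have : ‖∑ i, t i • b i‖ ^ 2 = 1 := by
        rw [← real_inner_self_eq_norm_sq, hb.inner_sum, ← ht]
        simp [sq]
      nlinarith [norm_nonneg (∑ i, t i • b i)]
    rw [← hF _ hn]
    have hexp : ∀ ω, F ω * hermiteFun q ⟪∑ i, t i • b i, ξ ω⟫ =
        ∑ m' ∈ Finset.piAntidiag (Finset.univ : Finset (Fin k)) q,
          (Nat.multinomial Finset.univ m' : ℝ) * (∏ i, t i ^ m' i) *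
            (F ω * ∏ i, hermiteFun (m' i) ⟪b i, ξ ω⟫) := by
      intro ω
      rw [sum_inner]
      simp only [real_inner_smul_left]
      rw [hermiteFun_sum ht, Finset.mul_sum]
      refine Finset.sum_congr rfl fun m' _ => ?_
      ring
    simp only [hexp]
    rw [integral_finsetSum _ fun m' _ => (hint m').const_mul _]
    refine Finset.sum_congr rfl fun m' _ => ?_
    rw [integral_const_mul]
    ring
  -- Homogeneity of degree q extends the vanishing from the sphere to the whole space, so every
  -- coefficient is zero.
  have hall : ∀ t : Fin k → ℝ, ∑ m' ∈ Finset.piAntidiag (Finset.univ : Finset (Fin k)) q,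
        (Nat.multinomial Finset.univ m' : ℝ) * c m' * ∏ i, t i ^ m' i = 0 := by
    intro t
    set r := √(∑ i, t i ^ 2) with hr
    by_cases h0 : r = 0
    · have ht : ∀ i, t i = 0 := by
        have := (Real.sqrt_eq_zero (Finset.sum_nonneg fun i _ => sq_nonneg (t i))).1 h0
        intro i
        simpa using (Finset.sum_eq_zero_iff_of_nonneg fun i _ => sq_nonneg (t i)).1 this i
          (Finset.mem_univ i)
      -- At the origin with q = 0 the polynomial is a constant, evaluated at a unit vector; such a
      -- vector exists because k ≥ 1.
      rcases Nat.eq_zero_or_pos q with rfl | hq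
      · have := hunit (Pi.single ⟨0, hk⟩ 1) (by
          rw [Finset.sum_eq_single ⟨0, hk⟩] <;> simp +contextual)
        simpa using this
      · refine Finset.sum_eq_zero fun m' hm' => ?_
        have : ∃ i, m' i ≠ 0 := by
          by_contra! hne
          have h1 := (Finset.mem_piAntidiag.1 hm').1
          simp [hne] at h1
          omega
        obtain ⟨i, hi⟩ := this
        rw [Finset.prod_eq_zero (Finset.mem_univ i) (by rw [ht i, zero_pow hi]), mul_zero]
    · have hr2 : r ^ 2 = ∑ i, t i ^ 2 :=
        Real.sq_sqrt (Finset.sum_nonneg fun i _ => sq_nonneg (t i))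
      have h1 := hunit (fun i => r⁻¹ * t i) (by
        simp only [mul_pow]
        rw [← Finset.mul_sum, ← hr2, inv_pow, inv_mul_cancel₀ (pow_ne_zero 2 h0)])
      have h2 : ∑ m' ∈ Finset.piAntidiag (Finset.univ : Finset (Fin k)) q,
          (Nat.multinomial Finset.univ m' : ℝ) * c m' * ∏ i, t i ^ m' i = r ^ q *
          ∑ m' ∈ Finset.piAntidiag (Finset.univ : Finset (Fin k)) q,
          (Nat.multinomial Finset.univ m' : ℝ) * c m' * ∏ i, (r⁻¹ * t i) ^ m' i := by
        rw [Finset.mul_sum]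
        refine Finset.sum_congr rfl fun m' hm' => ?_
        simp only [mul_pow]
        rw [Finset.prod_mul_distrib, Finset.prod_pow_eq_pow_sum, (Finset.mem_piAntidiag.1 hm').1,
          inv_pow]
        field_simp
      rw [h2, h1, mul_zero]
  let p : MvPolynomial (Fin k) ℝ := ∑ m' ∈ Finset.piAntidiag (Finset.univ : Finset (Fin k)) q,
    MvPolynomial.monomial (Finsupp.equivFunOnFinite.symm m')
      ((Nat.multinomial Finset.univ m' : ℝ) * c m')
  have hp : p = 0 := by
    refine MvPolynomial.funext fun t => ?_
    rw [map_zero, ← hall t]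
    simp only [p, map_sum, MvPolynomial.eval_monomial]
    refine Finset.sum_congr rfl fun m' _ => ?_
    rw [Finsupp.prod_fintype _ _ fun i => pow_zero _]
    simp
  have hcm : c m = 0 := by
    have h1 := congrArg (MvPolynomial.coeff (Finsupp.equivFunOnFinite.symm m)) hp
    simp only [p, MvPolynomial.coeff_sum, MvPolynomial.coeff_monomial, MvPolynomial.coeff_zero,
      EmbeddingLike.apply_eq_iff_eq] at h1
    rw [Finset.sum_ite_eq' _ m, if_pos (Finset.mem_piAntidiag.2 ⟨hm, by simp⟩)] at h1
    exact (mul_eq_zero.1 h1).resolve_left (by exact_mod_cast (Nat.multinomial_pos _ _).ne')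
  rw [real_inner_comm, inner_lp_two_eq_integral, ← hcm]
  refine integral_congr_ae ?_
  filter_upwards [hG, ae_all_iff.2 hbζ] with ω h1 h2
  rw [h1]
  simp only [h2]

theorem integral_mul_hermiteFun_eq_zero {F : Lp ℝ 2 P} {q : ℕ} (hF : F ∈ (wienerChaos P n a q)ᗮ)
    {u : E} (hu : ‖u‖ = 1) : ∫ ω, F ω * hermiteFun q ⟪u, ξ ω⟫ ∂P = 0 := by
  have h1 := (Submodule.mem_orthogonal' _ _).1 hF _ (h.hermiteFun_inner_mem hu q)
  rw [inner_lp_two_eq_integral] at h1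
  rw [← h1]
  refine integral_congr_ae ?_
  filter_upwards [(h.memLp_hermiteFun_inner u q).coeFn_toLp] with ω hω
  rw [hω]

/-- Polarization is used once in each variable, which reduces the claim to E[H_q(⟪u, ξ⟫) H_p(⟪u',
ξ⟫)] = 0 for unit vectors. -/
theorem isOrtho_wienerChaos {p q : ℕ} (hpq : p ≠ q) :
    wienerChaos P n a p ⟂ wienerChaos P n a q := by
  have key : ∀ u : E, ‖u‖ = 1 → (h.memLp_hermiteFun_inner u q).toLp _ ∈ (wienerChaos P n a p)ᗮ := by
    intro u hu
    refine h.mem_orthogonal_wienerChaos fun u' hu' => ?_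
    have hb : Orthonormal ℝ (fun _ : Fin 1 => u) :=
      ⟨fun _ => hu, fun i j hij => absurd (Subsingleton.elim i j) hij⟩
    have h1 := integral_prod_hermiteFun_mul_hermiteFun_inner hb hu' (fun _ => q) p
    simp only [Finset.univ_unique, Finset.prod_singleton, Finset.sum_singleton] at h1
    rw [if_neg (Ne.symm hpq)] at h1
    have h2 := h.hasLaw.integral_comp (f := fun ξ : E => hermiteFun q ⟪u, ξ⟫ * hermiteFun p ⟪u', ξ⟫)
      (((continuous_hermiteFun q).comp (by fun_prop)).mul
        ((continuous_hermiteFun p).comp (by fun_prop))).aestronglyMeasurable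
    rw [← h1, ← h2]
    refine integral_congr_ae ?_
    filter_upwards [(h.memLp_hermiteFun_inner u q).coeFn_toLp] with ω hω
    rw [hω]
    rfl
  rw [Submodule.isOrtho_iff_le]
  intro G hG
  refine h.mem_orthogonal_wienerChaos fun u hu => ?_
  have h1 := (Submodule.mem_orthogonal _ _).1 (key u hu) G hG
  rw [inner_lp_two_eq_integral] at h1
  rw [← h1]
  refine integral_congr_ae ?_
  filter_upwards [(h.memLp_hermiteFun_inner u q).coeFn_toLp] with ω hω
  rw [hω]

theorem chaosProj_zero [IsProbabilityMeasure P] [Nontrivial E] (F : Lp ℝ 2 P) :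
    chaosProj P n a 0 F = Lp.const 2 P (∫ ω, F ω ∂P) := by
  obtain ⟨u, hu⟩ := exists_norm_eq E (zero_le_one (α := ℝ))
  have hc : ∀ c : ℝ, Lp.const 2 P c =ᵐ[P] fun _ => c := fun c => Lp.coeFn_const 2 P c
  have h1 : Lp.const 2 P (∫ ω, F ω ∂P) ∈ wienerChaos P n a 0 := by
    have h2 := Submodule.smul_mem _ (∫ ω, F ω ∂P) (h.hermiteFun_inner_mem hu 0)
    convert h2 using 1
    refine Lp.ext ?_
    filter_upwards [hc (∫ ω, F ω ∂P), Lp.coeFn_smul (∫ ω, F ω ∂P)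
      ((h.memLp_hermiteFun_inner u 0).toLp _), (h.memLp_hermiteFun_inner u 0).coeFn_toLp]
      with ω h1 h2 h3
    rw [h1, h2, Pi.smul_apply, h3, hermiteFun_zero]
    simp
  refine Submodule.eq_starProjection_of_mem_orthogonal h1 ?_
  refine h.mem_orthogonal_wienerChaos fun u' _ => ?_
  simp only [hermiteFun_zero, mul_one]
  have hi : Integrable F P := (Lp.memLp F).integrable (by norm_num)
  have h3 : ∫ ω, (F - Lp.const 2 P (∫ ω, F ω ∂P) : Lp ℝ 2 P) ω ∂P =
      ∫ ω, (F ω - ∫ ω, F ω ∂P) ∂P := by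
    refine integral_congr_ae ?_
    filter_upwards [Lp.coeFn_sub F (Lp.const 2 P (∫ ω, F ω ∂P)), hc (∫ ω, F ω ∂P)] with ω h1 h2
    rw [h1, Pi.sub_apply, h2]
  rw [h3, integral_sub hi (integrable_const _)]
  simp

end IsGaussianModel

end Chaos

end ArithmeticWave

namespace ArithmeticWave

local notation "⟪" x ", " y "⟫" => inner ℝ x y

/-! ### Totality of the chaoses among functions of the Gaussian vector -/

section Completeness

variable {E : Type*} [NormedAddCommGroup E] [InnerProductSpace ℝ E] [FiniteDimensional ℝ E]
  [MeasurableSpace E] [BorelSpace E]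

/-- Fernique's theorem gives some C > 0 with exp(C‖ξ‖²) integrable, and 2‖t‖‖ξ‖ ≤ ‖t‖²/C + C‖ξ‖². -/
theorem memLp_exp_abs_inner (t : E) :
    MemLp (fun ξ : E => Real.exp |⟪t, ξ⟫|) 2 (stdGaussian E) := by
  have hm : AEStronglyMeasurable (fun ξ : E => Real.exp |⟪t, ξ⟫|) (stdGaussian E) :=
    Continuous.aestronglyMeasurable (by fun_prop)
  rw [memLp_two_iff_integrable_sq hm]
  obtain ⟨C, hC, hint⟩ := IsGaussian.exists_integrable_exp_sq (stdGaussian E)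
  refine (hint.const_mul (Real.exp (‖t‖ ^ 2 / C))).mono' (hm.pow 2) (ae_of_all _ fun ξ => ?_)
  rw [Real.norm_of_nonneg (by positivity), ← Real.exp_nat_mul, ← Real.exp_add, Real.exp_le_exp]
  have h1 := abs_real_inner_le_norm t ξ
  have h2 : 2 * (‖t‖ * ‖ξ‖) ≤ ‖t‖ ^ 2 / C + C * ‖ξ‖ ^ 2 := by
    rw [div_add' _ _ _ hC.ne', le_div_iff₀ hC]
    nlinarith [sq_nonneg (‖t‖ - C * ‖ξ‖)]
  push_cast
  linarith

namespace IsGaussianModel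

variable {Ω : Type*} [MeasurableSpace Ω] {d : ℕ} {P : Measure Ω} {n : ℕ}
  {a : (Fin d → ℤ) → Ω → ℂ} {ξ : Ω → E} (h : IsGaussianModel P n a ξ)

include h

/-- Induction on k with the recurrence y·H_q = H_{q+1} + q·H_{q-1}: the statement is proved for
y^k·H_q with all q at once, and q = 0 gives the monomial. -/
theorem integral_mul_pow_eq_zero [Nontrivial E] {F : Lp ℝ 2 P}
    (hF : ∀ q, ∀ u : E, ‖u‖ = 1 → ∫ ω, F ω * hermiteFun q ⟪u, ξ ω⟫ ∂P = 0) (t : E) (k : ℕ) :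
    ∫ ω, F ω * ⟪t, ξ ω⟫ ^ k ∂P = 0 := by
  have hint : ∀ (u : E) (k q : ℕ),
      Integrable (fun ω => F ω * (⟪u, ξ ω⟫ ^ k * hermiteFun q ⟪u, ξ ω⟫)) P := by
    intro u k q
    refine (Lp.memLp F).integrable_mul (h.memLp_of_polyGrowth
      (g := fun ξ => ⟪u, ξ⟫ ^ k * hermiteFun q ⟪u, ξ⟫)
      (((polyGrowth_inner u).pow k).mul ((polyGrowth_inner u).hermiteFun q)) ?_)
    exact Continuous.mul (by fun_prop) ((continuous_hermiteFun q).comp (by fun_prop))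
  have hunit : ∀ u : E, ‖u‖ = 1 → ∀ k q : ℕ,
      ∫ ω, F ω * (⟪u, ξ ω⟫ ^ k * hermiteFun q ⟪u, ξ ω⟫) ∂P = 0 := by
    intro u hu k
    induction k with
    | zero => intro q; simpa using hF q u hu
    | succ k ih =>
      intro q
      have h1 : ∀ ω, F ω * (⟪u, ξ ω⟫ ^ (k + 1) * hermiteFun q ⟪u, ξ ω⟫) =
          F ω * (⟪u, ξ ω⟫ ^ k * hermiteFun (q + 1) ⟪u, ξ ω⟫) +
            q * (F ω * (⟪u, ξ ω⟫ ^ k * hermiteFun (q - 1) ⟪u, ξ ω⟫)) := by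
        intro ω
        rw [hermiteFun_succ]
        ring
      simp only [h1]
      rw [integral_add (hint u k _) ((hint u k _).const_mul _), integral_const_mul, ih, ih]
      simp
  by_cases ht : t = 0
  · obtain ⟨u, hu⟩ := exists_norm_eq E (zero_le_one (α := ℝ))
    rcases Nat.eq_zero_or_pos k with rfl | hk
    · simpa [hermiteFun_zero] using hunit u hu 0 0
    · simp [ht, hk.ne']
  · have h1 : ∀ ω, F ω * ⟪t, ξ ω⟫ ^ k =
        ‖t‖ ^ k * (F ω * (⟪‖t‖⁻¹ • t, ξ ω⟫ ^ k * hermiteFun 0 ⟪‖t‖⁻¹ • t, ξ ω⟫)) := by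
      intro ω
      rw [real_inner_smul_left, hermiteFun_zero, mul_pow, inv_pow]
      have : ‖t‖ ≠ 0 := norm_ne_zero_iff.2 ht
      field_simp
    simp only [h1, integral_const_mul]
    rw [hunit _ (by simp [norm_smul, ht]), mul_zero]

/-- Expand the exponential into its power series; the partial sums are dominated by |F|·exp|⟪t, ξ⟫|,
integrable as a product of square integrable functions. -/
theorem integral_mul_cexp_eq_zero [Nontrivial E] {F : Lp ℝ 2 P}
    (hF : ∀ q, ∀ u : E, ‖u‖ = 1 → ∫ ω, F ω * hermiteFun q ⟪u, ξ ω⟫ ∂P = 0) (t : E) :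
    ∫ ω, (F ω : ℂ) * Complex.exp (⟪ξ ω, t⟫ * Complex.I) ∂P = 0 := by
  have hξm : AEMeasurable ξ P := h.hasLaw.aemeasurable
  have hFm : AEStronglyMeasurable F P := Lp.aestronglyMeasurable F
  have hs := hasSum_integral_of_dominated_convergence (μ := P)
    (F := fun (k : ℕ) ω => (F ω : ℂ) * ((⟪t, ξ ω⟫ * Complex.I : ℂ) ^ k / k.factorial))
    (f := fun ω => (F ω : ℂ) * Complex.exp (⟪ξ ω, t⟫ * Complex.I))
    (fun k ω => |F ω| * (|⟪t, ξ ω⟫| ^ k / k.factorial)) (fun k => ?_) (fun k => ?_) ?_ ?_ ?_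
  · refine (hs.unique ?_).symm ▸ rfl
    have h0 : ∀ k : ℕ, ∫ ω, (F ω : ℂ) * ((⟪t, ξ ω⟫ * Complex.I : ℂ) ^ k / k.factorial) ∂P = 0 := by
      intro k
      have h1 : ∀ ω, (F ω : ℂ) * ((⟪t, ξ ω⟫ * Complex.I : ℂ) ^ k / k.factorial) =
          (Complex.I ^ k / k.factorial) * ((F ω * ⟪t, ξ ω⟫ ^ k : ℝ) : ℂ) := by
        intro ω; push_cast; ring
      simp only [h1]
      rw [integral_const_mul, integral_complex_ofReal, h.integral_mul_pow_eq_zero hF]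
      simp
    simp only [h0]
    exact hasSum_zero
  · have : AEMeasurable (fun ω => ⟪t, ξ ω⟫) P := by fun_prop
    have h1 : AEMeasurable (fun ω => (F ω : ℂ)) P :=
      Complex.measurable_ofReal.comp_aemeasurable hFm.aemeasurable
    exact (h1.mul ((((Complex.measurable_ofReal.comp_aemeasurable this).mul_const _).pow_const
      k).div_const _)).aestronglyMeasurable
  · refine ae_of_all _ fun ω => ?_
    simp
  · refine ae_of_all _ fun ω => ?_
    exact (Real.summable_pow_div_factorial _).mul_left _
  · have h1 : ∀ ω, ∑' k : ℕ, |F ω| * (|⟪t, ξ ω⟫| ^ k / k.factorial) =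
        |F ω| * Real.exp |⟪t, ξ ω⟫| := by
      intro ω
      rw [tsum_mul_left, Real.exp_eq_exp_ℝ, NormedSpace.exp_eq_tsum_div]
    simp only [h1]
    exact (Lp.memLp F).abs.integrable_mul (h.memLp_comp (memLp_exp_abs_inner t))
  · refine ae_of_all _ fun ω => ?_
    refine HasSum.mul_left _ ?_
    rw [real_inner_comm, Complex.exp_eq_exp_ℂ]
    exact NormedSpace.expSeries_div_hasSum_exp _

/-- The Hermite polynomials of unit variables are total in the space of square integrable
functions of `ξ`. -/
theorem integral_mul_comp_eq_zero [Nontrivial E] [IsFiniteMeasure P] {F : Lp ℝ 2 P}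
    (hF : ∀ q, ∀ u : E, ‖u‖ = 1 → ∫ ω, F ω * hermiteFun q ⟪u, ξ ω⟫ ∂P = 0) {g : E → ℝ}
    (hg : Measurable g) {C : ℝ} (hC : ∀ x, |g x| ≤ C) : ∫ ω, F ω * g (ξ ω) ∂P = 0 := by
  have hFi : Integrable F P := (Lp.memLp F).integrable (by norm_num)
  have hFm : Measurable F := (Lp.stronglyMeasurable F).measurable
  have hξm : AEMeasurable ξ P := h.hasLaw.aemeasurable
  -- `μ 1` and `μ (-1)` are the images under ξ of the positive and negative parts of F·P. Equality
  -- of their characteristic functions makes them equal.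
  let μ : ℝ → Measure E := fun s => (P.withDensity fun ω => ENNReal.ofReal (s * F ω)).map ξ
  have hξm' : ∀ s : ℝ, AEMeasurable ξ (P.withDensity fun ω => ENNReal.ofReal (s * F ω)) := fun s =>
    hξm.mono_ac (withDensity_absolutelyContinuous _ _)
  have hfin : ∀ s, IsFiniteMeasure (μ s) := by
    intro s
    have : IsFiniteMeasure (P.withDensity fun ω => ENNReal.ofReal (s * F ω)) := by
      refine isFiniteMeasure_withDensity ?_
      exact ((hFi.const_mul s).lintegral_lt_top).ne
    infer_instance
  have hcont : ∀ (s : ℝ) {𝕜 : Type} [RCLike 𝕜] (φ : E → 𝕜), Measurable φ →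
      ∫ x, φ x ∂μ s = ∫ ω, (max (s * F ω) 0 : ℝ) • φ (ξ ω) ∂P := by
    intro s 𝕜 _ φ hφ
    rw [integral_map (hξm' s) hφ.aestronglyMeasurable,
      integral_withDensity_eq_integral_toReal_smul₀ (by fun_prop) (by simp)]
    simp only [ENNReal.toReal_ofReal']
  have hsplit : ∀ ω, max (1 * F ω) 0 - max (-1 * F ω) 0 = F ω := by
    intro ω
    rcases le_total 0 (F ω) with h0 | h0
    · rw [max_eq_left (by linarith), max_eq_right (by linarith)]; ring
    · rw [max_eq_right (by linarith), max_eq_left (by linarith)]; ring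
  have hint : ∀ (s : ℝ) {𝕜 : Type} [RCLike 𝕜] (φ : E → 𝕜) (C : ℝ), Measurable φ →
      (∀ x, ‖φ x‖ ≤ C) → Integrable (fun ω => (max (s * F ω) 0 : ℝ) • φ (ξ ω)) P := by
    intro s 𝕜 _ φ C hφ hC
    have h1 : Integrable (fun ω => (max (s * F ω) 0 : ℝ)) P := (hFi.const_mul s).pos_part
    exact h1.smul_bdd C (hφ.comp_aemeasurable hξm).aestronglyMeasurable (ae_of_all _ fun ω => hC _)
  have hdiff : ∀ {𝕜 : Type} [RCLike 𝕜] (φ : E → 𝕜) (C : ℝ), Measurable φ →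
      (∀ x, ‖φ x‖ ≤ C) → ∫ x, φ x ∂μ 1 - ∫ x, φ x ∂μ (-1) = ∫ ω, F ω • φ (ξ ω) ∂P := by
    intro 𝕜 _ φ C hφ hC
    rw [hcont 1 φ hφ, hcont (-1) φ hφ, ← integral_sub (hint 1 φ C hφ hC) (hint (-1) φ C hφ hC)]
    congr 1
    ext ω
    rw [← sub_smul, hsplit]
  have hμ : μ 1 = μ (-1) := by
    refine Measure.ext_of_charFun (funext fun t => ?_)
    rw [charFun_apply, charFun_apply, ← sub_eq_zero,
      hdiff (fun x : E => Complex.exp (⟪x, t⟫ * Complex.I)) 1 (by fun_prop)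
        (fun x => by rw [Complex.norm_exp_ofReal_mul_I])]
    simpa [Complex.real_smul] using h.integral_mul_cexp_eq_zero hF t
  have := hdiff g C hg hC
  rw [hμ, sub_self] at this
  simpa using this.symm

theorem hasSum_chaosProj [Nontrivial E] [IsFiniteMeasure P] {F : Lp ℝ 2 P} {g : E → ℝ}
    (hg : Measurable g) {C : ℝ} (hC : ∀ x, |g x| ≤ C) (hF : F =ᵐ[P] fun ω => g (ξ ω)) :
    HasSum (fun q => chaosProj P n a q F) F := by
  refine hasSum_starProjection_of_orthogonal (wienerChaos P n a)
    (fun p q hpq => h.isOrtho_wienerChaos hpq) fun R hR => ?_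
  rw [inner_lp_two_eq_integral, ← h.integral_mul_comp_eq_zero
    (fun q u hu => h.integral_mul_hermiteFun_eq_zero (hR q) hu) hg hC]
  refine integral_congr_ae ?_
  filter_upwards [hF] with ω hω
  rw [hω]

end IsGaussianModel

end Completeness

end ArithmeticWave

namespace ArithmeticWave

local notation "⟪" x ", " y "⟫" => inner ℝ x y

/-! ### The Gaussian density, and Kac–Rice for signed test functions -/

section Density

theorem stdGaussian_euclideanSpace_eq_withDensity (d : ℕ) :
    stdGaussian (EuclideanSpace ℝ (Fin d)) = volume.withDensity fun z =>
      ENNReal.ofReal (1 / (2 * Real.pi) ^ ((d : ℝ) / 2) * Real.exp (-‖z‖ ^ 2 / 2)) := by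
  set ρ : EuclideanSpace ℝ (Fin d) → ℝ := fun z =>
    1 / (2 * Real.pi) ^ ((d : ℝ) / 2) * Real.exp (-‖z‖ ^ 2 / 2) with hρ
  have hρ0 : ∀ z, 0 ≤ ρ z := fun z => by positivity
  have hρc : Continuous ρ := by fun_prop
  have hi : Integrable ρ := by
    have h := GaussianFourier.integrable_cexp_neg_mul_sq_norm_add (b := 1 / 2)
      (V := EuclideanSpace ℝ (Fin d)) (by norm_num) 0 0
    refine (h.norm.const_mul (1 / (2 * Real.pi) ^ ((d : ℝ) / 2))).congr (ae_of_all _ fun z => ?_)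
    simp only [hρ, zero_mul, add_zero, Complex.norm_exp]
    congr 2
    have : (-(1 / 2 : ℂ) * (‖z‖ : ℂ) ^ 2) = ((-‖z‖ ^ 2 / 2 : ℝ) : ℂ) := by push_cast; ring
    rw [this, Complex.ofReal_re]
  have hfin : IsFiniteMeasure ((volume : Measure (EuclideanSpace ℝ (Fin d))).withDensity fun z =>
      ENNReal.ofReal (ρ z)) := isFiniteMeasure_withDensity_ofReal hi.2
  refine Measure.ext_of_charFun (funext fun t => ?_)
  rw [charFun_stdGaussian, charFun_apply,
    integral_withDensity_eq_integral_toReal_smul (by fun_prop) (by simp)]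
  have h1 : ∀ z : EuclideanSpace ℝ (Fin d), (ENNReal.ofReal (ρ z)).toReal •
      Complex.exp (⟪z, t⟫ * Complex.I) = (1 / (2 * Real.pi) ^ ((d : ℝ) / 2) : ℝ) *
        Complex.exp (-(1 / 2 : ℂ) * ‖z‖ ^ 2 + Complex.I * ⟪t, z⟫) := by
    intro z
    rw [ENNReal.toReal_ofReal (hρ0 z), Complex.real_smul, hρ, Complex.ofReal_mul,
      Complex.ofReal_exp, mul_assoc, ← Complex.exp_add, real_inner_comm]
    congr 2
    push_cast
    ring
  refine Eq.symm ((integral_congr_ae (ae_of_all _ h1)).trans ?_)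
  rw [integral_const_mul, GaussianFourier.integral_cexp_neg_mul_sq_norm_add (by norm_num)]
  rw [finrank_euclideanSpace_fin, ← mul_assoc]
  have h2 : ((Real.pi : ℂ) / (1 / 2)) ^ ((d : ℂ) / 2) =
      (((2 * Real.pi) ^ ((d : ℝ) / 2) : ℝ) : ℂ) := by
    rw [Complex.ofReal_cpow (by positivity)]
    congr 1 <;> push_cast <;> ring
  rw [h2, ← Complex.ofReal_mul, one_div_mul_cancel (by positivity), Complex.ofReal_one, one_mul]
  congr 1
  rw [Complex.I_sq]
  ring

theorem integral_stdGaussian_euclideanSpace {d : ℕ} (f : EuclideanSpace ℝ (Fin d) → ℝ) :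
    ∫ z, f z ∂stdGaussian (EuclideanSpace ℝ (Fin d)) =
      1 / (2 * Real.pi) ^ ((d : ℝ) / 2) * ∫ z, f z * Real.exp (-‖z‖ ^ 2 / 2) := by
  rw [stdGaussian_euclideanSpace_eq_withDensity,
    integral_withDensity_eq_integral_toReal_smul (by fun_prop) (by simp), ← integral_const_mul]
  congr 1
  ext z
  rw [ENNReal.toReal_ofReal (by positivity), smul_eq_mul]
  ring

theorem integral_norm_mul_prod_hermiteFun {d : ℕ} (m : Fin d → ℕ) :
    ∫ z : EuclideanSpace ℝ (Fin d), ‖z‖ * ∏ k, hermiteFun (m k) (z k) ∂stdGaussian _ =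
      (∏ k, ((m k).factorial : ℝ)) * normHermiteCoeff m := by
  rw [integral_stdGaussian_euclideanSpace, normHermiteCoeff, ← mul_assoc, ← mul_assoc,
    mul_one_div_cancel (Finset.prod_ne_zero_iff.2 fun k _ => by positivity), one_mul]

end Density

namespace IsIsotropicFrame

variable {d : ℕ} {E : Type*} [NormedAddCommGroup E] [InnerProductSpace ℝ E]
  [FiniteDimensional ℝ E] [MeasurableSpace E] [BorelSpace E]
  {v : EuclideanSpace ℝ (Fin d) → E} {w : Fin d → EuclideanSpace ℝ (Fin d) → E} {c : ℝ}

theorem hasLaw_gradVec (h : IsIsotropicFrame v w c) (x : EuclideanSpace ℝ (Fin d)) :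
    HasLaw (gradVec w x) (stdGaussian (EuclideanSpace ℝ (Fin d))) (stdGaussian E) := by
  have h1 := hasLaw_inner_orthonormal (h.orthonormal_w x)
  have h2 : HasLaw (WithLp.toLp 2 : (Fin d → ℝ) → EuclideanSpace ℝ (Fin d))
      (stdGaussian (EuclideanSpace ℝ (Fin d))) (Measure.pi fun _ => gaussianReal 0 1) :=
    ⟨by fun_prop, map_pi_eq_stdGaussian⟩
  exact h2.comp h1

end IsIsotropicFrame

theorem PolyGrowth.integrable_prod {X E : Type*} [MeasurableSpace X] [NormedAddCommGroup E]
    [NormedSpace ℝ E] [CompleteSpace E] [SecondCountableTopology E] [MeasurableSpace E]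
    [BorelSpace E] {μ : Measure X} [IsFiniteMeasure μ] {γ : Measure E} [IsGaussian γ]
    {g : X × E → ℝ} (hg : PolyGrowth (fun p => ‖p.2‖) g)
    (hm : AEStronglyMeasurable g (μ.prod γ)) : Integrable g (μ.prod γ) := by
  obtain ⟨C, k, h⟩ := hg
  refine (((integrable_one_add_norm_pow γ k).const_mul C).comp_snd μ).mono' hm
    (ae_of_all _ fun p => ?_)
  simpa using h p

theorem PolyGrowth.comp_of_norm_le {α E : Type*} [NormedAddCommGroup E] {N : α → ℝ} {g : E → ℝ}
    (hg : PolyGrowth (fun ξ => ‖ξ‖) g) {T : α → E} {K : ℝ} (hT : ∀ a, ‖T a‖ ≤ K * |N a|) :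
    PolyGrowth N fun a => g (T a) := by
  obtain ⟨C, k, h⟩ := hg
  refine ⟨|C| * (1 + |K|) ^ k, k, fun a => (h (T a)).trans ?_⟩
  rw [mul_assoc, ← mul_pow, abs_norm]
  have h1 : K * |N a| ≤ |K| * |N a| := by gcongr; exact le_abs_self K
  have h2 : 1 + ‖T a‖ ≤ (1 + |K|) * (1 + |N a|) := by
    nlinarith [hT a, abs_nonneg K, abs_nonneg (N a)]
  exact mul_le_mul (le_abs_self C) (pow_le_pow_left₀ (by positivity) h2 k) (by positivity)
    (abs_nonneg C)

instance isFiniteMeasure_restrict_unitCube (d : ℕ) :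
    IsFiniteMeasure (volume.restrict (unitCube d)) :=
  ⟨by simp [volume_unitCube]⟩

namespace IsIsotropicFrame

variable {d : ℕ} {E : Type*} [NormedAddCommGroup E] [InnerProductSpace ℝ E]
  [FiniteDimensional ℝ E] [MeasurableSpace E] [BorelSpace E]
  {v : EuclideanSpace ℝ (Fin d) → E} {w : Fin d → EuclideanSpace ℝ (Fin d) → E} {c : ℝ}

omit [FiniteDimensional ℝ E] [MeasurableSpace E] [BorelSpace E] in
theorem norm_gradVec_le (h : IsIsotropicFrame v w c) (x : EuclideanSpace ℝ (Fin d)) (ξ : E) :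
    ‖gradVec w x ξ‖ ≤ d * ‖ξ‖ := by
  refine (euclidean_norm_le_sum _).trans ?_
  have : ∀ k ∈ (Finset.univ : Finset (Fin d)), |gradVec w x ξ k| ≤ ‖ξ‖ := fun k _ => by
    simpa [gradVec, h.norm_w] using abs_real_inner_le_norm (w k x) ξ
  simpa using Finset.sum_le_sum this

/-- The Kac–Rice formula for test functions of polynomial growth. -/
theorem integral_zeroMeasure_mul (h : IsIsotropicFrame v w c)
    (hfin : ∀ᵐ ξ ∂stdGaussian E, μHE[d - 1] {x | x ∈ unitCube d ∧ ⟪v x, ξ⟫ = 0} < ⊤)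
    {g : E → ℝ} (hg : Continuous g) (hgg : PolyGrowth (fun ξ => ‖ξ‖) g) :
    ∫ ξ, (μHE[d - 1] {x | x ∈ unitCube d ∧ ⟪v x, ξ⟫ = 0}).toReal * g ξ ∂stdGaussian E =
      (√(2 * Real.pi))⁻¹ * c * ∫ x in unitCube d, ∫ ξ, ‖gradVec w x ξ‖ * g (ξ - ⟪v x, ξ⟫ • v x)
        ∂stdGaussian E := by
  set V : E → ℝ≥0∞ := fun ξ => μHE[d - 1] {x | x ∈ unitCube d ∧ ⟪v x, ξ⟫ = 0} with hVdef
  have hVm : Measurable V := h.measurable_zeroMeasure (d - 1) (isSigmaCompact_unitCube d)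
  have hcv := h.continuous_v
  have hcg := h.continuous_gradVec
  have hc := h.pos
  set μ := ((volume : Measure (EuclideanSpace ℝ (Fin d))).restrict (unitCube d)).prod
    (stdGaussian E) with hμ
  let T : EuclideanSpace ℝ (Fin d) × E → E := fun p => p.2 - ⟪v p.1, p.2⟫ • v p.1
  have hT : Continuous T := by fun_prop
  let D : EuclideanSpace ℝ (Fin d) × E → ℝ := fun p =>
    (√(2 * Real.pi))⁻¹ * c * ‖gradVec w p.1 p.2‖
  have hD : Continuous D := by fun_prop
  have hD0 : ∀ p, 0 ≤ D p := fun p => by positivity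
  -- Kac–Rice for all nonnegative weights is an identity of measures, which can then be integrated
  -- against signed functions.
  have hmeas : (stdGaussian E).withDensity V =
      (μ.withDensity fun p => ENNReal.ofReal (D p)).map T := by
    refine Measure.ext_of_lintegral _ fun G hG => ?_
    rw [lintegral_withDensity_eq_lintegral_mul _ hVm hG, lintegral_map hG hT.measurable,
      lintegral_withDensity_eq_lintegral_mul _ (by fun_prop) (by fun_prop), hμ,
      lintegral_prod _ (Measurable.aemeasurable (by
        exact Measurable.mul (by fun_prop) (by fun_prop)))]
    have h1 := h.kacRice hG
    simp only [Pi.mul_apply, mul_comm (V _)]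
    rw [h1]
    congr 1
    ext x
    rw [← lintegral_const_mul _ (by
      have : Measurable fun ξ : E => gradVec w x ξ := (hcg.comp (by fun_prop : Continuous fun ξ : E => (x, ξ))).measurable
      exact Measurable.mul (by fun_prop) (by fun_prop))]
    congr 1
    ext ξ
    simp only [D, T]
    rw [ENNReal.ofReal_mul (by positivity), ENNReal.ofReal_mul (by positivity), ofReal_norm]
    ring
  have hl := integral_withDensity_eq_integral_toReal_smul hVm hfin g
  rw [hmeas, integral_map hT.aemeasurable hg.aestronglyMeasurable,
    integral_withDensity_eq_integral_toReal_smul (by fun_prop) (by simp)] at hl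
  have hgT : PolyGrowth (fun p : EuclideanSpace ℝ (Fin d) × E => ‖p.2‖) fun p => g (T p) := by
    refine hgg.comp_of_norm_le (K := 2) fun p => ?_
    have h2 := abs_real_inner_le_norm (v p.1) p.2
    rw [h.norm_v, one_mul] at h2
    calc ‖T p‖ ≤ ‖p.2‖ + ‖⟪v p.1, p.2⟫ • v p.1‖ := norm_sub_le _ _
      _ = ‖p.2‖ + |⟪v p.1, p.2⟫| := by rw [norm_smul, h.norm_v, mul_one, Real.norm_eq_abs]
      _ ≤ 2 * |‖p.2‖| := by rw [abs_norm]; linarith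
  have hgr : PolyGrowth (fun p : EuclideanSpace ℝ (Fin d) × E => ‖p.2‖)
      fun p => ‖gradVec w p.1 p.2‖ :=
    ⟨d, 1, fun p => by
      have := h.norm_gradVec_le p.1 p.2
      have hd : (0 : ℝ) ≤ d := by positivity
      rw [abs_norm, abs_norm]
      linarith⟩
  have hint : Integrable (fun p => (ENNReal.ofReal (D p)).toReal • g (T p)) μ := by
    have : Integrable (fun p => D p * g (T p)) μ :=
      ((hgr.const_mul _).mul hgT).integrable_prod (hD.mul (hg.comp hT)).aestronglyMeasurable
    refine this.congr (ae_of_all _ fun p => ?_)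
    simp [ENNReal.toReal_ofReal (hD0 p)]
  rw [hμ, integral_prod _ hint] at hl
  simp only [smul_eq_mul] at hl
  rw [← hl, ← integral_const_mul]
  congr 1
  ext x
  rw [← integral_const_mul]
  congr 1
  ext ξ
  rw [ENNReal.toReal_ofReal (hD0 _)]
  simp only [D, T]
  ring

end IsIsotropicFrame

end ArithmeticWave

/-! ### Projections of the nodal volume on the chaoses -/

namespace ArithmeticWave

local notation "⟪" x ", " y "⟫" => inner ℝ x y

/-- The Hermite coefficients of the formal density `δ₀(z₀) ‖(z₁, …, z_d)‖` of the nodal measure. -/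
noncomputable def chaosCoeff {d : ℕ} (m : Fin (d + 1) → ℕ) : ℝ :=
  betaCoeff (m 0) / ((m 0).factorial : ℝ) * normHermiteCoeff fun k => m k.succ

section Frame

variable {d : ℕ} {E : Type*} [NormedAddCommGroup E] [InnerProductSpace ℝ E]

/-- The orthonormal family `(v x, w_1 x, …, w_d x)`. -/
def frameVec (v : EuclideanSpace ℝ (Fin d) → E) (w : Fin d → EuclideanSpace ℝ (Fin d) → E)
    (x : EuclideanSpace ℝ (Fin d)) : Fin (d + 1) → E :=
  Fin.cons (v x) fun k => w k x

/-- The component of order `q` of the Hermite expansion of the nodal measure. -/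
noncomputable def chaosComponent (v : EuclideanSpace ℝ (Fin d) → E)
    (w : Fin d → EuclideanSpace ℝ (Fin d) → E) (c : ℝ) (q : ℕ) (ξ : E) : ℝ :=
  c * ∑ m ∈ Finset.piAntidiag (Finset.univ : Finset (Fin (d + 1))) q, chaosCoeff m *
    ∫ x in unitCube d, ∏ i, hermiteFun (m i) ⟪frameVec v w x i, ξ⟫

variable {v : EuclideanSpace ℝ (Fin d) → E} {w : Fin d → EuclideanSpace ℝ (Fin d) → E} {c : ℝ}

namespace IsIsotropicFrame

theorem orthonormal_frameVec (h : IsIsotropicFrame v w c) (x : EuclideanSpace ℝ (Fin d)) :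
    Orthonormal ℝ (frameVec v w x) := h.orthonormal x

theorem continuous_frameVec (h : IsIsotropicFrame v w c) (i : Fin (d + 1)) :
    Continuous fun x => frameVec v w x i := by
  refine Fin.cases ?_ (fun k => ?_) i
  · exact h.continuous_v
  · exact h.continuous_w k

theorem continuous_prod_hermiteFun (h : IsIsotropicFrame v w c) (m : Fin (d + 1) → ℕ) :
    Continuous fun p : EuclideanSpace ℝ (Fin d) × E =>
      ∏ i, hermiteFun (m i) ⟪frameVec v w p.1 i, p.2⟫ :=
  continuous_finsetProd _ fun i _ => (continuous_hermiteFun (m i)).comp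
    (((h.continuous_frameVec i).comp continuous_fst).inner continuous_snd)

theorem polyGrowth_prod_hermiteFun (h : IsIsotropicFrame v w c) (m : Fin (d + 1) → ℕ) :
    PolyGrowth (fun p : EuclideanSpace ℝ (Fin d) × E => ‖p.2‖) fun p =>
      ∏ i, hermiteFun (m i) ⟪frameVec v w p.1 i, p.2⟫ := by
  refine PolyGrowth.prod fun i _ => PolyGrowth.hermiteFun (PolyGrowth.of_abs_le fun p => ?_) _
  have := abs_real_inner_le_norm (frameVec v w p.1 i) p.2
  rwa [(h.orthonormal_frameVec p.1).1 i, one_mul, ← abs_norm p.2] at this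

theorem polyGrowth_chaosComponent (h : IsIsotropicFrame v w c) (q : ℕ) :
    PolyGrowth (fun ξ : E => ‖ξ‖) (chaosComponent v w c q) := by
  refine PolyGrowth.const_mul c (PolyGrowth.sum fun m _ => PolyGrowth.const_mul _ ?_)
  obtain ⟨C, k, hC⟩ := h.polyGrowth_prod_hermiteFun m
  refine ⟨C, k, fun ξ => ?_⟩
  have := norm_setIntegral_le_of_norm_le_const (μ := volume) (s := unitCube d)
    (f := fun x => ∏ i, hermiteFun (m i) ⟪frameVec v w x i, ξ⟫)
    (C := C * (1 + |‖ξ‖|) ^ k) (by simp [volume_unitCube]) fun x _ => hC (x, ξ)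
  simpa [Measure.real, volume_unitCube] using this

variable [FiniteDimensional ℝ E] [MeasurableSpace E] [BorelSpace E]

omit [FiniteDimensional ℝ E] in
theorem measurable_chaosComponent (h : IsIsotropicFrame v w c) (q : ℕ) :
    Measurable (chaosComponent v w c q) := by
  refine Measurable.const_mul (Finset.measurable_sum _ fun m _ => Measurable.const_mul ?_ _) _
  have h1 : StronglyMeasurable (Function.uncurry fun (ξ : E) (x : EuclideanSpace ℝ (Fin d)) =>
      ∏ i, hermiteFun (m i) ⟪frameVec v w x i, ξ⟫) :=
    ((h.continuous_prod_hermiteFun m).comp continuous_swap).stronglyMeasurable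
  exact (h1.integral_prod_right (ν := volume.restrict (unitCube d))).measurable

/-- Projecting off v x sets the first frame coordinate to 0 and leaves the rest of ξ unchanged. In
the multinomial expansion this coordinate contributes H_{m 0}(0), i.e. β, and the others the Hermite
coefficients of the norm. -/
theorem integral_norm_gradVec_mul_hermiteFun (h : IsIsotropicFrame v w c)
    (x : EuclideanSpace ℝ (Fin d)) {u : E} (hu : ‖u‖ = 1) (q : ℕ) :
    ∫ ξ, ‖gradVec w x ξ‖ * hermiteFun q ⟪u, ξ - ⟪v x, ξ⟫ • v x⟫ ∂stdGaussian E =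
      √(2 * Real.pi) * ∑ m ∈ Finset.piAntidiag (Finset.univ : Finset (Fin (d + 1))) q,
        q.factorial * chaosCoeff m * ∏ i, ⟪frameVec v w x i, u⟫ ^ m i := by
  have hb := h.orthonormal_frameVec x
  let Φ : (Fin (d + 1) → ℝ) → ℝ := fun z =>
    ‖(WithLp.toLp 2 fun k : Fin d => z k.succ : EuclideanSpace ℝ (Fin d))‖
  -- The frame coordinates of the vector projected orthogonally to v x.
  let y : (Fin (d + 1) → ℝ) → Fin (d + 1) → ℝ := fun z => Fin.cons 0 fun k => z k.succ
  have hΦ : Continuous Φ := by fun_prop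
  have hy : Continuous y := by
    refine continuous_pi fun i => Fin.cases ?_ (fun k => ?_) i
    · exact continuous_const
    · exact continuous_apply k.succ
  have hgrad : ∀ ξ, Φ (fun j => ⟪frameVec v w x j, ξ⟫) = ‖gradVec w x ξ‖ := fun ξ => rfl
  have key := integral_mul_hermiteFun_add hb hu hΦ (y := y) ?_ hy ?_ q
  · have hl : ∀ ξ, Φ (fun j => ⟪frameVec v w x j, ξ⟫) * hermiteFun q
        (∑ i, ⟪frameVec v w x i, u⟫ * y (fun j => ⟪frameVec v w x j, ξ⟫) i +
          ⟪u - ∑ j, ⟪frameVec v w x j, u⟫ • frameVec v w x j, ξ⟫) =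
        ‖gradVec w x ξ‖ * hermiteFun q ⟪u, ξ - ⟪v x, ξ⟫ • v x⟫ := by
      intro ξ
      rw [hgrad]
      congr 2
      rw [inner_sub_left, sum_inner, Fin.sum_univ_succ, Fin.sum_univ_succ, inner_sub_right,
        real_inner_smul_right]
      simp only [y, frameVec, Fin.cons_zero, Fin.cons_succ, real_inner_smul_left]
      rw [real_inner_comm u (v x)]
      ring
    simp only [hl] at key
    rw [key, Finset.mul_sum]
    refine Finset.sum_congr rfl fun m hm => ?_
    have h1 : ∀ ξ, Φ (fun j => ⟪frameVec v w x j, ξ⟫) *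
        ∏ i, hermiteFun (m i) (y (fun j => ⟪frameVec v w x j, ξ⟫) i) =
        hermiteFun (m 0) 0 * (‖gradVec w x ξ‖ *
          ∏ k : Fin d, hermiteFun (m k.succ) (gradVec w x ξ k)) := by
      intro ξ
      rw [hgrad, Fin.prod_univ_succ]
      simp only [y, frameVec, Fin.cons_zero, Fin.cons_succ, gradVec]
      ring
    simp only [h1, integral_const_mul]
    have h2 := (h.hasLaw_gradVec x).integral_comp (f := fun z : EuclideanSpace ℝ (Fin d) =>
      ‖z‖ * ∏ k, hermiteFun (m k.succ) (z k)) (Continuous.aestronglyMeasurable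
        (continuous_norm.mul (continuous_finsetProd _ fun k _ =>
          (continuous_hermiteFun _).comp (by fun_prop))))
    simp only [Function.comp_def] at h2
    rw [h2, integral_norm_mul_prod_hermiteFun fun k => m k.succ]
    have hmul : ((m 0).factorial : ℝ) * (∏ k : Fin d, ((m k.succ).factorial : ℝ)) *
        (Nat.multinomial Finset.univ m : ℝ) = (q.factorial : ℝ) := by
      have := Nat.multinomial_spec Finset.univ m
      rw [(Finset.mem_piAntidiag.1 hm).1, Fin.prod_univ_succ] at this
      exact_mod_cast this
    rw [← hmul, chaosCoeff, betaCoeff]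
    have h3 : √(2 * Real.pi) ≠ 0 := by positivity
    have h4 : ((m 0).factorial : ℝ) ≠ 0 := by positivity
    field_simp
  · refine ⟨d, 1, fun ξ => ?_⟩
    have := h.norm_gradVec_le x ξ
    have hd : (0 : ℝ) ≤ d := by positivity
    simp only [hgrad, abs_norm, pow_one]
    linarith
  · refine fun i => Fin.cases ?_ (fun k => ?_) i
    · simpa [y] using PolyGrowth.const 0
    · simpa [y] using polyGrowth_inner (frameVec v w x k.succ)

theorem integral_zeroMeasure_mul_hermiteFun (h : IsIsotropicFrame v w c)
    (hfin : ∀ᵐ ξ ∂stdGaussian E, μHE[d - 1] {x | x ∈ unitCube d ∧ ⟪v x, ξ⟫ = 0} < ⊤)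
    {u : E} (hu : ‖u‖ = 1) (q : ℕ) :
    ∫ ξ, (μHE[d - 1] {x | x ∈ unitCube d ∧ ⟪v x, ξ⟫ = 0}).toReal * hermiteFun q ⟪u, ξ⟫
        ∂stdGaussian E =
      c * ∫ x in unitCube d, ∑ m ∈ Finset.piAntidiag (Finset.univ : Finset (Fin (d + 1))) q,
        q.factorial * chaosCoeff m * ∏ i, ⟪frameVec v w x i, u⟫ ^ m i := by
  rw [h.integral_zeroMeasure_mul hfin (g := fun ξ => hermiteFun q ⟪u, ξ⟫)
    ((continuous_hermiteFun q).comp (by fun_prop)) ((polyGrowth_inner u).hermiteFun q)]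
  simp only [h.integral_norm_gradVec_mul_hermiteFun _ hu]
  rw [integral_const_mul, mul_comm _ c, mul_assoc, ← mul_assoc _⁻¹,
    inv_mul_cancel₀ (by positivity), one_mul]

end IsIsotropicFrame

end Frame

namespace IsGaussianModel

variable {E : Type*} [NormedAddCommGroup E] [InnerProductSpace ℝ E] [FiniteDimensional ℝ E]
  [MeasurableSpace E] [BorelSpace E] {Ω : Type*} [MeasurableSpace Ω] {d : ℕ} {P : Measure Ω}
  {n : ℕ} {a : (Fin d → ℤ) → Ω → ℂ} {ξ : Ω → E} (h : IsGaussianModel P n a ξ)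
  {v : EuclideanSpace ℝ (Fin d) → E} {w : Fin d → EuclideanSpace ℝ (Fin d) → E} {c : ℝ}

include h

theorem memLp_chaosComponent (hv : IsIsotropicFrame v w c) (q : ℕ) :
    MemLp (fun ω => chaosComponent v w c q (ξ ω)) 2 P :=
  h.memLp_comp ((hv.polyGrowth_chaosComponent q).memLp_two
    (hv.measurable_chaosComponent q).aestronglyMeasurable)

/-- Fubini, with the integrand dominated uniformly in x by |F| times a power of 1 + ‖ξ‖. It serves
both for the membership of the component in its chaos and for its pairing with the test variables.
-/
theorem integral_mul_chaosComponent [IsFiniteMeasure P] (hv : IsIsotropicFrame v w c) (q : ℕ)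
    {F : Ω → ℝ} (hF : MemLp F 2 P) :
    ∫ ω, F ω * chaosComponent v w c q (ξ ω) ∂P =
      c * ∫ x in unitCube d, ∑ m ∈ Finset.piAntidiag (Finset.univ : Finset (Fin (d + 1))) q,
        chaosCoeff m * ∫ ω, F ω * ∏ i, hermiteFun (m i) ⟪frameVec v w x i, ξ ω⟫ ∂P := by
  have hξm : AEMeasurable ξ P := h.hasLaw.aemeasurable
  let f : (Fin (d + 1) → ℕ) → EuclideanSpace ℝ (Fin d) → Ω → ℝ := fun m x ω =>
    F ω * ∏ i, hermiteFun (m i) ⟪frameVec v w x i, ξ ω⟫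
  have hint : ∀ m, Integrable (Function.uncurry (f m))
      ((volume.restrict (unitCube d)).prod P) := by
    intro m
    obtain ⟨C, k, hC⟩ := hv.polyGrowth_prod_hermiteFun m
    have hk : MemLp (fun ω => (1 + ‖ξ ω‖) ^ k) 2 P :=
      h.memLp_of_polyGrowth (g := fun ξ => (1 + ‖ξ‖) ^ k)
        (((PolyGrowth.const 1).add (PolyGrowth.of_abs_le fun ξ => le_rfl)).pow k) (by fun_prop)
    have hdom : Integrable (fun ω => |F ω| * (C * (1 + ‖ξ ω‖) ^ k)) P :=
      hF.abs.integrable_mul (hk.const_mul C)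
    refine (hdom.comp_snd (volume.restrict (unitCube d))).mono' ?_ (ae_of_all _ fun p => ?_)
    · refine hF.1.comp_snd.mul ?_
      have h1 : AEMeasurable (fun p : EuclideanSpace ℝ (Fin d) × Ω => (p.1, ξ p.2))
          ((volume.restrict (unitCube d)).prod P) :=
        measurable_fst.aemeasurable.prodMk hξm.comp_snd
      exact ((hv.continuous_prod_hermiteFun m).measurable.comp_aemeasurable h1).aestronglyMeasurable
    · simp only [Function.uncurry, f, norm_mul, Real.norm_eq_abs]
      have := hC (p.1, ξ p.2)
      rw [abs_norm] at this
      exact mul_le_mul_of_nonneg_left this (abs_nonneg _)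
  have h1 : ∀ ω, F ω * chaosComponent v w c q (ξ ω) =
      ∑ m ∈ Finset.piAntidiag (Finset.univ : Finset (Fin (d + 1))) q, c * (chaosCoeff m *
        ∫ x in unitCube d, f m x ω) := by
    intro ω
    simp only [chaosComponent, Finset.mul_sum, f, integral_const_mul]
    refine Finset.sum_congr rfl fun m _ => ?_
    ring
  have hx : ∀ m, Integrable (fun x => ∫ ω, f m x ω ∂P) (volume.restrict (unitCube d)) := fun m =>
    (hint m).integral_prod_left
  have hω : ∀ m, Integrable (fun ω => ∫ x in unitCube d, f m x ω) P := fun m =>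
    (hint m).integral_prod_right
  simp only [h1]
  rw [integral_finsetSum _ fun m _ => ((hω m).const_mul _).const_mul _,
    integral_finsetSum _ fun m _ => (hx m).const_mul _, Finset.mul_sum]
  refine Finset.sum_congr rfl fun m _ => ?_
  rw [integral_const_mul, integral_const_mul, integral_const_mul,
    integral_integral_swap (hint m)]

/-- A chaos is closed, hence its own double orthogonal. Against a variable orthogonal to it, the
integral over x may be taken last, and for each x the product of Hermite polynomials is already in
the chaos. -/
theorem chaosComponent_mem [IsFiniteMeasure P] (hv : IsIsotropicFrame v w c) (q : ℕ) :
    (h.memLp_chaosComponent hv q).toLp _ ∈ wienerChaos P n a q := by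
  rw [← Submodule.orthogonal_orthogonal (wienerChaos P n a q), Submodule.mem_orthogonal]
  intro F hF
  rw [inner_lp_two_eq_integral]
  have h1 : ∫ ω, F ω * ((h.memLp_chaosComponent hv q).toLp _ : Lp ℝ 2 P) ω ∂P =
      ∫ ω, F ω * chaosComponent v w c q (ξ ω) ∂P := by
    refine integral_congr_ae ?_
    filter_upwards [(h.memLp_chaosComponent hv q).coeFn_toLp] with ω hω
    rw [hω]
  rw [h1, h.integral_mul_chaosComponent hv q (Lp.memLp F)]
  have h2 : ∀ x, ∑ m ∈ Finset.piAntidiag (Finset.univ : Finset (Fin (d + 1))) q,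
      chaosCoeff m * ∫ ω, F ω * ∏ i, hermiteFun (m i) ⟪frameVec v w x i, ξ ω⟫ ∂P = 0 := by
    intro x
    refine Finset.sum_eq_zero fun m hm => ?_
    have h3 := h.prod_hermiteFun_mem (by omega) (hv.orthonormal_frameVec x) m
    rw [(Finset.mem_piAntidiag.1 hm).1] at h3
    have h4 := (Submodule.mem_orthogonal' _ _).1 hF _ h3
    rw [inner_lp_two_eq_integral] at h4
    have h5 : ∫ ω, F ω * ∏ i, hermiteFun (m i) ⟪frameVec v w x i, ξ ω⟫ ∂P = 0 := by
      rw [← h4]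
      refine integral_congr_ae ?_
      filter_upwards [(h.memLp_prod_hermiteFun_inner (frameVec v w x) m).coeFn_toLp] with ω hω
      rw [hω]
    rw [h5, mul_zero]
  simp [h2]

/-- The projections of the nodal volume on the Wiener chaoses. -/
theorem chaosProj_zeroMeasure [IsFiniteMeasure P] (hv : IsIsotropicFrame v w c)
    (hfin : ∀ᵐ ξ ∂stdGaussian E, μHE[d - 1] {x | x ∈ unitCube d ∧ ⟪v x, ξ⟫ = 0} < ⊤)
    {F : Lp ℝ 2 P}
    (hF : F =ᵐ[P] fun ω => (μHE[d - 1] {x | x ∈ unitCube d ∧ ⟪v x, ξ ω⟫ = 0}).toReal) (q : ℕ) :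
    chaosProj P n a q F = (h.memLp_chaosComponent hv q).toLp _ := by
  refine Submodule.eq_starProjection_of_mem_orthogonal (h.chaosComponent_mem hv q) ?_
  refine h.mem_orthogonal_wienerChaos fun u hu => ?_
  have hH := h.memLp_hermiteFun_inner u q
  have h1 : ∫ ω, (F - (h.memLp_chaosComponent hv q).toLp _ : Lp ℝ 2 P) ω *
      hermiteFun q ⟪u, ξ ω⟫ ∂P = ∫ ω, (F ω * hermiteFun q ⟪u, ξ ω⟫ -
        hermiteFun q ⟪u, ξ ω⟫ * chaosComponent v w c q (ξ ω)) ∂P := by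
    refine integral_congr_ae ?_
    filter_upwards [Lp.coeFn_sub F ((h.memLp_chaosComponent hv q).toLp _),
      (h.memLp_chaosComponent hv q).coeFn_toLp] with ω h1 h2
    rw [h1, Pi.sub_apply, h2]
    ring
  have i1 : Integrable (fun ω => F ω * hermiteFun q ⟪u, ξ ω⟫) P := (Lp.memLp F).integrable_mul hH
  have i2 : Integrable (fun ω => hermiteFun q ⟪u, ξ ω⟫ * chaosComponent v w c q (ξ ω)) P :=
    hH.integrable_mul (h.memLp_chaosComponent hv q)
  rw [h1, integral_sub i1 i2, sub_eq_zero,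
    h.integral_mul_chaosComponent hv q hH]
  have h2 : ∫ ω, F ω * hermiteFun q ⟪u, ξ ω⟫ ∂P =
      ∫ ξ, (μHE[d - 1] {x | x ∈ unitCube d ∧ ⟪v x, ξ⟫ = 0}).toReal * hermiteFun q ⟪u, ξ⟫
        ∂stdGaussian E := by
    have hVm := hv.measurable_zeroMeasure (d - 1) (isSigmaCompact_unitCube d)
    rw [← h.hasLaw.integral_comp (f := fun ξ : E =>
      (μHE[d - 1] {x | x ∈ unitCube d ∧ ⟪v x, ξ⟫ = 0}).toReal * hermiteFun q ⟪u, ξ⟫)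
      (hVm.ennreal_toReal.mul ((continuous_hermiteFun q).comp
        (by fun_prop : Continuous fun ξ : E => ⟪u, ξ⟫)).measurable).aestronglyMeasurable]
    refine integral_congr_ae ?_
    filter_upwards [hF] with ω hω
    simp [hω]
  -- Kac–Rice and the candidate component now give the same sum of q!·`chaosCoeff m`·∏ ⟪frame_i,
  -- u⟫^{m_i}, integrated over x.
  rw [h2, hv.integral_zeroMeasure_mul_hermiteFun hfin hu]
  congr 2
  ext x
  refine Finset.sum_congr rfl fun m hm => ?_
  have h3 := h.hasLaw.integral_comp (f := fun ξ : E =>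
    (∏ i, hermiteFun (m i) ⟪frameVec v w x i, ξ⟫) * hermiteFun q ⟪u, ξ⟫)
    (((continuous_finsetProd _ fun i _ => (continuous_hermiteFun (m i)).comp (by fun_prop)).mul
      ((continuous_hermiteFun q).comp (by fun_prop))).aestronglyMeasurable)
  rw [integral_prod_hermiteFun_mul_hermiteFun_inner (hv.orthonormal_frameVec x) hu,
    if_pos (Finset.mem_piAntidiag.1 hm).1] at h3
  simp only [mul_comm (hermiteFun q _)]
  simp only [Function.comp_def] at h3
  rw [h3]
  ring

end IsGaussianModel

end ArithmeticWave

namespace ArithmeticWave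

/-! ### The Hermite coefficients of the norm and of the Dirac mass -/

section Polar

variable {X : Type*} [NormedAddCommGroup X] [NormedSpace ℝ X] [FiniteDimensional ℝ X]
  [MeasurableSpace X] [BorelSpace X] [Nontrivial X] (μ : Measure X) [μ.IsAddHaarMeasure]

theorem integral_homogeneous_mul_norm {g : X → ℝ} {k : ℕ}
    (hg : ∀ (r : ℝ) (z : X), 0 < r → g (r • z) = r ^ k * g z) (φ : ℝ → ℝ) :
    ∫ z, g z * φ ‖z‖ ∂μ = (∫ θ, g (θ : Metric.sphere (0 : X) 1) ∂μ.toSphere) *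
      ∫ r in Set.Ioi (0 : ℝ), r ^ (Module.finrank ℝ X - 1 + k) * φ r := by
  calc ∫ z, g z * φ ‖z‖ ∂μ
      = ∫ z : ({(0)}ᶜ : Set X), g z * φ ‖z.1‖ ∂(μ.comap (↑)) := by
        rw [integral_subtype_comap (measurableSet_singleton _).compl fun z => g z * φ ‖z‖,
          restrict_compl_singleton]
    _ = ∫ p : Metric.sphere (0 : X) 1 × Set.Ioi (0 : ℝ), g p.1 * ((p.2 : ℝ) ^ k * φ p.2)
          ∂μ.toSphere.prod (.volumeIoiPow (Module.finrank ℝ X - 1)) := by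
        rw [← μ.measurePreserving_homeomorphUnitSphereProd.integral_comp
          (Homeomorph.measurableEmbedding _)]
        congr 1
        ext z
        have hz : (z : X) ≠ 0 := z.2
        have h1 : (z : X) = ‖(z : X)‖ • (‖(z : X)‖⁻¹ • (z : X)) := by
          rw [smul_inv_smul₀ (norm_ne_zero_iff.2 hz)]
        have h2 := hg ‖(z : X)‖ (‖(z : X)‖⁻¹ • (z : X)) (norm_pos_iff.2 hz)
        rw [← h1] at h2
        simp only [homeomorphUnitSphereProd_apply_fst_coe, homeomorphUnitSphereProd_apply_snd_coe]
        rw [h2]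
        ring
    _ = (∫ θ, g (θ : Metric.sphere (0 : X) 1) ∂μ.toSphere) *
          ∫ r : Set.Ioi (0 : ℝ), (r : ℝ) ^ k * φ r ∂.volumeIoiPow (Module.finrank ℝ X - 1) :=
        integral_prod_mul (fun θ : Metric.sphere (0 : X) 1 => g θ)
          fun r : Set.Ioi (0 : ℝ) => (r : ℝ) ^ k * φ r
    _ = _ := by
        congr 1
        rw [Measure.volumeIoiPow, integral_withDensity_eq_integral_toReal_smul (by fun_prop)
          (by simp), ← integral_subtype_comap measurableSet_Ioi
            fun r : ℝ => r ^ (Module.finrank ℝ X - 1 + k) * φ r]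
        congr 1
        ext r
        have hr : (0 : ℝ) < r := r.2
        rw [ENNReal.toReal_ofReal (by positivity), smul_eq_mul]
        ring

end Polar

/-- The ratio of Gaussian moments `E‖Z‖^{2i+1} / E‖Z‖^{2i}` in dimension `d`. -/
noncomputable def radialRatio (d i : ℕ) : ℝ :=
  Real.sqrt 2 * Real.Gamma ((d : ℝ) / 2 + i + 1 / 2) / Real.Gamma ((d : ℝ) / 2 + i)

theorem integral_pow_mul_exp_neg_sq_half (k : ℕ) :
    ∫ r in Set.Ioi (0 : ℝ), r ^ k * Real.exp (-r ^ 2 / 2) =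
      2 ^ (((k : ℝ) - 1) / 2) * Real.Gamma (((k : ℝ) + 1) / 2) := by
  have h := integral_rpow_mul_exp_neg_mul_rpow (p := 2) (q := k) (b := 1 / 2) (by norm_num)
    (by have : (0 : ℝ) ≤ k := by positivity
        linarith) (by norm_num)
  have h1 : ∀ r : ℝ, r ^ k * Real.exp (-r ^ 2 / 2) =
      r ^ (k : ℝ) * Real.exp (-(1 / 2) * r ^ (2 : ℝ)) := by
    intro r
    rw [Real.rpow_natCast, Real.rpow_two]
    congr 2
    ring
  simp only [h1]
  rw [h]
  congr 1
  rw [one_div, Real.inv_rpow (by norm_num), ← Real.rpow_neg (by norm_num),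
    ← Real.rpow_neg_one (2 : ℝ), ← Real.rpow_add (by norm_num)]
  congr 1
  ring

/-- In polar coordinates both sides have the same integral over the sphere; what remains is the
quotient of two radial Gamma integrals. -/
theorem integral_norm_mul_homogeneous {d : ℕ} (hd : 1 ≤ d) {g : EuclideanSpace ℝ (Fin d) → ℝ}
    {i : ℕ} (hg : ∀ (r : ℝ) (z), 0 < r → g (r • z) = r ^ (2 * i) * g z) :
    ∫ z, ‖z‖ * g z ∂stdGaussian (EuclideanSpace ℝ (Fin d)) =
      radialRatio d i * ∫ z, g z ∂stdGaussian (EuclideanSpace ℝ (Fin d)) := by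
  have : Nonempty (Fin d) := ⟨⟨0, hd⟩⟩
  rw [integral_stdGaussian_euclideanSpace, integral_stdGaussian_euclideanSpace]
  have h1 : ∀ z : EuclideanSpace ℝ (Fin d), ‖z‖ * g z * Real.exp (-‖z‖ ^ 2 / 2) =
      g z * (fun r : ℝ => r * Real.exp (-r ^ 2 / 2)) ‖z‖ := fun z => by ring
  simp only [h1]
  rw [integral_homogeneous_mul_norm volume hg fun r => r * Real.exp (-r ^ 2 / 2),
    integral_homogeneous_mul_norm volume hg fun r => Real.exp (-r ^ 2 / 2),
    finrank_euclideanSpace_fin]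
  have h2 : ∀ r : ℝ, r ^ (d - 1 + 2 * i) * (r * Real.exp (-r ^ 2 / 2)) =
      r ^ (d + 2 * i) * Real.exp (-r ^ 2 / 2) := by
    intro r
    rw [← mul_assoc, ← pow_succ]
    congr 2
    omega
  simp only [h2]
  rw [integral_pow_mul_exp_neg_sq_half, integral_pow_mul_exp_neg_sq_half, radialRatio]
  have h3 : ((d - 1 + 2 * i : ℕ) : ℝ) = d - 1 + 2 * i := by
    push_cast [Nat.cast_sub hd]; ring
  have h4 : (((d + 2 * i : ℕ) : ℝ) - 1) / 2 = (d - 1 + 2 * i - 1) / 2 + 1 / 2 := by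
    push_cast; ring
  have h5 : (((d + 2 * i : ℕ) : ℝ) + 1) / 2 = (d : ℝ) / 2 + i + 1 / 2 := by push_cast; ring
  have h6 : ((d : ℝ) - 1 + 2 * i + 1) / 2 = (d : ℝ) / 2 + i := by ring
  rw [h3, h4, h5, h6, Real.rpow_add (by norm_num), ← Real.sqrt_eq_rpow]
  have h7 : Real.Gamma ((d : ℝ) / 2 + i) ≠ 0 := by
    have : (1 : ℝ) ≤ d := by exact_mod_cast hd
    exact (Real.Gamma_pos_of_pos (by positivity)).ne'
  field_simp

theorem integral_pow_gaussianReal (j : ℕ) :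
    ∫ y, y ^ (2 * j) ∂gaussianReal 0 1 = ((2 * j).factorial : ℝ) / (2 ^ j * j.factorial) := by
  induction j with
  | zero => simp
  | succ j ih =>
    have hid : PolyGrowth (fun y : ℝ => ‖y‖) fun y => y := PolyGrowth.of_abs_le fun y => by simp
    have h := stein_gaussianReal (g := fun y => y ^ (2 * j + 1))
      (g' := fun y => ((2 * j + 1 : ℕ) : ℝ) * y ^ (2 * j)) (fun y => by
        simpa using hasDerivAt_pow (2 * j + 1) y) (hid.pow _) ((hid.pow _).const_mul _)
      (by fun_prop)
    have h1 : ∀ y : ℝ, y ^ (2 * (j + 1)) = y * y ^ (2 * j + 1) := fun y => by ring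
    simp only [h1]
    rw [h, integral_const_mul, ih, show 2 * (j + 1) = 2 * j + 1 + 1 by ring, Nat.factorial_succ,
      Nat.factorial_succ, Nat.factorial_succ]
    push_cast
    field_simp
    ring

theorem integral_prod_pow_stdGaussian {d : ℕ} (j : Fin d → ℕ) :
    ∫ z : EuclideanSpace ℝ (Fin d), ∏ k, z k ^ (2 * j k) ∂stdGaussian _ =
      ∏ k, ((2 * j k).factorial : ℝ) / (2 ^ j k * (j k).factorial) := by
  rw [← map_pi_eq_stdGaussian, integral_map (by fun_prop)
    (Continuous.aestronglyMeasurable (by fun_prop))]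
  simp only
  rw [integral_fintype_prod_eq_prod (𝕜 := ℝ) fun k (y : ℝ) => y ^ (2 * j k)]
  exact Finset.prod_congr rfl fun k _ => integral_pow_gaussianReal (j k)

theorem integral_norm_mul_prod_pow_stdGaussian {d : ℕ} (hd : 1 ≤ d) (j : Fin d → ℕ) :
    ∫ z : EuclideanSpace ℝ (Fin d), ‖z‖ * ∏ k, z k ^ (2 * j k) ∂stdGaussian _ =
      radialRatio d (∑ k, j k) * ∏ k, ((2 * j k).factorial : ℝ) / (2 ^ j k * (j k).factorial) := by
  rw [← integral_prod_pow_stdGaussian, integral_norm_mul_homogeneous hd]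
  intro r z _
  simp only [PiLp.smul_apply, smul_eq_mul, mul_pow]
  rw [Finset.prod_mul_distrib, Finset.prod_pow_eq_pow_sum, Finset.mul_sum]

theorem scaledHermite_zero (y : ℝ) (q : ℕ) : scaledHermite 0 y q = y ^ q := by
  induction q using Nat.twoStepInduction with
  | zero => simp [scaledHermite]
  | one => simp [scaledHermite]
  | more q _ h1 => rw [scaledHermite, h1]; ring

theorem hermiteFun_odd_zero {q : ℕ} (hq : Odd q) : hermiteFun q 0 = 0 := by
  have := hermiteFun_neg q 0
  rw [neg_zero, hq.neg_one_pow] at this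
  linarith

theorem hermiteFun_even_zero (r : ℕ) :
    hermiteFun (2 * r) 0 = (-1) ^ r * (2 * r).factorial / (2 ^ r * r.factorial) := by
  induction r with
  | zero => simp [hermiteFun_zero]
  | succ r ih =>
    rw [show 2 * (r + 1) = 2 * r + 2 by ring, hermiteFun_add_two, ih,
      show 2 * r + 2 = 2 * r + 1 + 1 by ring, Nat.factorial_succ, Nat.factorial_succ,
      Nat.factorial_succ]
    push_cast
    field_simp
    ring

theorem sum_range_even {f : ℕ → ℝ} (hf : ∀ i, Odd i → f i = 0) (s : ℕ) :
    ∑ i ∈ Finset.range (2 * s + 1), f i = ∑ j ∈ Finset.range (s + 1), f (2 * j) := by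
  induction s with
  | zero => simp
  | succ s ih =>
    rw [show 2 * (s + 1) + 1 = 2 * s + 1 + 1 + 1 by ring, Finset.sum_range_succ,
      Finset.sum_range_succ, ih, hf (2 * s + 1) ⟨s, rfl⟩, Finset.sum_range_succ _ (s + 1)]
    ring_nf

/-- The addition formula with variances 0 + 1 and arguments y + 0: monomials in y come from variance
0, and the coefficients are the values of Hermite polynomials at 0. -/
theorem hermiteFun_two_mul (s : ℕ) (y : ℝ) :
    hermiteFun (2 * s) y / (2 * s).factorial = ∑ j ∈ Finset.range (s + 1),
      (-1) ^ (s - j) / ((s - j).factorial * 2 ^ (s - j)) * (y ^ (2 * j) / (2 * j).factorial) := by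
  have h := scaledHermite_add 0 1 y 0 (2 * s)
  rw [zero_add, add_zero, scaledHermite_one,
    Finset.Nat.sum_antidiagonal_eq_sum_range_succ_mk] at h
  simp only [scaledHermite_zero, scaledHermite_one] at h
  rw [h, sum_range_even, Finset.sum_div]
  · refine Finset.sum_congr rfl fun j hj => ?_
    have hj' : j ≤ s := by simpa [Nat.lt_succ_iff] using hj
    rw [show 2 * s - 2 * j = 2 * (s - j) by omega, hermiteFun_even_zero,
      Nat.cast_choose ℝ (show 2 * j ≤ 2 * s by omega), show 2 * s - 2 * j = 2 * (s - j) by omega]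
    field_simp
  · intro i hi
    rcases le_or_gt i (2 * s) with h1 | h1
    · rw [hermiteFun_odd_zero, mul_zero, mul_zero]
      rw [Nat.odd_iff] at hi ⊢
      omega
    · rw [Nat.choose_eq_zero_of_lt h1]
      simp

theorem polyGrowth_coord {d : ℕ} (k : Fin d) :
    PolyGrowth (fun z : EuclideanSpace ℝ (Fin d) => ‖z‖) fun z => z k :=
  PolyGrowth.of_abs_le fun z => by simpa using PiLp.norm_apply_le z k

theorem normHermiteCoeff_two_mul {d : ℕ} (hd : 1 ≤ d) (s : Fin d → ℕ) :
    normHermiteCoeff (fun k => 2 * s k) =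
      ∑ j ∈ Fintype.piFinset fun k => Finset.range (s k + 1), radialRatio d (∑ k, j k) *
        ∏ k, ((-1) ^ (s k - j k) / ((s k - j k).factorial * 2 ^ (s k - j k)) *
          (1 / (2 ^ j k * (j k).factorial)) : ℝ) := by
  have hne : (∏ k, ((2 * s k).factorial : ℝ)) ≠ 0 :=
    Finset.prod_ne_zero_iff.2 fun k _ => by positivity
  have h1 : normHermiteCoeff (fun k => 2 * s k) = ∫ z : EuclideanSpace ℝ (Fin d),
      ‖z‖ * ∏ k, hermiteFun (2 * s k) (z k) / (2 * s k).factorial ∂stdGaussian _ := by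
    simp only [Finset.prod_div_distrib]
    have := integral_norm_mul_prod_hermiteFun fun k => 2 * s k
    simp only [← mul_div_assoc, integral_div]
    rw [this]
    field_simp
  rw [h1]
  simp only [hermiteFun_two_mul, Finset.prod_univ_sum, Finset.mul_sum]
  have h2 : ∀ (j : Fin d → ℕ) (z : EuclideanSpace ℝ (Fin d)),
      ‖z‖ * ∏ k, ((-1 : ℝ) ^ (s k - j k) / ((s k - j k).factorial * 2 ^ (s k - j k)) *
        (z k ^ (2 * j k) / (2 * j k).factorial)) =
      (∏ k, ((-1 : ℝ) ^ (s k - j k) / ((s k - j k).factorial * 2 ^ (s k - j k)) /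
        (2 * j k).factorial)) * (‖z‖ * ∏ k, z k ^ (2 * j k)) := by
    intro j z
    rw [mul_left_comm, ← Finset.prod_mul_distrib]
    congr 1
    exact Finset.prod_congr rfl fun k _ => by ring
  simp only [h2]
  rw [integral_finsetSum]
  · refine Finset.sum_congr rfl fun j _ => ?_
    rw [integral_const_mul, integral_norm_mul_prod_pow_stdGaussian hd, mul_left_comm,
      ← Finset.prod_mul_distrib]
    congr 1
    refine Finset.prod_congr rfl fun k _ => ?_
    field_simp
  · intro j _
    refine Integrable.const_mul ?_ _
    exact ((PolyGrowth.of_abs_le fun z => le_rfl).mul (PolyGrowth.prod fun k _ =>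
      (polyGrowth_coord k).pow _)).integrable (Continuous.aestronglyMeasurable (by fun_prop))

/-- The series defining `a(2s)` evaluates to the Hermite coefficient of the norm. -/
theorem normCoeff_eq_normHermiteCoeff {d : ℕ} (hd : 1 ≤ d) (s : Fin d → ℕ) :
    normCoeff s = normHermiteCoeff fun k => 2 * s k := by
  classical
  -- The constraint j ≤ s empties all terms with i > ∑ s_k. The finite sum over j ≤ s is then
  -- grouped by i = ∑ j_k.
  rw [normHermiteCoeff_two_mul hd, normCoeff, tsum_eq_sum (s := Finset.range (∑ k, s k + 1))]
  · rw [← Finset.sum_fiberwise_of_maps_to (s := Fintype.piFinset fun k => Finset.range (s k + 1))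
      (t := Finset.range (∑ k, s k + 1)) (g := fun j => ∑ k, j k)]
    · refine Finset.sum_congr rfl fun i _ => ?_
      have hset : (Finset.piAntidiag (Finset.univ : Finset (Fin d)) i).filter
          (fun j => ∀ k, j k ≤ s k) = (Fintype.piFinset fun k => Finset.range (s k + 1)).filter
            fun j => ∑ k, j k = i := by
        ext j
        simp [Finset.mem_piAntidiag, and_comm]
      rw [hset, Finset.mul_sum]
      refine Finset.sum_congr rfl fun j hj => ?_
      obtain rfl := (Finset.mem_filter.1 hj).2
      have hmul : (∏ k, ((j k).factorial : ℝ)) * (Nat.multinomial Finset.univ j : ℝ) =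
          ((∑ k, j k).factorial : ℝ) := by
        exact_mod_cast Nat.multinomial_spec Finset.univ j
      have hne : (∏ k, ((j k).factorial : ℝ)) ≠ 0 :=
        Finset.prod_ne_zero_iff.2 fun k _ => by positivity
      have hne2 : (Nat.multinomial Finset.univ j : ℝ) ≠ 0 := by
        exact_mod_cast (Nat.multinomial_pos _ _).ne'
      rw [← hmul, Finset.prod_mul_distrib]
      simp only [one_div, Finset.prod_inv_distrib, Finset.prod_mul_distrib,
        Finset.prod_pow_eq_pow_sum]
      rw [← one_div ((2 : ℝ)), radialRatio]
      field_simp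
    · intro j hj
      rw [Finset.mem_range, Nat.lt_succ_iff]
      refine Finset.sum_le_sum fun k _ => ?_
      have := Fintype.mem_piFinset.1 hj k
      simpa [Nat.lt_succ_iff] using this
  · intro i hi
    rw [Finset.filter_eq_empty_iff.2, Finset.sum_empty, mul_zero]
    intro j hj hle
    have h1 : ∑ k, j k = i := (Finset.mem_piAntidiag.1 hj).1
    have h2 : ∑ k, j k ≤ ∑ k, s k := Finset.sum_le_sum fun k _ => hle k
    simp only [Finset.mem_range] at hi
    omega

/-- Reflecting the coordinate `k₀` is an isometry that changes the sign of the integrand. -/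
theorem normHermiteCoeff_eq_zero_of_odd {d : ℕ} {m : Fin d → ℕ} {k₀ : Fin d} (hk : Odd (m k₀)) :
    normHermiteCoeff m = 0 := by
  classical
  let L : EuclideanSpace ℝ (Fin d) ≃ₗᵢ[ℝ] EuclideanSpace ℝ (Fin d) :=
    LinearIsometryEquiv.piLpCongrRight 2 fun k =>
      if k = k₀ then LinearIsometryEquiv.neg ℝ else LinearIsometryEquiv.refl ℝ ℝ
  have hL : ∀ z k, L z k = if k = k₀ then -z k else z k := by
    intro z k
    simp only [L, LinearIsometryEquiv.piLpCongrRight_apply]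
    split_ifs <;> simp
  have h1 := L.measurePreserving.integral_comp L.toHomeomorph.measurableEmbedding
    fun z : EuclideanSpace ℝ (Fin d) =>
      ‖z‖ * (∏ k, hermiteFun (m k) (z k)) * Real.exp (-‖z‖ ^ 2 / 2)
  have h2 : ∀ z, ∏ k, hermiteFun (m k) (L z k) = -∏ k, hermiteFun (m k) (z k) := by
    intro z
    rw [← Finset.mul_prod_erase _ _ (Finset.mem_univ k₀),
      ← Finset.mul_prod_erase _ _ (Finset.mem_univ k₀), hL, if_pos rfl, hermiteFun_neg,
      hk.neg_one_pow, neg_one_mul, neg_mul]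
    congr 2
    refine Finset.prod_congr rfl fun k hk' => ?_
    rw [hL, if_neg (Finset.ne_of_mem_erase hk')]
  simp only [h2, L.norm_map, mul_neg, neg_mul, integral_neg] at h1
  have h3 : ∫ z : EuclideanSpace ℝ (Fin d),
      ‖z‖ * (∏ k, hermiteFun (m k) (z k)) * Real.exp (-‖z‖ ^ 2 / 2) = 0 := by linarith
  rw [normHermiteCoeff, h3, mul_zero]

theorem betaCoeff_odd {k : ℕ} (hk : Odd k) : betaCoeff k = 0 := by
  rw [betaCoeff, hermiteFun_odd_zero hk, mul_zero]

theorem chaosCoeff_eq_zero_of_odd {d : ℕ} {m : Fin (d + 1) → ℕ} {i : Fin (d + 1)}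
    (hi : Odd (m i)) : chaosCoeff m = 0 := by
  revert hi
  refine Fin.cases (fun hi => ?_) (fun k hi => ?_) i
  · rw [chaosCoeff, betaCoeff_odd hi, zero_div, zero_mul]
  · rw [chaosCoeff, normHermiteCoeff_eq_zero_of_odd (k₀ := k) hi, mul_zero]

theorem tendsto_average_zero {g : ℝ → ℝ} (hg : Continuous g) :
    Tendsto (fun ε : ℝ => 1 / (2 * ε) * ∫ t in (-ε)..ε, g t) (𝓝[>] 0) (𝓝 (g 0)) := by
  have h1 : HasDerivAt (fun x => ∫ t in (0 : ℝ)..x, g t) (g 0) 0 :=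
    hg.integral_hasStrictDerivAt 0 0 |>.hasDerivAt
  have h2 : HasDerivAt (fun x => ∫ t in (0 : ℝ)..(-x), g t) (-g 0) 0 := by
    have h3 : HasDerivAt (fun x => ∫ t in (0 : ℝ)..x, g t) (g 0) (-0) := by simpa using h1
    exact (h3.comp (0 : ℝ) (hasDerivAt_neg (0 : ℝ))).congr_deriv (by ring)
  have h4 := (h1.sub h2).tendsto_slope_zero_right
  have h5 := h4.const_mul (1 / 2)
  have h6 : (1 / 2 : ℝ) * (g 0 - -g 0) = g 0 := by ring
  rw [h6] at h5
  refine h5.congr fun ε => ?_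
  have hi : ∀ a b : ℝ, IntervalIntegrable g volume a b := fun a b => hg.intervalIntegrable a b
  have h7 : ∫ t in (-ε)..ε, g t = (∫ t in (0 : ℝ)..ε, g t) - ∫ t in (0 : ℝ)..(-ε), g t := by
    rw [intervalIntegral.integral_interval_sub_left (hi _ _) (hi _ _)]
  rw [h7]
  simp
  ring

theorem tendsto_betaCoeff (k : ℕ) :
    Tendsto (fun ε : ℝ => 1 / (2 * ε) * ∫ t in (-ε)..ε, hermiteFun k t *
      (Real.exp (-t ^ 2 / 2) / Real.sqrt (2 * Real.pi))) (𝓝[>] 0) (𝓝 (betaCoeff k)) := by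
  have hc := continuous_hermiteFun k
  have h := tendsto_average_zero (g := fun t => hermiteFun k t *
    (Real.exp (-t ^ 2 / 2) / Real.sqrt (2 * Real.pi))) (by fun_prop)
  have h0 : hermiteFun k 0 * (Real.exp (-0 ^ 2 / 2) / Real.sqrt (2 * Real.pi)) = betaCoeff k := by
    rw [betaCoeff]
    simp
    ring
  rwa [h0] at h

end ArithmeticWave

/-! ### Odd, even and second-order components -/

namespace ArithmeticWave

local notation "⟪" x ", " y "⟫" => inner ℝ x y

section Components

variable {d : ℕ} {E : Type*} [NormedAddCommGroup E] [InnerProductSpace ℝ E]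
  {v : EuclideanSpace ℝ (Fin d) → E} {w : Fin d → EuclideanSpace ℝ (Fin d) → E} {c : ℝ}

theorem chaosComponent_odd (q : ℕ) (ξ : E) : chaosComponent v w c (2 * q + 1) ξ = 0 := by
  rw [chaosComponent, Finset.sum_eq_zero, mul_zero]
  intro m hm
  have h1 := (Finset.mem_piAntidiag.1 hm).1
  have : ∃ i, Odd (m i) := by
    by_contra! hne
    have h2 : Even (∑ i, m i) := Finset.even_sum _ fun i _ => by simpa using hne i
    rw [h1] at h2
    exact (Nat.not_even_iff_odd.2 ⟨q, rfl⟩) h2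
  obtain ⟨i, hi⟩ := this
  rw [chaosCoeff_eq_zero_of_odd hi, zero_mul]

theorem chaosComponent_even (hd : 1 ≤ d) (q : ℕ) (ξ : E) :
    chaosComponent v w c (2 * q) ξ = c * ∑ p ∈ Finset.range (q + 1),
      betaCoeff (2 * q - 2 * p) / ((2 * q - 2 * p).factorial : ℝ) *
        ∑ s ∈ Finset.piAntidiag (Finset.univ : Finset (Fin d)) p, normCoeff s *
          ∫ x in unitCube d, hermiteFun (2 * q - 2 * p) ⟪v x, ξ⟫ *
            ∏ j, hermiteFun (2 * s j) ⟪w j x, ξ⟫ := by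
  classical
  rw [chaosComponent]
  congr 1
  simp only [Finset.mul_sum]
  rw [Finset.sum_sigma']
  symm
  -- The surviving multi-indices have all entries even: p is half the degree carried by the
  -- derivatives, and the rest 2q - 2p falls on the field.
  let e : (Σ _ : ℕ, Fin d → ℕ) → Fin (d + 1) → ℕ := fun t =>
    Fin.cons (2 * q - 2 * t.1) fun k => 2 * t.2 k
  refine Finset.sum_of_injOn e ?_ ?_ ?_ ?_
  · rintro ⟨p, s⟩ hp ⟨p', s'⟩ hp' heq
    simp only [Finset.coe_sigma, Set.mem_sigma_iff, Finset.mem_coe, Finset.mem_range] at hp hp'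
    have h0 := congrFun heq 0
    simp only [e, Fin.cons_zero] at h0
    obtain rfl : p = p' := by omega
    obtain rfl : s = s' := by
      ext k
      have := congrFun heq k.succ
      simpa [e] using this
    rfl
  · rintro ⟨p, s⟩ hp
    simp only [Finset.coe_sigma, Set.mem_sigma_iff, Finset.mem_coe, Finset.mem_range,
      Finset.mem_piAntidiag] at hp ⊢
    refine ⟨?_, by simp⟩
    rw [Fin.sum_univ_succ]
    simp only [Fin.cons_zero, Fin.cons_succ]
    rw [← Finset.mul_sum]
    have h1 : ∑ k, s k = p := hp.2.1
    rw [h1]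
    omega
  · intro m hm hne
    by_cases hodd : ∃ i, Odd (m i)
    · obtain ⟨i, hi⟩ := hodd
      rw [chaosCoeff_eq_zero_of_odd hi, zero_mul]
    · exfalso
      push Not at hodd
      have hsum : ∑ i, m i = 2 * q := (Finset.mem_piAntidiag.1 hm).1
      choose r hr using fun i => (Nat.not_odd_iff_even.1 (hodd i))
      have hr2 : ∀ i, m i = 2 * r i := fun i => by rw [hr i]; ring
      rw [Fin.sum_univ_succ] at hsum
      simp only [hr2] at hsum
      rw [← Finset.mul_sum] at hsum
      refine hne ⟨⟨∑ k : Fin d, r k.succ, fun k => r k.succ⟩, ?_, ?_⟩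
      · simp only [Finset.coe_sigma, Set.mem_sigma_iff, Finset.mem_coe, Finset.mem_range,
          Finset.mem_piAntidiag]
        exact ⟨by omega, by simp⟩
      · ext i
        refine Fin.cases ?_ (fun k => ?_) i
        · simp only [e, Fin.cons_zero, hr2]
          omega
        · simp only [e, Fin.cons_succ, hr2]
  · rintro ⟨p, s⟩ _
    simp only [chaosCoeff, e, Fin.cons_zero, Fin.cons_succ, frameVec, Fin.prod_univ_succ]
    rw [normCoeff_eq_normHermiteCoeff hd, mul_assoc]

theorem radialRatio_one {d : ℕ} (hd : 1 ≤ d) :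
    radialRatio d 1 = ((d : ℝ) + 1) / d * radialRatio d 0 := by
  have h0 : (0 : ℝ) < d := by exact_mod_cast hd
  have h1 : Real.Gamma ((d : ℝ) / 2 + (1 : ℕ) + 1 / 2) =
      ((d : ℝ) / 2 + 1 / 2) * Real.Gamma ((d : ℝ) / 2 + 1 / 2) := by
    rw [← Real.Gamma_add_one (by positivity)]
    congr 1
    push_cast
    ring
  have h2 : Real.Gamma ((d : ℝ) / 2 + (1 : ℕ)) = (d : ℝ) / 2 * Real.Gamma ((d : ℝ) / 2) := by
    rw [← Real.Gamma_add_one (by positivity)]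
    congr 1
    push_cast
    ring
  have h3 : Real.Gamma ((d : ℝ) / 2) ≠ 0 := (Real.Gamma_pos_of_pos (by positivity)).ne'
  rw [radialRatio, radialRatio, h1, h2]
  simp only [Nat.cast_zero, add_zero]
  field_simp

theorem normCoeff_zero {d : ℕ} (hd : 1 ≤ d) : normCoeff (0 : Fin d → ℕ) = radialRatio d 0 := by
  have h := integral_norm_mul_prod_pow_stdGaussian hd (0 : Fin d → ℕ)
  have h1 := integral_norm_mul_prod_hermiteFun (0 : Fin d → ℕ)
  rw [normCoeff_eq_normHermiteCoeff hd]
  simp [hermiteFun_zero] at h h1 ⊢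
  rw [← h, h1]
  rfl

/-- The coefficient is half of E[‖Z‖(Z_k² - 1)], and E[‖Z‖ Z_k²] = (1 + 1/d)·E‖Z‖ by
`radialRatio_one`. -/
theorem normCoeff_single {d : ℕ} (hd : 1 ≤ d) (k : Fin d) :
    normCoeff (Pi.single k 1) = radialRatio d 0 / (2 * d) := by
  have hd0 : (0 : ℝ) < d := by exact_mod_cast hd
  have h0 := integral_norm_mul_prod_pow_stdGaussian hd (0 : Fin d → ℕ)
  have h1 := integral_norm_mul_prod_pow_stdGaussian hd (Pi.single k 1 : Fin d → ℕ)
  have h2 := integral_norm_mul_prod_hermiteFun fun j => 2 * (Pi.single k 1 : Fin d → ℕ) j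
  have hprod : ∀ g : Fin d → ℕ → ℝ, (∀ j, g j 0 = 1) →
      ∏ j, g j ((Pi.single k 1 : Fin d → ℕ) j) = g k 1 := by
    intro g hg
    rw [Finset.prod_eq_single k (fun j _ hj => by rw [Pi.single_eq_of_ne hj, hg])
      (fun h => absurd (Finset.mem_univ k) h), Pi.single_eq_same]
  have hp1 : ∀ z : EuclideanSpace ℝ (Fin d),
      ∏ j, z j ^ (2 * (Pi.single k 1 : Fin d → ℕ) j) = z k ^ 2 := fun z => by
    simpa using hprod (fun j i => z j ^ (2 * i)) (fun j => by simp)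
  have hp2 : ∀ z : EuclideanSpace ℝ (Fin d),
      ∏ j, hermiteFun (2 * (Pi.single k 1 : Fin d → ℕ) j) (z j) = z k ^ 2 - 1 := fun z => by
    rw [hprod (fun j i => hermiteFun (2 * i) (z j)) (fun j => by simp [hermiteFun_zero])]
    rw [mul_one, hermiteFun_add_two, hermiteFun_one, hermiteFun_zero]
    push_cast
    ring
  have hp3 : ∏ j, ((2 * (Pi.single k 1 : Fin d → ℕ) j).factorial : ℝ) = 2 := by
    rw [hprod (fun _ i => ((2 * i).factorial : ℝ)) (fun j => by simp)]
    norm_num [Nat.factorial]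
  have hp4 : ∏ j, (((2 * (Pi.single k 1 : Fin d → ℕ) j).factorial : ℝ) /
      (2 ^ ((Pi.single k 1 : Fin d → ℕ) j) * ((Pi.single k 1 : Fin d → ℕ) j).factorial)) = 1 := by
    rw [hprod (fun _ i => ((2 * i).factorial : ℝ) / (2 ^ i * i.factorial)) (fun j => by simp)]
    norm_num [Nat.factorial]
  simp only [hp1, hp4, Finset.sum_pi_single', Finset.mem_univ, if_true, mul_one] at h1
  simp only [hp2, hp3, mul_sub, mul_one] at h2
  simp only [Pi.zero_apply, mul_zero, pow_zero, Finset.prod_const_one, mul_one,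
    Finset.sum_const_zero, Nat.factorial_zero, Nat.cast_one, div_one] at h0
  have hn : PolyGrowth (fun z : EuclideanSpace ℝ (Fin d) => ‖z‖) fun z => ‖z‖ :=
    PolyGrowth.of_abs_le fun z => le_rfl
  have i1 : Integrable (fun z : EuclideanSpace ℝ (Fin d) => ‖z‖ * z k ^ 2) (stdGaussian _) :=
    (hn.mul ((polyGrowth_coord k).pow 2)).integrable (Continuous.aestronglyMeasurable (by fun_prop))
  have i2 : Integrable (fun z : EuclideanSpace ℝ (Fin d) => ‖z‖) (stdGaussian _) :=
    hn.integrable (Continuous.aestronglyMeasurable (by fun_prop))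
  rw [integral_sub i1 i2, h1, h0, radialRatio_one hd] at h2
  rw [normCoeff_eq_normHermiteCoeff hd]
  have h3 : 2 * normHermiteCoeff (fun j => 2 * (Pi.single k 1 : Fin d → ℕ) j) =
      radialRatio d 0 / d := by
    rw [← h2]
    field_simp
    ring
  rw [eq_div_iff (by positivity)]
  rw [eq_div_iff (by positivity)] at h3
  linarith

theorem betaCoeff_two : betaCoeff 2 = -betaCoeff 0 := by
  rw [betaCoeff, betaCoeff, hermiteFun_add_two, hermiteFun_one, hermiteFun_zero]
  push_cast
  ring

/-- The component of order two vanishes when gradient and field have the same energy. -/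
theorem chaosComponent_two (hd : 1 ≤ d) (ξ : E)
    (hi : IntegrableOn (fun x => ⟪v x, ξ⟫ ^ 2) (unitCube d))
    (hi' : ∀ j, IntegrableOn (fun x => ⟪w j x, ξ⟫ ^ 2) (unitCube d))
    (hen : ∑ j, ∫ x in unitCube d, ⟪w j x, ξ⟫ ^ 2 = d * ∫ x in unitCube d, ⟪v x, ξ⟫ ^ 2) :
    chaosComponent v w c 2 ξ = 0 := by
  have hd0 : (0 : ℝ) < d := by exact_mod_cast hd
  have hH2 : ∀ y, hermiteFun 2 y = y ^ 2 - 1 := fun y => by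
    rw [hermiteFun_add_two, hermiteFun_one, hermiteFun_zero]
    push_cast
    ring
  have hint : ∀ f : EuclideanSpace ℝ (Fin d) → ℝ, IntegrableOn (fun x => f x ^ 2) (unitCube d) →
      ∫ x in unitCube d, hermiteFun 2 (f x) = (∫ x in unitCube d, f x ^ 2) - 1 := by
    intro f hf
    simp only [hH2]
    rw [integral_sub hf (integrable_const _)]
    simp [Measure.real, volume_unitCube]
  have hset : Finset.piAntidiag (Finset.univ : Finset (Fin d)) 1 =
      Finset.univ.image fun k => (Pi.single k 1 : Fin d → ℕ) := by
    ext s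
    simp only [Finset.mem_piAntidiag, Finset.mem_image, Finset.mem_univ, true_and]
    constructor
    · rintro ⟨hs, -⟩
      have hs1 : ∑ i, s i = 1 := hs
      obtain ⟨k, -, hk⟩ := Finset.exists_ne_zero_of_sum_ne_zero (by rw [hs1]; simp :
        ∑ i, s i ≠ 0)
      refine ⟨k, ?_⟩
      rw [← Finset.add_sum_erase _ _ (Finset.mem_univ k)] at hs1
      have hk1 : s k = 1 := by omega
      have hz : ∑ i ∈ Finset.univ.erase k, s i = 0 := by omega
      ext j
      by_cases hj : j = k
      · subst hj; simp [hk1]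
      · rw [Pi.single_eq_of_ne hj]
        exact ((Finset.sum_eq_zero_iff.1 hz) j (Finset.mem_erase.2 ⟨hj, Finset.mem_univ j⟩)).symm
    · rintro ⟨k, rfl⟩
      exact ⟨by simp, by simp⟩
  have h := chaosComponent_even (v := v) (w := w) (c := c) hd 1 ξ
  rw [mul_one] at h
  rw [h, Finset.sum_range_succ, Finset.sum_range_one, hset, Finset.sum_image fun k _ k' _ hk => by
    simpa [Pi.single_apply] using congrFun hk k]
  have hprod : ∀ (k : Fin d) x, ∏ j, hermiteFun (2 * (Pi.single k 1 : Fin d → ℕ) j) ⟪w j x, ξ⟫ =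
      hermiteFun 2 ⟪w k x, ξ⟫ := by
    intro k x
    rw [Finset.prod_eq_single k]
    · simp
    · intro j _ hj
      rw [Pi.single_eq_of_ne hj, mul_zero, hermiteFun_zero]
    · simp
  simp only [hprod, normCoeff_single hd, mul_zero, Nat.sub_zero, mul_one, Nat.sub_self,
    hermiteFun_zero, one_mul, Finset.piAntidiag_zero, Finset.sum_singleton, normCoeff_zero hd,
    Pi.zero_apply, Finset.prod_const_one]
  -- What remains is c·β₀·a(0)/2 times -(∫f² - 1) + (1/d)·∑_k (∫f_k² - 1), which is zero by `hen`.
  rw [hint _ hi, ← Finset.mul_sum, Finset.sum_congr rfl fun k _ => hint _ (hi' k),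
    Finset.sum_sub_distrib, hen, betaCoeff_two]
  simp only [Finset.sum_const, Finset.card_univ, Fintype.card_fin, nsmul_eq_mul, mul_one]
  norm_num [Nat.factorial]
  right
  field_simp
  ring

end Components

/-! ### An almost sure deterministic bound on the zero set -/

namespace IsIsotropicFrame

variable {d : ℕ} {E : Type*} [NormedAddCommGroup E] [InnerProductSpace ℝ E]
  [FiniteDimensional ℝ E] [MeasurableSpace E] [BorelSpace E]
  {v : EuclideanSpace ℝ (Fin d) → E} {w : Fin d → EuclideanSpace ℝ (Fin d) → E} {c : ℝ}

/-- Almost surely every zero in the cube is regular, so the bound for regular zeros covers the whole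
zero set. -/
theorem exists_zeroMeasure_le (h : IsIsotropicFrame v w c) (hd : 1 ≤ d) {M : ℕ}
    (hM : ∀ ξ : E, AxisZerosLE (fun x => ⟪v x, ξ⟫) M) :
    ∃ C : ℝ≥0, ∀ᵐ ξ ∂stdGaussian E, μHE[d - 1] {x | x ∈ unitCube d ∧ ⟪v x, ξ⟫ = 0} ≤ C := by
  obtain ⟨m, rfl⟩ : ∃ m, d = m + 1 := ⟨d - 1, by omega⟩
  refine ⟨(m + 1) * ((4 * m) ^ m * M), ?_⟩
  have hnull := h.measure_singularZeros_eq_zero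
  filter_upwards [measure_eq_zero_iff_ae_notMem.1 hnull] with ξ hξ
  have hsub : {x | x ∈ unitCube (m + 1) ∧ ⟪v x, ξ⟫ = 0} ⊆ {x | x ∈ unitCube (m + 1) ∧
      ⟪v x, ξ⟫ = 0 ∧ fderiv ℝ (fun x => ⟪v x, ξ⟫) x ≠ 0} := by
    rintro x ⟨hx, hx0⟩
    refine ⟨hx, hx0, fun hder => hξ ⟨x, hx, hx0, fun k => ?_⟩⟩
    rw [(h.hasFDerivAt_inner x ξ).fderiv] at hder
    have h1 := DFunLike.congr_fun hder (EuclideanSpace.single k 1)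
    simpa [gradVec, h.pos.ne', EuclideanSpace.inner_single_right] using h1
  refine (measure_mono hsub).trans ?_
  refine (euclideanHausdorffMeasure_regularZeros_le (h.contDiff_inner ξ) (hM ξ)).trans_eq ?_
  push_cast
  ring

end IsIsotropicFrame

end ArithmeticWave

namespace ArithmeticWave

local notation "⟪" x ", " y "⟫" => inner ℝ x y

/-! ### Symmetries of the frequency set -/

section Frequencies

variable {d n : ℕ}

open Classical in
/-- The lexicographically positive frequencies: one out of each antipodal pair. -/
noncomputable def halfFrequencySet (d n : ℕ) : Finset (Fin d → ℤ) :=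
  (frequencySet d n).filter fun l => 0 < toLex l

theorem ne_zero_of_mem_frequencySet (hn : 1 ≤ n) {l : Fin d → ℤ} (hl : l ∈ frequencySet d n) :
    l ≠ 0 := by
  rintro rfl
  rw [mem_frequencySet] at hl
  simp at hl
  omega

theorem mem_halfFrequencySet {l : Fin d → ℤ} :
    l ∈ halfFrequencySet d n ↔ l ∈ frequencySet d n ∧ 0 < toLex l := by
  classical
  rw [halfFrequencySet, Finset.mem_filter]

theorem mem_frequencySet_of_mem_half {l : Fin d → ℤ} (hl : l ∈ halfFrequencySet d n) :
    l ∈ frequencySet d n := (mem_halfFrequencySet.1 hl).1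

theorem neg_notMem_half {l : Fin d → ℤ} (hl : l ∈ halfFrequencySet d n) :
    -l ∉ halfFrequencySet d n := by
  intro h
  have h1 := (mem_halfFrequencySet.1 hl).2
  have h2 := (mem_halfFrequencySet.1 h).2
  rw [toLex_neg] at h2
  exact lt_asymm h1 (neg_pos.1 h2)

theorem mem_half_or_neg_mem_half (hn : 1 ≤ n) {l : Fin d → ℤ} (hl : l ∈ frequencySet d n) :
    l ∈ halfFrequencySet d n ∨ -l ∈ halfFrequencySet d n := by
  have h0 : toLex l ≠ 0 := fun h => ne_zero_of_mem_frequencySet hn hl h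
  rcases lt_or_gt_of_ne h0 with h | h
  · exact Or.inr (mem_halfFrequencySet.2 ⟨neg_mem_frequencySet hl, by
      rw [toLex_neg]; exact neg_pos.2 h⟩)
  · exact Or.inl (mem_halfFrequencySet.2 ⟨hl, h⟩)

theorem sum_frequencySet {M : Type*} [AddCommMonoid M] (hn : 1 ≤ n) (g : (Fin d → ℤ) → M) :
    ∑ l ∈ frequencySet d n, g l = ∑ l : halfFrequencySet d n, (g l + g (-l)) := by
  classical
  rw [← Finset.sum_filter_add_sum_filter_not _ (· ∈ halfFrequencySet d n) g,
    Finset.sum_add_distrib, Finset.sum_coe_sort (halfFrequencySet d n) g,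
    Finset.sum_coe_sort (halfFrequencySet d n) fun l => g (-l)]
  congr 1
  · refine Finset.sum_congr ?_ fun _ _ => rfl
    ext l
    simp only [Finset.mem_filter, and_iff_right_iff_imp]
    exact mem_frequencySet_of_mem_half
  · refine Finset.sum_nbij' (fun l => -l) (fun l => -l) ?_ ?_ (fun l _ => neg_neg l)
      (fun l _ => neg_neg l) (fun l _ => by rw [neg_neg])
    · intro l hl
      obtain ⟨h1, h2⟩ := Finset.mem_filter.1 hl
      exact (mem_half_or_neg_mem_half hn h1).resolve_left h2
    · intro l hl
      exact Finset.mem_filter.2 ⟨neg_mem_frequencySet (mem_frequencySet_of_mem_half hl),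
        neg_notMem_half hl⟩

theorem card_frequencySet (hn : 1 ≤ n) :
    ((frequencySet d n).card : ℝ) = 2 * Fintype.card (halfFrequencySet d n) := by
  have h := sum_frequencySet (d := d) hn fun _ => (1 : ℝ)
  simp only [Finset.sum_const, nsmul_eq_mul, mul_one, Finset.card_univ] at h
  rw [h]
  ring

/-- Changing the sign of the k-th coordinate preserves Λ_n and negates each summand. -/
theorem sum_mul_eq_zero {k j : Fin d} (hkj : k ≠ j) :
    ∑ l ∈ frequencySet d n, ((l k : ℝ) * l j) = 0 := by
  classical
  have h : ∑ l ∈ frequencySet d n, ((l k : ℝ) * l j) =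
      ∑ l ∈ frequencySet d n, -((l k : ℝ) * l j) := by
    have hmem : ∀ l ∈ frequencySet d n, Function.update l k (-l k) ∈ frequencySet d n := by
      intro l hl
      rw [mem_frequencySet] at hl ⊢
      rw [← hl]
      refine Finset.sum_congr rfl fun i _ => ?_
      by_cases hi : i = k
      · subst hi; simp
      · rw [Function.update_of_ne hi]
    refine Finset.sum_nbij' (fun l => Function.update l k (-l k))
      (fun l => Function.update l k (-l k)) hmem hmem ?_ ?_ ?_
    · intro l _; simp
    · intro l _; simp
    · intro l _
      rw [Function.update_self, Function.update_of_ne (Ne.symm hkj)]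
      push_cast
      ring
  rw [Finset.sum_neg_distrib] at h
  linarith

/-- Swapping coordinates shows that the sum does not depend on k, and the d sums add up to n times
the number of frequencies. -/
theorem sum_sq_frequencySet (hd : 1 ≤ d) (k : Fin d) :
    ∑ l ∈ frequencySet d n, ((l k : ℝ) * l k) = n * (frequencySet d n).card / d := by
  classical
  have hsym : ∀ j : Fin d, ∑ l ∈ frequencySet d n, ((l j : ℝ) * l j) =
      ∑ l ∈ frequencySet d n, ((l k : ℝ) * l k) := by
    intro j
    have hmem : ∀ l ∈ frequencySet d n, l ∘ Equiv.swap k j ∈ frequencySet d n := by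
      intro l hl
      rw [mem_frequencySet] at hl ⊢
      rw [← hl]
      exact Equiv.sum_comp (Equiv.swap k j) fun i => l i ^ 2
    refine Finset.sum_nbij' (fun l => l ∘ Equiv.swap k j) (fun l => l ∘ Equiv.swap k j) hmem hmem
      ?_ ?_ ?_
    · intro l _; ext i; simp
    · intro l _; ext i; simp
    · intro l _; simp
  have htot : ∑ j : Fin d, ∑ l ∈ frequencySet d n, ((l j : ℝ) * l j) =
      n * (frequencySet d n).card := by
    rw [Finset.sum_comm]
    have : ∀ l ∈ frequencySet d n, ∑ j, ((l j : ℝ) * l j) = n := by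
      intro l hl
      have h := mem_frequencySet.1 hl
      have h' : ((∑ i, l i ^ 2 : ℤ) : ℝ) = n := by rw [h]; simp
      rw [← h']
      push_cast
      exact Finset.sum_congr rfl fun i _ => by ring
    rw [Finset.sum_congr rfl this]
    simp [mul_comm]
  simp only [hsym, Finset.sum_const, Finset.card_univ, Fintype.card_fin, nsmul_eq_mul] at htot
  have hd0 : (0 : ℝ) < d := by exact_mod_cast hd
  rw [eq_div_iff hd0.ne', ← htot]
  ring

theorem sum_half_mul (hd : 1 ≤ d) (hn : 1 ≤ n) (k j : Fin d) :
    ∑ l : halfFrequencySet d n, ((l.1 k : ℝ) * l.1 j) =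
      if k = j then (n : ℝ) * (frequencySet d n).card / (2 * d) else 0 := by
  have h := sum_frequencySet (d := d) hn fun l => ((l k : ℝ) * l j)
  have h1 : ∀ l : halfFrequencySet d n, ((l.1 k : ℝ) * l.1 j + ((-l.1) k : ℤ) * ((-l.1) j : ℤ)) =
      2 * ((l.1 k : ℝ) * l.1 j) := by
    intro l
    simp only [Pi.neg_apply]
    push_cast
    ring
  simp only [h1, ← Finset.mul_sum] at h
  split_ifs with hkj
  · subst hkj
    rw [sum_sq_frequencySet hd] at h
    have hd0 : (0 : ℝ) < d := by exact_mod_cast hd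
    field_simp at h ⊢
    linarith
  · rw [sum_mul_eq_zero hkj] at h
    linarith

end Frequencies

/-! ### Characters of the torus -/

section Characters

variable {d : ℕ}

/-- The character `e(⟨l, x⟩)` of the torus. -/
noncomputable def torusChar (l : Fin d → ℤ) (x : EuclideanSpace ℝ (Fin d)) : ℂ :=
  Complex.exp (2 * Real.pi * Complex.I * ((∑ i, (l i : ℝ) * x i : ℝ) : ℂ))

theorem torusChar_add (l l' : Fin d → ℤ) (x : EuclideanSpace ℝ (Fin d)) :
    torusChar (l + l') x = torusChar l x * torusChar l' x := by
  rw [torusChar, torusChar, torusChar, ← Complex.exp_add]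
  congr 1
  simp only [Pi.add_apply]
  push_cast
  rw [← mul_add, ← Finset.sum_add_distrib]
  congr 1
  exact Finset.sum_congr rfl fun i _ => by ring

theorem norm_torusChar (l : Fin d → ℤ) (x : EuclideanSpace ℝ (Fin d)) : ‖torusChar l x‖ = 1 := by
  rw [torusChar, show (2 * Real.pi * Complex.I * ((∑ i, (l i : ℝ) * x i : ℝ) : ℂ)) =
    ((2 * Real.pi * ∑ i, (l i : ℝ) * x i : ℝ) : ℂ) * Complex.I by push_cast; ring,
    Complex.norm_exp_ofReal_mul_I]

theorem conj_torusChar (l : Fin d → ℤ) (x : EuclideanSpace ℝ (Fin d)) :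
    starRingEnd ℂ (torusChar l x) = torusChar (-l) x := by
  rw [torusChar, torusChar, ← Complex.exp_conj]
  congr 1
  simp [Complex.conj_ofNat]

theorem contDiff_torusChar (l : Fin d → ℤ) {m : WithTop ℕ∞} : ContDiff ℝ m (torusChar l) := by
  have h1 : ContDiff ℝ m fun x : EuclideanSpace ℝ (Fin d) => ∑ i, (l i : ℝ) * x i :=
    ContDiff.sum fun i _ => contDiff_const.mul (by fun_prop)
  exact ((contDiff_const.mul (Complex.ofRealCLM.contDiff.comp h1))).cexp

theorem fderiv_torusChar_single (l : Fin d → ℤ) (x : EuclideanSpace ℝ (Fin d)) (k : Fin d) :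
    fderiv ℝ (torusChar l) x (EuclideanSpace.single k 1) =
      2 * Real.pi * Complex.I * (l k : ℝ) * torusChar l x := by
  let L : EuclideanSpace ℝ (Fin d) →L[ℝ] ℝ := innerSL ℝ (WithLp.toLp 2 fun i => (l i : ℝ))
  have hL : ∀ y, L y = ∑ i, (l i : ℝ) * y i := by
    intro y
    simp [L, PiLp.inner_apply, mul_comm]
  have hd : HasDerivAt (fun t : ℝ => Complex.exp (2 * Real.pi * Complex.I * (t : ℂ)))
      (Complex.exp (2 * Real.pi * Complex.I * (L x : ℂ)) * (2 * Real.pi * Complex.I)) (L x) := by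
    have h1 : HasDerivAt (fun t : ℝ => (2 * Real.pi * Complex.I * (t : ℂ)))
        (2 * Real.pi * Complex.I) (L x) := by
      simpa using (Complex.ofRealCLM.hasDerivAt (x := L x)).const_mul (2 * Real.pi * Complex.I)
    exact h1.cexp
  have h2 := hd.hasFDerivAt.comp x L.hasFDerivAt
  have h3 : ((fun t : ℝ => Complex.exp (2 * Real.pi * Complex.I * (t : ℂ))) ∘ L) = torusChar l := by
    ext y
    simp only [Function.comp_apply, torusChar, hL]
  rw [h3] at h2
  have h4 : L (EuclideanSpace.single k 1) = l k := by
    simp [hL]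
  rw [h2.fderiv]
  simp only [ContinuousLinearMap.comp_apply, h4, ContinuousLinearMap.toSpanSingleton_apply,
    torusChar, ← hL, Complex.real_smul]
  ring

end Characters

end ArithmeticWave

namespace ArithmeticWave

local notation "⟪" x ", " y "⟫" => inner ℝ x y

/-! ### The isotropic frame of the arithmetic wave -/

section WaveFrame

/-- The space of coefficients indexed by the lexicographically positive frequencies. -/
abbrev CoeffSpace (d n : ℕ) : Type := PiLp 2 fun _ : halfFrequencySet d n => ℂ

variable {d n : ℕ}

/-- The vector representing the evaluation of the wave at `x`. -/
noncomputable def waveVec (n : ℕ) (x : EuclideanSpace ℝ (Fin d)) : CoeffSpace d n :=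
  WithLp.toLp 2 fun l => (√(2 / (frequencySet d n).card) : ℂ) * torusChar (-l.1) x

/-- The multiplication operator representing the normalised derivative in direction `k`. -/
noncomputable def derivMul (n : ℕ) (k : Fin d) : CoeffSpace d n →ₗ[ℝ] CoeffSpace d n where
  toFun u := WithLp.toLp 2 fun l => -Complex.I * ((l.1 k / √((n : ℝ) / d) : ℝ) : ℂ) * u l
  map_add' u u' := by ext l; simp [mul_add]
  map_smul' r u := by
    ext l
    simp only [PiLp.smul_apply, Complex.real_smul, RingHom.id_apply]
    ring

/-- The vector representing the normalised derivative of the wave at `x` in direction `k`. -/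
noncomputable def waveVecDeriv (n : ℕ) (k : Fin d) (x : EuclideanSpace ℝ (Fin d)) :
    CoeffSpace d n :=
  derivMul n k (waveVec n x)

theorem waveVecDeriv_apply (k : Fin d) (x : EuclideanSpace ℝ (Fin d)) (l : halfFrequencySet d n) :
    waveVecDeriv n k x l =
      -Complex.I * ((l.1 k / √((n : ℝ) / d) : ℝ) : ℂ) * waveVec n x l := rfl

theorem normSq_waveVec_apply (x : EuclideanSpace ℝ (Fin d)) (l : halfFrequencySet d n) :
    Complex.normSq (waveVec n x l) = 2 / (frequencySet d n).card := by
  rw [Complex.normSq_eq_norm_sq]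
  simp only [waveVec, norm_mul, norm_torusChar, mul_one, Complex.norm_real, Real.norm_eq_abs,
    sq_abs]
  exact Real.sq_sqrt (by positivity)

theorem contDiff_waveVec : ContDiff ℝ 1 (waveVec n : EuclideanSpace ℝ (Fin d) → _) := by
  rw [contDiff_piLp]
  intro l
  exact contDiff_const.mul (contDiff_torusChar _)

theorem fderiv_waveVec_single (hd : 1 ≤ d) (hn : 1 ≤ n) (x : EuclideanSpace ℝ (Fin d))
    (k : Fin d) : fderiv ℝ (waveVec n) x (EuclideanSpace.single k 1) =
      (2 * Real.pi * √((n : ℝ) / d)) • waveVecDeriv n k x := by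
  have hd0 : (0 : ℝ) < d := by exact_mod_cast hd
  have hn0 : (0 : ℝ) < n := by exact_mod_cast hn
  have hs : (√((n : ℝ) / d) : ℂ) ≠ 0 := by
    exact_mod_cast (Real.sqrt_pos.2 (by positivity)).ne'
  have hv : HasFDerivAt (waveVec n) (fderiv ℝ (waveVec n) x) x :=
    (contDiff_waveVec.differentiable one_ne_zero x).hasFDerivAt
  ext l
  have h1 := (PiLp.hasFDerivAt_apply (𝕜 := ℝ) 2 (waveVec n x) l).comp x hv
  have h2 : HasFDerivAt (fun y => waveVec n y l)
      ((√(2 / (frequencySet d n).card) : ℂ) • fderiv ℝ (torusChar (-l.1)) x) x :=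
    (((contDiff_torusChar (-l.1) (m := 1)).differentiable one_ne_zero x).hasFDerivAt).const_mul _
  have h3 := DFunLike.congr_fun (h1.unique h2) (EuclideanSpace.single k 1)
  simp only [ContinuousLinearMap.comp_apply, PiLp.proj_apply, smul_apply,
    smul_eq_mul, fderiv_torusChar_single] at h3
  rw [h3, PiLp.smul_apply, waveVecDeriv_apply, Complex.real_smul]
  simp only [waveVec, Pi.neg_apply]
  push_cast
  field_simp

theorem inner_waveVec_self (hn : 1 ≤ n) (hS : (frequencySet d n).Nonempty)
    (x : EuclideanSpace ℝ (Fin d)) : ⟪waveVec n x, waveVec n x⟫ = 1 := by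
  have hN : ((frequencySet d n).card : ℝ) ≠ 0 := by
    exact_mod_cast (Finset.card_pos.2 hS).ne'
  rw [PiLp.inner_apply]
  have h1 : ∀ l, ⟪waveVec n x l, waveVec n x l⟫ = 2 / (frequencySet d n).card := by
    intro l
    rw [real_inner_self_eq_norm_sq, ← Complex.normSq_eq_norm_sq, normSq_waveVec_apply]
  simp only [h1, Finset.sum_const, Finset.card_univ, nsmul_eq_mul]
  have := card_frequencySet (d := d) hn
  field_simp
  linarith

/-- In each coordinate the second vector is the first times a purely imaginary number, hence
orthogonal to it for the real inner product of ℂ. -/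
theorem inner_waveVec_waveVecDeriv (x : EuclideanSpace ℝ (Fin d)) (k : Fin d) :
    ⟪waveVec n x, waveVecDeriv n k x⟫ = 0 := by
  rw [PiLp.inner_apply]
  refine Finset.sum_eq_zero fun l _ => ?_
  rw [waveVecDeriv_apply, Complex.inner]
  generalize (l.1 k / √((n : ℝ) / d) : ℝ) = r
  simp [Complex.mul_re, Complex.mul_im]
  ring

theorem inner_waveVecDeriv (hd : 1 ≤ d) (hn : 1 ≤ n) (hS : (frequencySet d n).Nonempty)
    (x : EuclideanSpace ℝ (Fin d)) (k j : Fin d) :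
    ⟪waveVecDeriv n k x, waveVecDeriv n j x⟫ = if k = j then 1 else 0 := by
  have hd0 : (0 : ℝ) < d := by exact_mod_cast hd
  have hn0 : (0 : ℝ) < n := by exact_mod_cast hn
  have hN : ((frequencySet d n).card : ℝ) ≠ 0 := by
    exact_mod_cast (Finset.card_pos.2 hS).ne'
  have hs : √((n : ℝ) / d) ≠ 0 := (Real.sqrt_pos.2 (by positivity)).ne'
  have hs2 : √((n : ℝ) / d) ^ 2 = n / d := Real.sq_sqrt (by positivity)
  rw [PiLp.inner_apply]
  have h1 : ∀ l : halfFrequencySet d n, ⟪waveVecDeriv n k x l, waveVecDeriv n j x l⟫ =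
      2 * d / (n * (frequencySet d n).card) * ((l.1 k : ℝ) * l.1 j) := by
    intro l
    have h2 : ⟪waveVecDeriv n k x l, waveVecDeriv n j x l⟫ =
        (l.1 k / √((n : ℝ) / d)) * (l.1 j / √((n : ℝ) / d)) * Complex.normSq (waveVec n x l) := by
      rw [waveVecDeriv_apply, waveVecDeriv_apply, Complex.inner, Complex.normSq_apply]
      simp [Complex.mul_re, Complex.mul_im, -Complex.ofReal_div, Complex.ofReal_re,
        Complex.ofReal_im]
      ring
    rw [h2, normSq_waveVec_apply, div_mul_div_comm, ← sq, hs2]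
    field_simp
  simp only [h1]
  rw [← Finset.mul_sum, sum_half_mul hd hn]
  split_ifs
  · field_simp
  · rw [mul_zero]

theorem isIsotropicFrame_waveVec (hd : 1 ≤ d) (hn : 1 ≤ n) (hS : (frequencySet d n).Nonempty) :
    IsIsotropicFrame (waveVec n : EuclideanSpace ℝ (Fin d) → CoeffSpace d n)
      (waveVecDeriv n) (2 * Real.pi * √((n : ℝ) / d)) := by
  have hd0 : (0 : ℝ) < d := by exact_mod_cast hd
  have hn0 : (0 : ℝ) < n := by exact_mod_cast hn
  have hc : 0 < 2 * Real.pi * √((n : ℝ) / d) := by positivity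
  set c := 2 * Real.pi * √((n : ℝ) / d) with hcdef
  have hw1 : ∀ k x, ‖(waveVecDeriv n k x : CoeffSpace d n)‖ = 1 := by
    intro k x
    have := inner_waveVecDeriv hd hn hS x k k
    rw [if_pos rfl, real_inner_self_eq_norm_sq] at this
    nlinarith [norm_nonneg (waveVecDeriv n k x : CoeffSpace d n)]
  have hlip : LipschitzWith (d * c).toNNReal
      (waveVec n : EuclideanSpace ℝ (Fin d) → CoeffSpace d n) := by
    refine lipschitzWith_of_nnnorm_fderiv_le (𝕜 := ℝ)
      (contDiff_waveVec.differentiable one_ne_zero) fun x => ?_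
    rw [← NNReal.coe_le_coe, coe_nnnorm, Real.coe_toNNReal _ (by positivity)]
    refine ContinuousLinearMap.opNorm_le_bound _ (by positivity) fun y => ?_
    conv_lhs => rw [euclidean_eq_sum_single y]
    rw [map_sum]
    refine (norm_sum_le _ _).trans ?_
    have : ∀ i ∈ (Finset.univ : Finset (Fin d)),
        ‖fderiv ℝ (waveVec n : EuclideanSpace ℝ (Fin d) → CoeffSpace d n) x
          (y i • EuclideanSpace.single i 1)‖ ≤ c * ‖y‖ := by
      intro i _
      rw [map_smul, fderiv_waveVec_single hd hn, norm_smul, norm_smul, hw1, mul_one, mul_comm,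
        Real.norm_of_nonneg hc.le]
      exact mul_le_mul_of_nonneg_left (PiLp.norm_apply_le y i) hc.le
    refine (Finset.sum_le_sum this).trans_eq ?_
    simp
    ring
  refine ⟨hc, contDiff_waveVec, fun x k => fderiv_waveVec_single hd hn x k, fun x => ?_, ?_⟩
  · rw [orthonormal_iff_ite]
    intro i j
    refine Fin.cases ?_ (fun k => ?_) i <;> refine Fin.cases ?_ (fun k' => ?_) j
    · simpa using inner_waveVec_self hn hS x
    · simpa [(Fin.succ_ne_zero k').symm] using inner_waveVec_waveVecDeriv (n := n) x k'
    · rw [real_inner_comm]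
      simpa [Fin.succ_ne_zero k] using inner_waveVec_waveVecDeriv (n := n) x k
    · simpa using inner_waveVecDeriv hd hn hS x k k'
  · let A : Fin d → CoeffSpace d n →L[ℝ] CoeffSpace d n := fun k =>
      LinearMap.toContinuousLinearMap (derivMul n k)
    have hA : ∀ k, LipschitzWith (‖A k‖₊ * (d * c).toNNReal)
        (waveVecDeriv n k : EuclideanSpace ℝ (Fin d) → CoeffSpace d n) := fun k =>
      (A k).lipschitz.comp hlip
    -- The frame asks for one constant common to all fields; the sum dominates each of them.
    refine ⟨(d * c).toNNReal + ∑ k, ‖A k‖₊ * (d * c).toNNReal,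
      hlip.weaken le_self_add, fun k => (hA k).weaken ?_⟩
    exact (Finset.single_le_sum (f := fun k => ‖A k‖₊ * (d * c).toNNReal)
      (fun i _ => zero_le) (Finset.mem_univ k)).trans le_add_self

theorem conj_waveVec_apply (x : EuclideanSpace ℝ (Fin d)) (l : halfFrequencySet d n) :
    starRingEnd ℂ (waveVec n x l) = (√(2 / (frequencySet d n).card) : ℂ) * torusChar l.1 x := by
  simp only [waveVec, map_mul, conj_torusChar, neg_neg, Complex.conj_ofReal]

theorem inner_waveVec (x : EuclideanSpace ℝ (Fin d)) (ξ : CoeffSpace d n) :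
    ⟪waveVec n x, ξ⟫ =
      √(2 / (frequencySet d n).card) * ∑ l, (torusChar l.1 x * ξ l).re := by
  rw [PiLp.inner_apply, Finset.mul_sum]
  refine Finset.sum_congr rfl fun l _ => ?_
  rw [Complex.inner, conj_waveVec_apply, mul_left_comm, Complex.re_ofReal_mul, mul_comm (ξ l)]

theorem inner_waveVecDeriv_right (k : Fin d) (x : EuclideanSpace ℝ (Fin d)) (ξ : CoeffSpace d n) :
    ⟪waveVecDeriv n k x, ξ⟫ = √(2 / (frequencySet d n).card) *
      ∑ l, (-(l.1 k / √((n : ℝ) / d)) * (torusChar l.1 x * ξ l).im) := by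
  rw [PiLp.inner_apply, Finset.mul_sum]
  refine Finset.sum_congr rfl fun l _ => ?_
  rw [Complex.inner, waveVecDeriv_apply, map_mul, conj_waveVec_apply]
  simp only [map_mul, map_neg, Complex.conj_I, Complex.conj_ofReal, neg_neg]
  rw [show ξ l * (Complex.I * ((l.1 k / √((n : ℝ) / d) : ℝ) : ℂ) *
      ((√(2 / (frequencySet d n).card) : ℝ) * torusChar l.1 x)) =
      ((√(2 / (frequencySet d n).card) * (l.1 k / √((n : ℝ) / d)) : ℝ) : ℂ) *
        (Complex.I * (torusChar l.1 x * ξ l)) by push_cast; ring, Complex.re_ofReal_mul,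
    Complex.I_mul_re]
  ring

end WaveFrame

end ArithmeticWave

namespace ArithmeticWave

local notation "⟪" x ", " y "⟫" => inner ℝ x y

/-! ### The wave as a linear functional of a standard Gaussian vector -/

section WaveModel

variable {Ω : Type*} {d n : ℕ}

/-- The vector of normalised coefficients along the lexicographically positive frequencies. -/
noncomputable def coeffVec (n : ℕ) (a : (Fin d → ℤ) → Ω → ℂ) (ω : Ω) : CoeffSpace d n :=
  WithLp.toLp 2 fun l => (√2 : ℂ) * a l.1 ω

variable [MeasurableSpace Ω] {P : Measure Ω} {a : (Fin d → ℤ) → Ω → ℂ}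

theorem wave_eq_inner (hn : 1 ≤ n) (ha : IsGaussianCoeff P n a) (ω : Ω)
    (x : EuclideanSpace ℝ (Fin d)) :
    wave n a ω x = ⟪waveVec n x, coeffVec n a ω⟫ := by
  have h1 : ∀ l : halfFrequencySet d n, (a l.1 ω * torusChar l.1 x +
      a (-l.1) ω * torusChar (-l.1) x).re = 2 * (torusChar l.1 x * a l.1 ω).re := by
    intro l
    rw [ha.conj_symm l.1 (mem_frequencySet_of_mem_half l.2), ← conj_torusChar, ← map_mul,
      Complex.add_re, Complex.conj_re, mul_comm]
    ring
  have h2 : waveSum n a ω x = ((1 / √((frequencySet d n).card : ℝ) : ℝ) : ℂ) *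
      ∑ l ∈ frequencySet d n, a l ω * torusChar l x := by
    rw [waveSum, Complex.ofReal_div, Complex.ofReal_one]
    rfl
  rw [wave, h2, Complex.re_ofReal_mul, sum_frequencySet hn fun l => a l ω * torusChar l x,
    Complex.re_sum, Finset.sum_congr rfl fun l _ => h1 l, inner_waveVec, ← Finset.mul_sum]
  have h3 : ∀ l : halfFrequencySet d n, (torusChar l.1 x * coeffVec n a ω l).re =
      √2 * (torusChar l.1 x * a l.1 ω).re := by
    intro l
    simp only [coeffVec]
    rw [mul_left_comm, Complex.re_ofReal_mul]
  have h4 : √(2 : ℝ) * √2 = 2 := Real.mul_self_sqrt (by norm_num)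
  rw [Finset.sum_congr rfl fun l _ => h3 l, ← Finset.mul_sum, ← mul_assoc, ← mul_assoc,
    Real.sqrt_div (by norm_num), div_mul_eq_mul_div (√2), h4]
  ring

theorem waveDeriv_eq_inner (hd : 1 ≤ d) (hn : 1 ≤ n) (hS : (frequencySet d n).Nonempty)
    (ha : IsGaussianCoeff P n a) (k : Fin d) (ω : Ω) (x : EuclideanSpace ℝ (Fin d)) :
    waveDeriv n a k ω x = ⟪waveVecDeriv n k x, coeffVec n a ω⟫ := by
  have hf := isIsotropicFrame_waveVec hd hn hS
  have h1 : wave n a ω = fun x => ⟪waveVec n x, coeffVec n a ω⟫ := funext fun x =>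
    wave_eq_inner hn ha ω x
  rw [waveDeriv, h1, (hf.hasFDerivAt_inner x _).fderiv]
  simp only [smul_apply, innerSL_apply_apply, EuclideanSpace.inner_single_right, gradVec,
    smul_eq_mul]
  rw [mul_div_assoc, mul_comm, div_mul_cancel₀ _ hf.pos.ne']
  simp

theorem aemeasurable_coeff (ha : IsGaussianCoeff P n a) {l : Fin d → ℤ}
    (hl : l ∈ frequencySet d n) : AEMeasurable (a l) P := by
  have h1 : a l = fun ω => (((a l ω).re : ℝ) : ℂ) + ((a l ω).im : ℝ) * Complex.I := by
    ext ω
    exact (Complex.re_add_im _).symm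
  rw [h1]
  have h2 := (ha.law_re l hl).aemeasurable
  have h3 := (ha.law_im l hl).aemeasurable
  exact (Complex.measurable_ofReal.comp_aemeasurable h2).add
    ((Complex.measurable_ofReal.comp_aemeasurable h3).mul_const _)

/-- The factor √2 brings the variance of real and imaginary parts from 1/2 to 1; by their
independence the characteristic function factors. -/
theorem hasLaw_sqrt_two_mul_coeff [IsProbabilityMeasure P] (ha : IsGaussianCoeff P n a)
    {l : Fin d → ℤ} (hl : l ∈ frequencySet d n) :
    HasLaw (fun ω => (√2 : ℂ) * a l ω) (stdGaussian ℂ) P := by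
  have hm : AEMeasurable (fun ω => (√2 : ℂ) * a l ω) P := (aemeasurable_coeff ha hl).const_mul _
  refine ⟨hm, ?_⟩
  have : IsProbabilityMeasure (P.map fun ω => (√2 : ℂ) * a l ω) := Measure.isProbabilityMeasure_map hm
  refine Measure.ext_of_charFun (funext fun t => ?_)
  rw [charFun_stdGaussian, charFun_apply,
    integral_map hm (Measurable.aestronglyMeasurable (by fun_prop))]
  have h1 : ∀ ω, Complex.exp (⟪(√2 : ℂ) * a l ω, t⟫ * Complex.I) =
      Complex.exp (((√2 * t.re : ℝ) : ℂ) * ((a l ω).re : ℂ) * Complex.I) *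
        Complex.exp (((√2 * t.im : ℝ) : ℂ) * ((a l ω).im : ℂ) * Complex.I) := by
    intro ω
    rw [← Complex.exp_add, ← add_mul]
    congr 2
    rw [Complex.inner, map_mul, Complex.conj_ofReal, ← Complex.ofReal_mul, ← Complex.ofReal_mul,
      ← Complex.ofReal_add]
    congr 1
    simp [Complex.mul_re, Complex.mul_im]
    ring
  simp only [h1]
  have hchar : ∀ s : ℝ, ∀ X : Ω → ℝ, HasLaw X (gaussianReal 0 (1 / 2)) P →
      ∫ ω, Complex.exp (((√2 * s : ℝ) : ℂ) * (X ω : ℂ) * Complex.I) ∂P =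
        Complex.exp (-(s : ℂ) ^ 2 / 2) := by
    intro s X hX
    have h2 := hX.integral_comp
      (f := fun y : ℝ => Complex.exp (((√2 * s : ℝ) : ℂ) * (y : ℂ) * Complex.I))
      (Continuous.aestronglyMeasurable (by fun_prop))
    simp only [Function.comp_def] at h2
    rw [h2, ← charFun_apply_real, charFun_gaussianReal]
    congr 1
    have h3 : ((√2 : ℝ) : ℂ) ^ 2 = 2 := by
      rw [← Complex.ofReal_pow, Real.sq_sqrt (by norm_num)]
      simp
    push_cast
    rw [mul_pow, h3]
    ring
  rw [(ha.indep_re_im l hl).integral_fun_comp_mul_comp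
    (f := fun y : ℝ => Complex.exp (((√2 * t.re : ℝ) : ℂ) * (y : ℂ) * Complex.I))
    (g := fun y : ℝ => Complex.exp (((√2 * t.im : ℝ) : ℂ) * (y : ℂ) * Complex.I))
    (ha.law_re l hl).aemeasurable (ha.law_im l hl).aemeasurable
    (Continuous.aestronglyMeasurable (by fun_prop))
    (Continuous.aestronglyMeasurable (by fun_prop)), hchar _ _ (ha.law_re l hl),
    hchar _ _ (ha.law_im l hl), ← Complex.exp_add]
  congr 1
  have h4 : ‖t‖ ^ 2 = t.re ^ 2 + t.im ^ 2 := by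
    rw [← Complex.normSq_eq_norm_sq, Complex.normSq_apply]; ring
  have h5 : (‖t‖ : ℂ) ^ 2 = (t.re : ℂ) ^ 2 + (t.im : ℂ) ^ 2 := by exact_mod_cast h4
  rw [h5]
  ring

theorem map_toLp_pi_stdGaussian {ι : Type*} [Fintype ι] :
    (Measure.pi fun _ : ι => stdGaussian ℂ).map (WithLp.toLp 2) =
      stdGaussian (PiLp 2 fun _ : ι => ℂ) := by
  have : IsProbabilityMeasure ((Measure.pi fun _ : ι => stdGaussian ℂ).map (WithLp.toLp 2)) :=
    Measure.isProbabilityMeasure_map (by fun_prop)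
  refine Measure.ext_of_charFun (E := PiLp 2 fun _ : ι => ℂ) (funext fun t => ?_)
  rw [charFun_pi, charFun_stdGaussian]
  simp only [charFun_stdGaussian]
  rw [← Complex.exp_sum]
  congr 1
  have h := PiLp.norm_sq_eq_of_L2 (fun _ : ι => ℂ) t
  rw [← Complex.ofReal_pow, h, ← Finset.sum_div, Finset.sum_neg_distrib]
  push_cast
  rfl

theorem hasLaw_coeffVec [IsProbabilityMeasure P] (ha : IsGaussianCoeff P n a) :
    HasLaw (coeffVec n a) (stdGaussian (CoeffSpace d n)) P := by
  have hind : iIndepFun (fun (l : halfFrequencySet d n) ω => (√2 : ℂ) * a l ω) P :=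
    (ha.indep (halfFrequencySet d n) (fun l hl => mem_frequencySet_of_mem_half hl)
      fun l hl => neg_notMem_half hl).comp (fun _ z => (√2 : ℂ) * z) fun _ => by fun_prop
  have h1 := iIndepFun.hasLaw_pi (fun l : halfFrequencySet d n =>
    hasLaw_sqrt_two_mul_coeff ha (mem_frequencySet_of_mem_half l.2)) hind
  have h2 : HasLaw (WithLp.toLp 2 : (halfFrequencySet d n → ℂ) → CoeffSpace d n)
      (stdGaussian (CoeffSpace d n)) (Measure.pi fun _ => stdGaussian ℂ) :=
    ⟨by fun_prop, map_toLp_pi_stdGaussian⟩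
  exact h2.comp h1

omit [MeasurableSpace Ω] in
theorem inner_single_coeffVec [DecidableEq (halfFrequencySet d n)] (l : halfFrequencySet d n)
    (z : ℂ) (ω : Ω) :
    ⟪(WithLp.toLp 2 (Pi.single l z) : CoeffSpace d n), coeffVec n a ω⟫ =
      √2 * (starRingEnd ℂ z * a l.1 ω).re := by
  rw [PiLp.inner_apply, Finset.sum_eq_single l]
  · simp only [coeffVec, Pi.single_eq_same]
    rw [Complex.inner, mul_assoc, Complex.re_ofReal_mul, mul_comm (a l.1 ω)]
  · intro l' _ hl'
    simp [Pi.single_eq_of_ne hl']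
  · simp

theorem memLp_inner_coeffVec [IsProbabilityMeasure P] (ha : IsGaussianCoeff P n a)
    (u : CoeffSpace d n) : MemLp (fun ω => ⟪u, coeffVec n a ω⟫) 2 P := by
  have h := (polyGrowth_inner u).memLp_two (μ := stdGaussian (CoeffSpace d n))
    (Continuous.aestronglyMeasurable (by fun_prop))
  rw [← (hasLaw_coeffVec ha).map_eq] at h
  exact h.comp_of_map (hasLaw_coeffVec ha).aemeasurable

/-- The Gaussian space as the image of the coefficient space. -/
noncomputable def coeffEval [IsProbabilityMeasure P] (ha : IsGaussianCoeff P n a) :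
    CoeffSpace d n →ₗ[ℝ] Lp ℝ 2 P where
  toFun u := (memLp_inner_coeffVec ha u).toLp _
  map_add' u u' := by
    rw [← MemLp.toLp_add]
    congr 1
    ext ω
    simp [inner_add_left]
  map_smul' r u := by
    rw [RingHom.id_apply, ← MemLp.toLp_const_smul]
    congr 1
    ext ω
    simp [real_inner_smul_left]

/-- The coefficient space is finite-dimensional, so the range is closed and taking the closure adds
nothing. The vectors supported on a single frequency give the generators z·a_λ plus its conjugate.
-/
theorem gaussianSpace_eq_range [IsProbabilityMeasure P] (hn : 1 ≤ n)
    (ha : IsGaussianCoeff P n a) : gaussianSpace P n a = LinearMap.range (coeffEval ha) := by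
  classical
  have hre : ∀ l ∈ frequencySet d n, ∀ (z : ℂ) ω,
      z * a l ω + starRingEnd ℂ z * a (-l) ω = ((2 * (z * a l ω).re : ℝ) : ℂ) := by
    intro l hl z ω
    rw [ha.conj_symm l hl, ← map_mul, Complex.add_conj]
  have h2 : √2 * √2 = 2 := Real.mul_self_sqrt (by norm_num)
  refine le_antisymm ?_ ?_
  · have hfd : FiniteDimensional ℝ (LinearMap.range (coeffEval ha)) := inferInstance
    refine Submodule.topologicalClosure_minimal _ (Submodule.span_le.2 ?_)
      (Submodule.closed_of_finiteDimensional _)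
    rintro F ⟨l, hl, z, hF⟩
    have key : ∃ u : CoeffSpace d n, ∀ ω, ⟪u, coeffVec n a ω⟫ = 2 * (z * a l ω).re := by
      rcases mem_half_or_neg_mem_half hn hl with h | h
      · refine ⟨WithLp.toLp 2 (Pi.single ⟨l, h⟩ ((√2 : ℂ) * starRingEnd ℂ z)), fun ω => ?_⟩
        rw [inner_single_coeffVec, map_mul, Complex.conj_ofReal, Complex.conj_conj, mul_assoc,
          Complex.re_ofReal_mul, ← mul_assoc, h2]
      · refine ⟨WithLp.toLp 2 (Pi.single ⟨-l, h⟩ ((√2 : ℂ) * z)), fun ω => ?_⟩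
        rw [inner_single_coeffVec, map_mul, Complex.conj_ofReal, mul_assoc,
          Complex.re_ofReal_mul, ← mul_assoc, h2]
        simp only
        rw [ha.conj_symm l hl, ← map_mul, Complex.conj_re]
    obtain ⟨u, hu⟩ := key
    refine ⟨u, Lp.ext ?_⟩
    filter_upwards [hF, (memLp_inner_coeffVec ha u).coeFn_toLp] with ω h1 h3
    have h4 : (coeffEval ha u : Lp ℝ 2 P) ω = ⟪u, coeffVec n a ω⟫ := h3
    rw [h4, hu]
    rw [hre l hl] at h1
    exact_mod_cast h1.symm
  · rintro F ⟨u, rfl⟩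
    refine Submodule.le_topologicalClosure _ ?_
    have hu : u = ∑ l, (WithLp.toLp 2 (Pi.single l (u l)) : CoeffSpace d n) := by
      ext l
      simp [WithLp.ofLp_sum, Finset.sum_apply, Pi.single_apply]
    rw [hu, map_sum]
    refine Submodule.sum_mem _ fun l _ => Submodule.subset_span ?_
    refine ⟨l.1, mem_frequencySet_of_mem_half l.2, (((√2 / 2 : ℝ)) : ℂ) * starRingEnd ℂ (u l), ?_⟩
    filter_upwards [(memLp_inner_coeffVec ha (WithLp.toLp 2 (Pi.single l (u l)))).coeFn_toLp]
      with ω h3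
    rw [hre l.1 (mem_frequencySet_of_mem_half l.2)]
    have h4 : (coeffEval ha (WithLp.toLp 2 (Pi.single l (u l))) : Lp ℝ 2 P) ω =
      ⟪(WithLp.toLp 2 (Pi.single l (u l)) : CoeffSpace d n), coeffVec n a ω⟫ := h3
    rw [h4, inner_single_coeffVec, mul_assoc, Complex.re_ofReal_mul]
    congr 1
    ring

theorem isGaussianModel_coeffVec [IsProbabilityMeasure P] (hn : 1 ≤ n)
    (ha : IsGaussianCoeff P n a) : IsGaussianModel P n a (coeffVec n a) := by
  refine ⟨hasLaw_coeffVec ha, fun F => ?_⟩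
  rw [gaussianSpace_eq_range hn ha]
  constructor
  · rintro ⟨u, rfl⟩
    exact ⟨u, (memLp_inner_coeffVec ha u).coeFn_toLp⟩
  · rintro ⟨u, hu⟩
    refine ⟨u, Lp.ext ?_⟩
    filter_upwards [hu, (memLp_inner_coeffVec ha u).coeFn_toLp] with ω h1 h2
    rw [h1]
    exact h2

end WaveModel

end ArithmeticWave

namespace ArithmeticWave

local notation "⟪" x ", " y "⟫" => inner ℝ x y

/-! ### Orthogonality of characters and Green's identity -/

section CubeIntegrals

variable {d n : ℕ}

theorem integrableOn_unitCube {F : Type*} [NormedAddCommGroup F]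
    {f : EuclideanSpace ℝ (Fin d) → F} (hf : Continuous f) :
    IntegrableOn f (unitCube d) := by
  refine (hf.continuousOn.integrableOn_compact
    (isCompact_closedBall (0 : EuclideanSpace ℝ (Fin d)) d)).mono_set fun x hx => ?_
  rw [mem_closedBall_zero_iff]
  refine (euclidean_norm_le_sum x).trans ?_
  calc ∑ i, |x i| ≤ ∑ _i : Fin d, (1 : ℝ) := Finset.sum_le_sum fun i _ => by
        rw [abs_of_nonneg (hx i).1]
        exact (hx i).2.le
    _ = d := by simp

theorem integral_unitCube_torusChar {l : Fin d → ℤ} (hl : l ≠ 0) :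
    ∫ x in unitCube d, torusChar l x = 0 := by
  obtain ⟨k, hk⟩ := Function.ne_iff.1 hl
  have hcube : unitCube d = (MeasurableEquiv.toLp 2 (Fin d → ℝ)).symm ⁻¹'
      (Set.univ.pi fun _ => Set.Ico (0 : ℝ) 1) := by
    ext x; simp [unitCube]
  have hmp := EuclideanSpace.volume_preserving_symm_measurableEquiv_toLp (Fin d)
  let g : (Fin d → ℝ) → ℂ := fun y =>
    ∏ i, Complex.exp (2 * Real.pi * Complex.I * (l i : ℂ) * (y i : ℂ))
  have hprod : ∀ x : EuclideanSpace ℝ (Fin d), torusChar l x =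
      g ((MeasurableEquiv.toLp 2 (Fin d → ℝ)).symm x) := by
    intro x
    simp only [torusChar, g]
    rw [← Complex.exp_sum]
    congr 1
    push_cast
    rw [Finset.mul_sum]
    exact Finset.sum_congr rfl fun i _ => by
      simp only [MeasurableEquiv.toLp_symm_apply]
      ring
  rw [setIntegral_congr_fun (measurableSet_unitCube d) fun x _ => hprod x, hcube]
  refine (hmp.setIntegral_preimage_emb (MeasurableEquiv.measurableEmbedding _) g _).trans ?_
  rw [volume_pi, Measure.restrict_pi_pi, integral_fintype_prod_eq_prod
      (f := fun i (y : ℝ) => Complex.exp (2 * Real.pi * Complex.I * (l i : ℂ) * (y : ℂ)))]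
  refine Finset.prod_eq_zero (Finset.mem_univ k) ?_
  rw [integral_Ico_eq_integral_Ioc, ← intervalIntegral.integral_of_le zero_le_one,
    integral_exp_mul_complex (by
      simpa [Real.pi_ne_zero] using hk)]
  have h1 : Complex.exp (2 * Real.pi * Complex.I * (l k : ℂ)) = 1 := by
    rw [mul_comm]
    exact Complex.exp_int_mul_two_pi_mul_I (l k)
  simp [h1]

theorem integral_re_torusChar_mul {l : Fin d → ℤ} (hl : l ≠ 0) (z : ℂ) :
    ∫ x in unitCube d, (torusChar l x * z).re = 0 := by
  have hc : Continuous (torusChar l) := (contDiff_torusChar l (m := 0)).continuous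
  have hi : IntegrableOn (fun x => torusChar l x * z) (unitCube d) :=
    integrableOn_unitCube (hc.mul continuous_const)
  have h := integral_re (𝕜 := ℂ) hi
  rw [integral_mul_const, integral_unitCube_torusChar hl] at h
  simpa using h

/-- Product-to-sum: the two products are half the difference-frequency term plus or minus half the
sum-frequency term, and the latter integrates to zero. -/
theorem integral_torusChar_mul_pair {l l' : Fin d → ℤ} (hl : l + l' ≠ 0) (z z' : ℂ) :
    ∫ x in unitCube d, (torusChar l x * z).im * (torusChar l' x * z').im =
        ∫ x in unitCube d, (torusChar l x * z).re * (torusChar l' x * z').re ∧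
      (l ≠ l' → ∫ x in unitCube d, (torusChar l x * z).re * (torusChar l' x * z').re = 0) := by
  have hcont : ∀ (m : Fin d → ℤ) (w : ℂ), Continuous fun x => (torusChar m x * w).re :=
    fun m w => Complex.continuous_re.comp
      (((contDiff_torusChar m (m := 0)).continuous).mul continuous_const)
  have hsum : ∀ x, torusChar (l + l') x * (z * z') = torusChar l x * z * (torusChar l' x * z') :=
    fun x => by rw [torusChar_add]; ring
  have hdiff : ∀ x, torusChar (l + -l') x * (z * starRingEnd ℂ z') =
      torusChar l x * z * starRingEnd ℂ (torusChar l' x * z') := fun x => by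
    rw [torusChar_add, map_mul, conj_torusChar]; ring
  have hre : ∀ x, (torusChar l x * z).re * (torusChar l' x * z').re =
      1 / 2 * (torusChar (l + -l') x * (z * starRingEnd ℂ z')).re +
        1 / 2 * (torusChar (l + l') x * (z * z')).re := fun x => by
    rw [hsum, hdiff, Complex.mul_re (_ * z) (_ * z'), Complex.mul_re (_ * z) (starRingEnd ℂ _),
      Complex.conj_re, Complex.conj_im]
    ring
  have him : ∀ x, (torusChar l x * z).im * (torusChar l' x * z').im =
      1 / 2 * (torusChar (l + -l') x * (z * starRingEnd ℂ z')).re -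
        1 / 2 * (torusChar (l + l') x * (z * z')).re := fun x => by
    rw [hsum, hdiff, Complex.mul_re (_ * z) (_ * z'), Complex.mul_re (_ * z) (starRingEnd ℂ _),
      Complex.conj_re, Complex.conj_im]
    ring
  have hi1 := (integrableOn_unitCube (hcont (l + -l') (z * starRingEnd ℂ z'))).const_mul (1 / 2)
  have hi2 := (integrableOn_unitCube (hcont (l + l') (z * z'))).const_mul (1 / 2)
  simp only [hre, him]
  rw [integral_sub hi1 hi2, integral_add hi1 hi2, integral_const_mul, integral_const_mul,
    integral_re_torusChar_mul hl]
  refine ⟨by ring, fun hne => ?_⟩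
  rw [integral_re_torusChar_mul (fun h => hne (by rwa [← sub_eq_add_neg, sub_eq_zero] at h))]
  ring

theorem continuous_inner_waveVec (ξ : CoeffSpace d n) :
    Continuous fun x => ⟪waveVec n x, ξ⟫ :=
  (contDiff_waveVec.continuous).inner continuous_const

theorem continuous_inner_waveVecDeriv (k : Fin d) (ξ : CoeffSpace d n) :
    Continuous fun x => ⟪waveVecDeriv n k x, ξ⟫ := by
  simp only [inner_waveVecDeriv_right]
  refine continuous_const.mul (continuous_finsetSum _ fun l _ => continuous_const.mul ?_)
  exact Complex.continuous_im.comp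
    (((contDiff_torusChar l.1 (m := 0)).continuous).mul continuous_const)

theorem sum_mul_eq_of_mem_frequencySet {l : Fin d → ℤ} (hl : l ∈ frequencySet d n) :
    ∑ k, (l k : ℝ) * l k = n := by
  have h := mem_frequencySet.1 hl
  have h' : ((∑ i, l i ^ 2 : ℤ) : ℝ) = n := by rw [h]; simp
  rw [← h']
  push_cast
  exact Finset.sum_congr rfl fun i _ => by ring

/-- Green's identity for Laplace eigenfunctions on the torus. -/
theorem sum_integral_inner_waveVecDeriv_sq (hd : 1 ≤ d) (hn : 1 ≤ n) (ξ : CoeffSpace d n) :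
    ∑ k, ∫ x in unitCube d, ⟪waveVecDeriv n k x, ξ⟫ ^ 2 =
      d * ∫ x in unitCube d, ⟪waveVec n x, ξ⟫ ^ 2 := by
  classical
  have hd0 : (0 : ℝ) < d := by exact_mod_cast hd
  have hn0 : (0 : ℝ) < n := by exact_mod_cast hn
  obtain ⟨s, hs⟩ : ∃ s, s = √(2 / (frequencySet d n).card : ℝ) := ⟨_, rfl⟩
  have hcre : ∀ l : halfFrequencySet d n, Continuous fun x => (torusChar l.1 x * ξ l).re :=
    fun l => Complex.continuous_re.comp
      (((contDiff_torusChar l.1 (m := 0)).continuous).mul continuous_const)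
  have hcim : ∀ l : halfFrequencySet d n, Continuous fun x => (torusChar l.1 x * ξ l).im :=
    fun l => Complex.continuous_im.comp
      (((contDiff_torusChar l.1 (m := 0)).continuous).mul continuous_const)
  have hire : ∀ (l l' : halfFrequencySet d n) (r : ℝ), IntegrableOn (fun x => r *
      ((torusChar l.1 x * ξ l).re * (torusChar l'.1 x * ξ l').re)) (unitCube d) :=
    fun l l' r => (integrableOn_unitCube ((hcre l).mul (hcre l'))).const_mul r
  have hiim : ∀ (l l' : halfFrequencySet d n) (r : ℝ), IntegrableOn (fun x => r *
      ((torusChar l.1 x * ξ l).im * (torusChar l'.1 x * ξ l').im)) (unitCube d) :=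
    fun l l' r => (integrableOn_unitCube ((hcim l).mul (hcim l'))).const_mul r
  -- Two lexicographically positive frequencies are never antipodal, so only diagonal terms of the
  -- double sums survive.
  have hadd : ∀ l l' : halfFrequencySet d n, l.1 + l'.1 ≠ 0 := fun l l' h =>
    neg_notMem_half l.2 (by rw [neg_eq_of_add_eq_zero_right h]; exact l'.2)
  have hpair := fun l l' : halfFrequencySet d n =>
    integral_torusChar_mul_pair (hadd l l') (ξ l) (ξ l')
  have hzero : ∀ l l' : halfFrequencySet d n, l' ≠ l →
      ∫ x in unitCube d, (torusChar l.1 x * ξ l).re * (torusChar l'.1 x * ξ l').re = 0 :=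
    fun l l' h => (hpair l l').2 fun h' => h (Subtype.ext h'.symm)
  have hV : ∫ x in unitCube d, ⟪waveVec n x, ξ⟫ ^ 2 =
      ∑ l, s ^ 2 * ∫ x in unitCube d, (torusChar l.1 x * ξ l).re * (torusChar l.1 x * ξ l).re := by
    have h1 : ∀ x, ⟪waveVec n x, ξ⟫ ^ 2 = ∑ l, ∑ l',
        s ^ 2 * ((torusChar l.1 x * ξ l).re * (torusChar l'.1 x * ξ l').re) := by
      intro x
      rw [inner_waveVec, ← hs, mul_pow, sq (∑ l, _), Finset.sum_mul_sum, Finset.mul_sum]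
      simp only [Finset.mul_sum]
    simp only [h1]
    rw [integral_finsetSum _ fun l _ => integrable_finsetSum _ fun l' _ => hire l l' _]
    refine Finset.sum_congr rfl fun l _ => ?_
    rw [integral_finsetSum _ fun l' _ => hire l l' _,
      Finset.sum_eq_single l _ (by simp), integral_const_mul]
    intro l' _ h
    rw [integral_const_mul, hzero l l' h, mul_zero]
  have hW : ∀ k, ∫ x in unitCube d, ⟪waveVecDeriv n k x, ξ⟫ ^ 2 =
      ∑ l : halfFrequencySet d n, ((l.1 k : ℝ) * l.1 k) * (d / n * (s ^ 2 *
        ∫ x in unitCube d, (torusChar l.1 x * ξ l).re * (torusChar l.1 x * ξ l).re)) := by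
    intro k
    have h1 : ∀ x, ⟪waveVecDeriv n k x, ξ⟫ ^ 2 =
        ∑ l : halfFrequencySet d n, ∑ l' : halfFrequencySet d n,
        ((l.1 k : ℝ) * l'.1 k) * (d / n * s ^ 2) *
          ((torusChar l.1 x * ξ l).im * (torusChar l'.1 x * ξ l').im) := by
      intro x
      rw [inner_waveVecDeriv_right, ← hs, mul_pow, sq (∑ l, _), Finset.sum_mul_sum, Finset.mul_sum]
      simp only [Finset.mul_sum]
      refine Finset.sum_congr rfl fun l _ => Finset.sum_congr rfl fun l' _ => ?_
      have h2 : √((n : ℝ) / d) * √((n : ℝ) / d) = n / d := Real.mul_self_sqrt (by positivity)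
      have h3 : ∀ p q r u v w : ℝ, w * (-(p / r) * u * (-(q / r) * v)) =
          p * q * (1 / (r * r) * w) * (u * v) := fun p q r u v w => by
        rw [one_div, mul_inv]; ring
      rw [h3, h2, one_div_div]
    simp only [h1]
    rw [integral_finsetSum _ fun l _ => integrable_finsetSum _ fun l' _ => hiim l l' _]
    refine Finset.sum_congr rfl fun l _ => ?_
    rw [integral_finsetSum _ fun l' _ => hiim l l' _,
      Finset.sum_eq_single l _ (by simp), integral_const_mul, (hpair l l).1]
    · ring
    · intro l' _ h
      rw [integral_const_mul, (hpair l l').1, hzero l l' h, mul_zero]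
  simp only [hW]
  rw [Finset.sum_comm, hV, Finset.mul_sum]
  refine Finset.sum_congr rfl fun l _ => ?_
  rw [← Finset.sum_mul, sum_mul_eq_of_mem_frequencySet (mem_frequencySet_of_mem_half l.2),
    ← mul_assoc, mul_div_cancel₀ _ hn0.ne']

end CubeIntegrals

/-! ### Zeros of the wave along coordinate axes -/

section AxisZeros

variable {d n : ℕ}

theorem torusChar_add_smul_single (l : Fin d → ℤ) (x : EuclideanSpace ℝ (Fin d)) (k : Fin d)
    (t : ℝ) : torusChar l (x + t • EuclideanSpace.single k 1) =
      torusChar l x * Complex.exp (2 * Real.pi * Complex.I * t) ^ l k := by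
  rw [torusChar, torusChar, ← Complex.exp_int_mul, ← Complex.exp_add]
  congr 1
  have h : ∑ i, (l i : ℝ) * (x + t • EuclideanSpace.single k 1 : EuclideanSpace ℝ (Fin d)) i =
      ∑ i, (l i : ℝ) * x i + l k * t := by
    simp [mul_add, Finset.sum_add_distrib]
  rw [h]
  push_cast
  ring

theorem injOn_exp_two_pi : Set.InjOn
    (fun t : ℝ => Complex.exp (2 * Real.pi * Complex.I * t)) (Set.Ico 0 1) := by
  intro s hs t ht h
  obtain ⟨m, hm⟩ := Complex.exp_eq_exp_iff_exists_int.1 h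
  have h1 : (2 * Real.pi * Complex.I : ℂ) ≠ 0 := by simp [Real.pi_ne_zero]
  have h2 : (s : ℂ) = t + m := mul_left_cancel₀ h1 (by rw [hm]; ring)
  have h3 : s = t + m := by exact_mod_cast h2
  have h4 : (m : ℝ) < 1 := by linarith [hs.2, ht.1]
  have h5 : (-1 : ℝ) < m := by linarith [hs.1, ht.2]
  have h6 : m = 0 := by
    have h4' : m < 1 := by exact_mod_cast h4
    have h5' : -1 < m := by exact_mod_cast h5
    omega
  rw [h3, h6]
  simp

/-- Along a coordinate axis the field is a trigonometric polynomial of degree at most `n`. -/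
theorem axisZerosLE_inner_waveVec (ξ : CoeffSpace d n) :
    AxisZerosLE (fun x => ⟪waveVec n x, ξ⟫) (2 * n) := by
  classical
  intro k x ⟨t₀, ht₀⟩ F hF
  set s := √(2 / (frequencySet d n).card : ℝ)
  let b : halfFrequencySet d n → ℂ := fun l => torusChar l.1 x * ξ l
  let e : ℝ → ℂ := fun t => Complex.exp (2 * Real.pi * Complex.I * t)
  -- With z = exp(2πit), the restriction to the line is up to a constant a Laurent polynomial in z
  -- with exponents in [-n, n]. Multiplying it by z^n gives Q, of degree at most 2n, whose roots
  -- account for the zeros.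
  let Q : Polynomial ℂ := ∑ l : halfFrequencySet d n,
    (Polynomial.C (b l) * Polynomial.X ^ ((n : ℤ) + l.1 k).toNat +
      Polynomial.C (starRingEnd ℂ (b l)) * Polynomial.X ^ ((n : ℤ) - l.1 k).toNat)
  have hbd : ∀ l : halfFrequencySet d n, -(n : ℤ) ≤ l.1 k ∧ l.1 k ≤ n := fun l => by
    have h := mem_frequencySet_of_mem_half l.2
    rw [frequencySet, Finset.mem_filter, Fintype.mem_piFinset] at h
    exact Finset.mem_Icc.1 (h.1 k)
  have hdeg : Q.natDegree ≤ 2 * n := by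
    refine Polynomial.natDegree_sum_le_of_forall_le _ _ fun l _ => ?_
    refine (Polynomial.natDegree_add_le _ _).trans (max_le ?_ ?_)
    · refine (Polynomial.natDegree_C_mul_X_pow_le _ _).trans ?_
      have := hbd l
      omega
    · refine (Polynomial.natDegree_C_mul_X_pow_le _ _).trans ?_
      have := hbd l
      omega
  have hne : ∀ t, e t ≠ 0 := fun t => Complex.exp_ne_zero _
  have hconj : ∀ t, starRingEnd ℂ (e t) = (e t)⁻¹ := fun t => by
    simp only [e]
    rw [← Complex.exp_conj, ← Complex.exp_neg]
    congr 1
    simp [Complex.conj_ofNat]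
  have hQ : ∀ t : ℝ, Q.eval (e t) = e t ^ n *
      ((2 * ∑ l : halfFrequencySet d n,
        (torusChar l.1 (x + t • EuclideanSpace.single k 1) * ξ l).re : ℝ) : ℂ) := by
    intro t
    simp only [Q, Polynomial.eval_finsetSum, Polynomial.eval_add, Polynomial.eval_mul,
      Polynomial.eval_C, Polynomial.eval_pow, Polynomial.eval_X]
    push_cast
    rw [Finset.mul_sum, Finset.mul_sum]
    refine Finset.sum_congr rfl fun l _ => ?_
    have h1 : (e t) ^ ((n : ℤ) + l.1 k).toNat = e t ^ n * e t ^ (l.1 k) := by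
      rw [← zpow_natCast, Int.toNat_of_nonneg (by linarith [hbd l]), zpow_add₀ (hne t),
        zpow_natCast]
    have h2 : (e t) ^ ((n : ℤ) - l.1 k).toNat = e t ^ n * (e t)⁻¹ ^ (l.1 k) := by
      rw [← zpow_natCast, Int.toNat_of_nonneg (by linarith [hbd l]), zpow_sub₀ (hne t),
        zpow_natCast, inv_zpow, div_eq_mul_inv]
    have h3 : torusChar l.1 (x + t • EuclideanSpace.single k 1) * ξ l = b l * e t ^ (l.1 k) := by
      rw [torusChar_add_smul_single]
      simp only [b, e]
      ring
    have h4 : ((2 : ℂ) * ((b l * e t ^ (l.1 k)).re : ℂ)) =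
        b l * e t ^ (l.1 k) + starRingEnd ℂ (b l) * (e t)⁻¹ ^ (l.1 k) := by
      have := Complex.add_conj (b l * e t ^ (l.1 k))
      rw [map_mul, map_zpow₀, hconj] at this
      rw [this]
      push_cast
      rfl
    rw [h1, h2, h3, h4]
    ring
  have hQ0 : Q ≠ 0 := by
    intro h0
    have h1 := hQ t₀
    rw [h0, Polynomial.eval_zero] at h1
    have h2 := (mul_eq_zero.1 h1.symm).resolve_left (pow_ne_zero _ (hne t₀))
    have h3 := (mul_eq_zero.1 (Complex.ofReal_eq_zero.1 h2)).resolve_left two_ne_zero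
    exact ht₀ (by simp only [inner_waveVec, h3, mul_zero])
  have hs : s ≠ 0 := fun h0 => ht₀ (by
    simp only [inner_waveVec]
    rw [show √(2 / (frequencySet d n).card : ℝ) = 0 from h0, zero_mul])
  have hroot : ∀ t ∈ F, e t ∈ Q.roots.toFinset := fun t ht => by
    rw [Multiset.mem_toFinset, Polynomial.mem_roots hQ0, Polynomial.IsRoot, hQ]
    have h1 := (hF t ht).2
    simp only [inner_waveVec] at h1
    rw [(mul_eq_zero.1 h1).resolve_left hs]
    simp
  calc F.card ≤ Q.roots.toFinset.card := Finset.card_le_card_of_injOn e hroot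
        fun u hu v hv h => injOn_exp_two_pi (hF u hu).1 (hF v hv).1 h
    _ ≤ Multiset.card Q.roots := Multiset.toFinset_card_le _
    _ ≤ Q.natDegree := Polynomial.card_roots' _
    _ ≤ 2 * n := hdeg

end AxisZeros

end ArithmeticWave

/-! ### Assembly of the theorem -/

theorem mainTheorem2 {Ω : Type*} [MeasurableSpace Ω] (P : Measure Ω) [IsProbabilityMeasure P]
    (d n : ℕ) (hd : 2 ≤ d) (hn : 1 ≤ n) (hS : (frequencySet d n).Nonempty)
    (a : (Fin d → ℤ) → Ω → ℂ) (ha : IsGaussianCoeff P n a) :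
    -- the nodal volume is almost surely finite and square integrable
    (∀ᵐ ω ∂P, nodalVolume n a ω ≠ ⊤) ∧
    ∃ hV : MemLp (fun ω => (nodalVolume n a ω).toReal) 2 P,
      -- the projection on the chaos of order zero is the expectation
      chaosProj P n a 0 hV.toLp = Lp.const 2 P (∫ ω, (nodalVolume n a ω).toReal ∂P) ∧
      -- `V = E[V] + ∑_{q ≥ 1} V[q]` in `L²(P)`
      HasSum (fun q : ℕ => chaosProj P n a (q + 1) hV.toLp)
        (hV.toLp - Lp.const 2 P (∫ ω, (nodalVolume n a ω).toReal ∂P)) ∧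
      -- odd-order projections vanish
      (∀ q : ℕ, chaosProj P n a (2 * q + 1) hV.toLp = 0) ∧
      -- even-order projections
      (∀ q : ℕ, 1 ≤ q → chaosProj P n a (2 * q) hV.toLp =ᵐ[P] evenChaosFormula n a q) ∧
      -- the second-order projection vanishes
      chaosProj P n a 2 hV.toLp = 0 ∧
      -- `β_k` are the coefficients of the (formal) Hermite expansion of the Dirac mass at zero
      (∀ k : ℕ, Tendsto (fun ε : ℝ => 1 / (2 * ε) *
          ∫ t in (-ε)..ε, hermiteFun k t * (Real.exp (-t ^ 2 / 2) / Real.sqrt (2 * Real.pi)))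
        (𝓝[>] 0) (𝓝 (betaCoeff k))) ∧
      -- `a(2s)` are the coefficients of the Hermite expansion of the Euclidean norm
      (∀ s : Fin d → ℕ, normCoeff s = normHermiteCoeff fun k => 2 * s k) := by
  have hd1 : 1 ≤ d := by omega
  have hv := isIsotropicFrame_waveVec hd1 hn hS
  have hm := isGaussianModel_coeffVec hn ha
  have hnt : Nontrivial (CoeffSpace d n) := by
    refine ⟨waveVec n 0, 0, fun h0 => ?_⟩
    have h1 := inner_waveVec_self (d := d) hn hS 0
    rw [h0, inner_zero_left] at h1
    exact zero_ne_one h1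
  let Z : CoeffSpace d n → ℝ≥0∞ := fun ξ =>
    μHE[d - 1] {x | x ∈ unitCube d ∧ inner ℝ (waveVec n x) ξ = 0}
  have hZ : Measurable Z := hv.measurable_zeroMeasure (d - 1) (isSigmaCompact_unitCube d)
  have hVZ : ∀ ω, nodalVolume n a ω = Z (coeffVec n a ω) := fun ω => by
    simp only [nodalVolume, Z, wave_eq_inner hn ha]
  obtain ⟨C, hC⟩ := hv.exists_zeroMeasure_le hd1 axisZerosLE_inner_waveVec
  have hCP : ∀ᵐ ω ∂P, Z (coeffVec n a ω) ≤ C := by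
    rw [← hm.hasLaw.map_eq] at hC
    exact ae_of_ae_map hm.hasLaw.aemeasurable hC
  have hfin : ∀ᵐ ω ∂P, nodalVolume n a ω ≠ ⊤ := by
    filter_upwards [hCP] with ω hω
    rw [hVZ]
    exact (hω.trans_lt ENNReal.coe_lt_top).ne
  have hV : MemLp (fun ω => (nodalVolume n a ω).toReal) 2 P := by
    simp only [hVZ]
    refine MemLp.of_bound
      (hZ.ennreal_toReal.comp_aemeasurable hm.hasLaw.aemeasurable).aestronglyMeasurable C ?_
    filter_upwards [hCP] with ω hω
    rw [Real.norm_of_nonneg ENNReal.toReal_nonneg]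
    exact ENNReal.toReal_mono ENNReal.coe_ne_top hω
  have hF : (hV.toLp : Lp ℝ 2 P) =ᵐ[P] fun ω => (Z (coeffVec n a ω)).toReal := by
    filter_upwards [hV.coeFn_toLp] with ω hω
    rw [hω, hVZ]
  have hproj := fun q => hm.chaosProj_zeroMeasure hv
    (hC.mono fun ξ hξ => hξ.trans_lt ENNReal.coe_lt_top) hF q
  have hzero : chaosProj P n a 0 hV.toLp =
      Lp.const 2 P (∫ ω, (nodalVolume n a ω).toReal ∂P) := by
    rw [hm.chaosProj_zero, integral_congr_ae hV.coeFn_toLp]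
  have hvanish : ∀ q, (∀ ξ, chaosComponent (waveVec n) (waveVecDeriv n)
      (2 * Real.pi * √((n : ℝ) / d)) q (ξ : CoeffSpace d n) = 0) →
      chaosProj P n a q hV.toLp = 0 := by
    intro q hq
    rw [hproj, ← MemLp.toLp_zero (MemLp.zero' : MemLp (fun _ : Ω => (0 : ℝ)) 2 P)]
    exact MemLp.toLp_congr _ _ (ae_of_all _ fun ω => hq _)
  refine ⟨hfin, hV, hzero, ?_, fun q => hvanish _ fun ξ => chaosComponent_odd q ξ, ?_, ?_,
    tendsto_betaCoeff, fun s => normCoeff_eq_normHermiteCoeff hd1 s⟩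
  · have hsum : HasSum (fun q => chaosProj P n a q hV.toLp) hV.toLp := by
      -- Totality is available for bounded functions of the Gaussian vector; truncating at the
      -- almost sure bound C changes nothing almost surely.
      refine hm.hasSum_chaosProj (g := fun ξ => min (Z ξ).toReal C)
        (hZ.ennreal_toReal.min measurable_const) (C := C) (fun ξ => ?_) ?_
      · have h0 : 0 ≤ min (Z ξ).toReal (C : ℝ) := le_min ENNReal.toReal_nonneg C.2
        exact (abs_of_nonneg h0).trans_le (min_le_right _ _)
      · filter_upwards [hF, hCP] with ω hω hω'
        have h1 : (Z (coeffVec n a ω)).toReal ≤ (C : ℝ) :=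
          ENNReal.toReal_mono ENNReal.coe_ne_top hω'
        rw [hω, min_eq_left h1]
    -- The expectation is the term of order zero; removing it shifts the index by one.
    rw [← hzero]
    simpa using (hasSum_nat_add_iff' 1).2 hsum
  · intro q _
    rw [hproj]
    filter_upwards [(hm.memLp_chaosComponent hv (2 * q)).coeFn_toLp] with ω hω
    rw [hω, chaosComponent_even hd1, evenChaosFormula]
    simp only [wave_eq_inner hn ha, waveDeriv_eq_inner hd1 hn hS ha]
  · exact hvanish 2 fun ξ => chaosComponent_two hd1 ξ
      (integrableOn_unitCube ((continuous_inner_waveVec ξ).pow 2))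
      (fun j => integrableOn_unitCube ((continuous_inner_waveVecDeriv j ξ).pow 2))
      (sum_integral_inner_waveVecDeriv_sq hd1 hn ξ)
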